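/- **Lemma (Parallel Transport Equation).** Let $M$ be a smooth (finite-dimensional, Hausdorff) manifold with a smooth connection $\nabla$ on $TM$, possibly with torsion, and let $p\in M$. Let $R_{X,Y}Z=\nabla_X\nabla_YZ-\nabla_Y\nabla_XZ-\nabla_{[X,Y]}Z$ and $T(X,Y)=\nabla_XY-\nabla_YX-[X,Y]$ be its curvature and torsion. For $X\in T_pM$ let $\gamma^X$ be the geodesic with $\gamma^X(0)=p$ and $\dot\gamma^X(0)=X$; put $\exp_pX=\gamma^X(1)$ wherever $\gamma^X$ exists up to time $1$, let $\mathbf{PT}^\nabla(X):T_pM\to T_{\exp_pX}M$ be the parallel transport along $\gamma^X$ from time $0$ to time $1$, and let $$\Phi^{-1}(X)\;:=\;\mathbf{PT}^\nabla(X)^{-1}\circ(\exp_p)_{*,X}\;\in\;\mathrm{End}\,T_pM,\qquad T_pM\cong T_X(T_pM),$$ be the backward parallel transport. Then $\exp_p$ is defined in a neighbourhood of $0\in T_pM$, the map $\Phi^{-1}$ is smooth at $0$, and its infinite order Taylor series at $0$ is the unique formal power series $\Phi^{-1}\in\overline{\mathrm{Sym}}\,T_p^*M\otimes\mathrm{End}\,T_pM$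 with $$N(N+1)\,\Phi^{-1}\;=\;\mathscr R\,\Phi^{-1}\;+\;N(\mathscr T\,\Phi^{-1}),\qquad \Phi^{-1}(0)=\mathrm{id}.$$ Here $N$ is the number operator, which multiplies the homogeneous component of degree $k$ by $k$; products of $\mathrm{End}\,T_pM$-valued power series are formed with the composition of endomorphisms; and $$\mathscr R(X)Y:=\sum_{k\ge0}\frac1{k!}\,(\nabla^k_{X,\dots,X}R)_{X,Y}X,\qquad \mathscr T(X)Y:=\sum_{k\ge0}\frac1{k!}\,(\nabla^k_{X,\dots,X}T)(X,Y),$$ where $\nabla^kR$ and $\nabla^kT$ are the iterated covariant derivatives, evaluated at $p$. -/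

import Mathlib

open Filter Topology Bundle
open scoped Manifold ContDiff Nat

set_option linter.unusedSectionVars false

noncomputable section

/-! ## Formal power series on a vector space -/

/-- A formal power series on a real vector space `V` with values in `W`, that is, an element of the
completed tensor product of `Sym V*` with `W` (for finite-dimensional `V`). Its component of degree
`k` is a homogeneous polynomial map of degree `k`, the restriction of a `k`-linear map to the
diagonal. -/
@[ext]
structure FormalSeries (V W : Type*) [AddCommGroup V] [Module ℝ V] [AddCommGroup W]
    [Module ℝ W] where
  /-- the homogeneous component of degree `k`, as a function on `V` -/
  coeff : ℕ → V → W
  homogeneous : ∀ k, ∃ m : MultilinearMap ℝ (fun _ : Fin k => V) W,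
    ∀ X, coeff k X = m (fun _ => X)

namespace FormalSeries

section Module

variable {V W : Type*} [AddCommGroup V] [Module ℝ V] [AddCommGroup W] [Module ℝ W]

instance : Add (FormalSeries V W) where
  add F G :=
    { coeff := fun k X => F.coeff k X + G.coeff k X
      homogeneous := fun k => by
        obtain ⟨m, hm⟩ := F.homogeneous k
        obtain ⟨m', hm'⟩ := G.homogeneous k
        exact ⟨m + m', fun X => by simp [hm, hm']⟩ }

/-- The number operator `N`: it multiplies the component of degree `k` by `k`. -/
def number (F : FormalSeries V W) : FormalSeries V W where
  coeff k X := (k : ℝ) • F.coeff k X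
  homogeneous k := by
    obtain ⟨m, hm⟩ := F.homogeneous k
    exact ⟨(k : ℝ) • m, fun X => by simp [hm]⟩

end Module

section Algebra

variable {V W : Type*} [AddCommGroup V] [Module ℝ V] [Ring W] [Algebra ℝ W]

/-- The product of power series with values in an algebra (below: endomorphisms, multiplied by
composition). -/
instance : Mul (FormalSeries V W) where
  mul F G :=
    { coeff := fun k X => ∑ ij ∈ Finset.HasAntidiagonal.antidiagonal k, F.coeff ij.1 X * G.coeff ij.2 X
      homogeneous := fun k => by
        choose f hf using F.homogeneous
        choose g hg using G.homogeneous
        refine ⟨∑ ij : Finset.HasAntidiagonal.antidiagonal k,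
          ((LinearMap.mul' ℝ W).compMultilinearMap
            ((f ij.1.1).domCoprod (g ij.1.2))).domDomCongr
              (finSumFinEquiv.trans (finCongr (Finset.HasAntidiagonal.mem_antidiagonal.mp ij.2))), fun X => ?_⟩
        rw [← Finset.sum_coe_sort]
        simp [hf, hg] }

end Algebra

section Taylor

variable {E F : Type*} [NormedAddCommGroup E] [NormedSpace ℝ E] [NormedAddCommGroup F]
  [NormedSpace ℝ F]

/-- The infinite order Taylor series at the origin of a map between normed spaces: its component of
degree `k` is `X ↦ (1 / k!) D^k f(0)(X, …, X)`. -/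
def taylor (f : E → F) : FormalSeries E F where
  coeff k X := (k ! : ℝ)⁻¹ • iteratedFDeriv ℝ k f 0 (fun _ => X)
  homogeneous k := ⟨(k ! : ℝ)⁻¹ • (iteratedFDeriv ℝ k f 0).toMultilinearMap, fun X => by simp⟩

end Taylor

end FormalSeries

/-! ## Affine manifolds -/

namespace AffineManifold

section Basic

variable (E : Type*) [NormedAddCommGroup E] [NormedSpace ℝ E]
  (M : Type*) [TopologicalSpace M] [ChartedSpace E M] [IsManifold 𝓘(ℝ, E) ∞ M]

/-- A connection on the tangent bundle of `M`. -/
abbrev Connection := CovariantDerivative 𝓘(ℝ, E) E (TangentSpace 𝓘(ℝ, E) : M → Type _)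

/-- The space of smooth vector fields on `M`. -/
abbrev VField :=
  ContMDiffSection 𝓘(ℝ, E) E ∞ (TangentSpace 𝓘(ℝ, E) : M → Type _)

/-- Tensor fields of type `(n, 1)` as `n`-linear maps from vector fields to vector fields. -/
abbrev TField (n : ℕ) :=
  MultilinearMap ℝ (fun _ : Fin n => VField E M) (VField E M)

end Basic

variable {E : Type*} [NormedAddCommGroup E] [NormedSpace ℝ E]
  {M : Type*} [TopologicalSpace M] [ChartedSpace E M]

instance [FiniteDimensional ℝ E] (x : M) : FiniteDimensional ℝ (TangentSpace 𝓘(ℝ, E) x) :=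
  inferInstanceAs (FiniteDimensional ℝ E)

instance (x : M) : T2Space (TangentSpace 𝓘(ℝ, E) x) :=
  inferInstanceAs (T2Space E)

section Curvature

variable [IsManifold 𝓘(ℝ, E) ∞ M]

instance : IsManifold 𝓘(ℝ, E) (minSmoothness ℝ 2) M := by
  simp only [minSmoothness_of_isRCLikeNormedField]; infer_instance

theorem VField.mdifferentiableAt (X : VField E M) (x : M) :
    MDiffAt (T% (fun y => X y)) x :=
  (X.contMDiff x).mdifferentiableAt (by simp)

/-- The covariant derivative `∇_X Y` of smooth vector fields, as a bilinear map. -/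
def nabla (cov : Connection E M) [CovariantDerivative.ContMDiffCovariantDerivative cov ∞] :
    VField E M →ₗ[ℝ] VField E M →ₗ[ℝ] VField E M :=
  LinearMap.mk₂ ℝ
    (fun X Y => ⟨fun x => cov (fun y => Y y) x (X x), by
      have h := (CovariantDerivative.ContMDiffCovariantDerivative.contMDiff (cov := cov) (k := ∞)).contMDiff
        (σ := fun y => Y y) (Y.contMDiff.contMDiffOn)
      rw [contMDiffOn_univ] at h
      exact ContMDiff.clm_bundle_apply h X.contMDiff⟩)
    (fun X X' Y => by ext x; simp)
    (fun c X Y => by ext x; simp)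
    (fun X Y Y' => by
      ext x
      have h := cov.isCovariantDerivativeOnUniv.add (Y.mdifferentiableAt x)
        (Y'.mdifferentiableAt x)
      exact congrArg (fun L => L (X x)) h)
    (fun c X Y => by
      ext x
      have h := cov.isCovariantDerivativeOnUniv.smul_const c (Y.mdifferentiableAt x)
      exact congrArg (fun L => L (X x)) h)

variable [FiniteDimensional ℝ E]

/-- The Lie bracket `[X, Y]` of smooth vector fields, as a bilinear map. -/
def lie : VField E M →ₗ[ℝ] VField E M →ₗ[ℝ] VField E M :=
  LinearMap.mk₂ ℝ
    (fun X Y => ⟨VectorField.mlieBracket 𝓘(ℝ, E) (fun y => X y) (fun y => Y y), by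
      have : IsManifold 𝓘(ℝ, E) (((⊤ : ℕ∞) : ℕ∞ω) + 1) M := by simpa
      intro x
      exact ContMDiffAt.mlieBracket_vectorField (m := ⊤) (n := ⊤) (X.contMDiff x) (Y.contMDiff x)
        (by simp)⟩)
    (fun X X' Y => by
      ext x
      exact VectorField.mlieBracket_add_left (X.mdifferentiableAt x) (X'.mdifferentiableAt x))
    (fun c X Y => by
      ext x
      exact VectorField.mlieBracket_const_smul_left (X.mdifferentiableAt x))
    (fun X Y Y' => by
      ext x
      exact VectorField.mlieBracket_add_right (Y.mdifferentiableAt x) (Y'.mdifferentiableAt x))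
    (fun c X Y => by
      ext x
      exact VectorField.mlieBracket_const_smul_right (Y.mdifferentiableAt x))

/-- The torsion `T(X, Y) = ∇_X Y - ∇_Y X - [X, Y]`. -/
def torsionTensor (cov : Connection E M) [CovariantDerivative.ContMDiffCovariantDerivative cov ∞] : TField E M 2 :=
  MultilinearMap.mk'
    (fun v => nabla cov (v 0) (v 1) - nabla cov (v 1) (v 0) - lie (v 0) (v 1))
    (fun v i X Y => by fin_cases i <;> simp <;> abel)
    (fun v i c X => by fin_cases i <;> simp [smul_sub])

/-- The curvature `R_{X, Y} Z = ∇_X ∇_Y Z - ∇_Y ∇_X Z - ∇_{[X, Y]} Z`. -/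
def curvatureTensor (cov : Connection E M) [CovariantDerivative.ContMDiffCovariantDerivative cov ∞] : TField E M 3 :=
  MultilinearMap.mk'
    (fun v => nabla cov (v 0) (nabla cov (v 1) (v 2)) - nabla cov (v 1) (nabla cov (v 0) (v 2))
      - nabla cov (lie (v 0) (v 1)) (v 2))
    (fun v i X Y => by fin_cases i <;> simp [Function.update] <;> abel)
    (fun v i c X => by fin_cases i <;> simp [Function.update, smul_sub])

theorem compLinearMap_update {n : ℕ} (S : TField E M n) (i : Fin n)
    (D : VField E M →ₗ[ℝ] VField E M) (v : Fin n → VField E M) :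
    S (fun j => (Function.update (fun _ : Fin n => LinearMap.id) i D j) (v j)) =
      S (Function.update v i (D (v i))) := by
  congr 1
  ext1 j
  by_cases h : j = i
  · subst h; simp
  · simp [h]

/-- The covariant derivative `∇S` of a tensor field,
`(∇S)(X, Y₁, …, Yₙ) = ∇_X (S(Y₁, …, Yₙ)) - ∑ᵢ S(Y₁, …, ∇_X Yᵢ, …, Yₙ)`. -/
def covDeriv (cov : Connection E M) [CovariantDerivative.ContMDiffCovariantDerivative cov ∞]
    {n : ℕ} (S : TField E M n) : TField E M (n + 1) :=
  LinearMap.uncurryLeft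
    { toFun := fun X => (nabla cov X).compMultilinearMap S -
        ∑ i, S.compLinearMap (Function.update (fun _ => LinearMap.id) i (nabla cov X))
      map_add' := fun X X' => by
        ext1 v
        simp [compLinearMap_update, Finset.sum_add_distrib]
        abel
      map_smul' := fun c X => by
        ext1 v
        simp [compLinearMap_update, smul_sub, Finset.smul_sum] }

theorem covDeriv_apply (cov : Connection E M)
    [CovariantDerivative.ContMDiffCovariantDerivative cov ∞] {n : ℕ} (S : TField E M n)
    (X : VField E M) (Y : Fin n → VField E M) :
    covDeriv cov S (Fin.cons X Y) =
      nabla cov X (S Y) - ∑ i, S (Function.update Y i (nabla cov X (Y i))) := by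
  simp [covDeriv, compLinearMap_update]

/-- The `k`-fold iterated covariant derivative `∇ᵏS`; the `k` directions of differentiation occupy
the first `k` slots, so that `(∇ᵏS)(X₁, …, X_k, Y₁, …, Yₙ) = (∇ᵏ_{X₁, …, X_k} S)(Y₁, …, Yₙ)`. -/
def iterCovDeriv (cov : Connection E M) [CovariantDerivative.ContMDiffCovariantDerivative cov ∞]
    {n : ℕ} (S : TField E M n) : (k : ℕ) → TField E M (n + k)
  | 0 => S
  | k + 1 => covDeriv cov (iterCovDeriv cov S k)

theorem extend_eq_symmₗ (p : M) {x : M} (hx : x ∈ (chartAt E p).source)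
    (v : TangentSpace 𝓘(ℝ, E) p) :
    FiberBundle.extend E v x =
      (trivializationAt E (TangentSpace 𝓘(ℝ, E)) p).symmₗ ℝ x
        ((trivializationAt E (TangentSpace 𝓘(ℝ, E)) p).linearMapAt ℝ p v) := by
  rw [Trivialization.symmₗ_apply _ (by simpa using hx), Trivialization.coe_linearMapAt_of_mem _
    (FiberBundle.mem_baseSet_trivializationAt' p)]
  rfl

theorem bump_eq_zero (p : M) {x : M} (hx : x ∉ (chartAt E p).source) :
    Classical.arbitrary (SmoothBumpFunction 𝓘(ℝ, E) p) x = 0 := by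
  by_contra h
  exact hx (SmoothBumpFunction.support_subset_source _ h)

variable [T2Space M]

/-- A linear extension of tangent vectors at `p` to smooth vector fields on `M`: the vector is
extended as a constant one in the trivialization of `TM` around `p`, and cut off. -/
def extendVector (p : M) : TangentSpace 𝓘(ℝ, E) p →ₗ[ℝ] VField E M where
  toFun v :=
    ⟨fun x => Classical.arbitrary (SmoothBumpFunction 𝓘(ℝ, E) p) x •
      FiberBundle.extend E v x, by
      refine ContMDiffOn.smul_section_of_tsupport (u := (chartAt E p).source)
        (Classical.arbitrary (SmoothBumpFunction 𝓘(ℝ, E) p)).contMDiff.contMDiffOn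
        (chartAt E p).open_source
        (Classical.arbitrary (SmoothBumpFunction 𝓘(ℝ, E) p)).tsupport_subset_chartAt_source ?_
      intro x hx
      rw [(trivializationAt E (TangentSpace 𝓘(ℝ, E)) p).contMDiffWithinAt_section _
        (by simpa using hx)]
      refine (contMDiffOn_const
        (c := (trivializationAt E (TangentSpace 𝓘(ℝ, E)) p ⟨p, v⟩).2)).congr ?_ x hx
      intro y hy
      have hy' : y ∈ (trivializationAt E (TangentSpace 𝓘(ℝ, E)) p).baseSet := by simpa using hy
      simp only [FiberBundle.extend]
      rw [Trivialization.apply_mk_symm _ hy']⟩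
  map_add' v w := by
    ext x
    by_cases hx : x ∈ (chartAt E p).source
    · simp [extend_eq_symmₗ p hx]
    · simp [bump_eq_zero p hx]
  map_smul' c v := by
    ext x
    by_cases hx : x ∈ (chartAt E p).source
    · simp [extend_eq_symmₗ p hx, smul_comm c]
    · simp [bump_eq_zero p hx]

theorem extendVector_apply_self (p : M) (v : TangentSpace 𝓘(ℝ, E) p) :
    extendVector p v p = v := by
  simp [extendVector]

/-- The value at `p` of a tensor field, as a multilinear map on the tangent space at `p`. -/
def TField.evalAt {n : ℕ} (S : TField E M n) (p : M) :
    MultilinearMap ℝ (fun _ : Fin n => TangentSpace 𝓘(ℝ, E) p) (TangentSpace 𝓘(ℝ, E) p) where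
  toFun v := S (fun i => extendVector p (v i)) p
  map_update_add' v i x y := by
    have h := fun z => Function.comp_update (extendVector (E := E) p) v i z
    simp only [Function.comp_def] at h
    simp [h]
  map_update_smul' v i c x := by
    have h := fun z => Function.comp_update (extendVector (E := E) p) v i z
    simp only [Function.comp_def] at h
    simp [h]

/-- For a multilinear map `S` on `V` and a slot `i`, the endomorphism `Y ↦ S(X, …, X, Y, X, …, X)`
with `Y` in the slot `i`. -/
def slotEnd {p : M} {n : ℕ}
    (S : MultilinearMap ℝ (fun _ : Fin n => TangentSpace 𝓘(ℝ, E) p) (TangentSpace 𝓘(ℝ, E) p))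
    (i : Fin n) (X : TangentSpace 𝓘(ℝ, E) p) :
    TangentSpace 𝓘(ℝ, E) p →L[ℝ] TangentSpace 𝓘(ℝ, E) p :=
  (S.toLinearMap (fun _ => X) i).toContinuousLinearMap

theorem slotEnd_homogeneous {p : M} {n d : ℕ} (h : n = d + 1)
    (S : MultilinearMap ℝ (fun _ : Fin n => TangentSpace 𝓘(ℝ, E) p) (TangentSpace 𝓘(ℝ, E) p))
    (i : Fin n) :
    ∃ m : MultilinearMap ℝ (fun _ : Fin d => TangentSpace 𝓘(ℝ, E) p)
      (TangentSpace 𝓘(ℝ, E) p →L[ℝ] TangentSpace 𝓘(ℝ, E) p),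
      ∀ X, slotEnd S i X = m (fun _ => X) := by
  subst h
  refine ⟨
    { toFun := fun v => LinearMap.toContinuousLinearMap
        { toFun := fun Y => S.curryMid i Y v
          map_add' := fun Y Y' => by simp
          map_smul' := fun c Y => by simp }
      map_update_add' := fun v j x y => by ext Y; simp
      map_update_smul' := fun v j c x => by ext Y; simp }, fun X => ?_⟩
  ext Y
  simp only [slotEnd, LinearMap.coe_toContinuousLinearMap', MultilinearMap.toLinearMap_apply,
    MultilinearMap.coe_mk, LinearMap.coe_mk, AddHom.coe_mk, MultilinearMap.curryMid_apply_apply]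
  congr 1
  ext1 j
  refine Fin.succAboveCases i ?_ (fun l => ?_) j <;> simp

/-- The power series `𝓡(X) Y = ∑ₖ (1 / k!) (∇ᵏ_{X, …, X} R)_{X, Y} X` at the point `p`. -/
def curvatureSeries (cov : Connection E M)
    [CovariantDerivative.ContMDiffCovariantDerivative cov ∞] (p : M) :
    FormalSeries (TangentSpace 𝓘(ℝ, E) p)
      (TangentSpace 𝓘(ℝ, E) p →L[ℝ] TangentSpace 𝓘(ℝ, E) p) where
  coeff
    | 0, _ => 0
    | 1, _ => 0
    | k + 2, X => (k ! : ℝ)⁻¹ •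
        slotEnd ((iterCovDeriv cov (curvatureTensor cov) k).evalAt p) ⟨k + 1, by omega⟩ X
  homogeneous
    | 0 => ⟨0, fun X => by simp⟩
    | 1 => ⟨0, fun X => by simp⟩
    | k + 2 => by
      obtain ⟨m, hm⟩ := slotEnd_homogeneous (d := k + 2) (by omega)
        ((iterCovDeriv cov (curvatureTensor cov) k).evalAt p) ⟨k + 1, by omega⟩
      exact ⟨(k ! : ℝ)⁻¹ • m, fun X => by simp [hm]⟩

/-- The power series `𝓣(X) Y = ∑ₖ (1 / k!) (∇ᵏ_{X, …, X} T)(X, Y)` at the point `p`. -/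
def torsionSeries (cov : Connection E M)
    [CovariantDerivative.ContMDiffCovariantDerivative cov ∞] (p : M) :
    FormalSeries (TangentSpace 𝓘(ℝ, E) p)
      (TangentSpace 𝓘(ℝ, E) p →L[ℝ] TangentSpace 𝓘(ℝ, E) p) where
  coeff
    | 0, _ => 0
    | k + 1, X => (k ! : ℝ)⁻¹ •
        slotEnd ((iterCovDeriv cov (torsionTensor cov) k).evalAt p) ⟨k + 1, by omega⟩ X
  homogeneous
    | 0 => ⟨0, fun X => by simp⟩
    | k + 1 => by
      obtain ⟨m, hm⟩ := slotEnd_homogeneous (d := k + 1) (by omega)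
        ((iterCovDeriv cov (torsionTensor cov) k).evalAt p) ⟨k + 1, by omega⟩
      exact ⟨(k ! : ℝ)⁻¹ • m, fun X => by simp [hm]⟩

end Curvature

/-! ## Geodesics, parallel transport and the exponential map -/

section Transport

variable [IsManifold 𝓘(ℝ, E) ∞ M]

/-- The covariant derivative `(∇/dt) V` at time `t` of a vector field `V` along a curve, given as a
curve in the tangent bundle; the underlying curve is `γ = (V ·).proj`. In the local trivialization
of `TM` around `γ t` it is the derivative of the components of `V` plus the covariant derivative
in the direction of `γ' t` of the vector field extending `V t` with constant components. -/
def covDerivAlong (cov : Connection E M) (V : ℝ → TangentBundle 𝓘(ℝ, E) M) (t : ℝ) :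
    TangentSpace 𝓘(ℝ, E) (V t).proj :=
  let e := trivializationAt E (TangentSpace 𝓘(ℝ, E)) (V t).proj
  e.symm (V t).proj (deriv (fun s => (e (V s)).2) t) +
    cov (FiberBundle.extend E (V t).2) (V t).proj
      (mfderiv 𝓘(ℝ, ℝ) 𝓘(ℝ, E) (fun s => (V s).proj) t (1 : ℝ))

/-- The velocity field of a curve, as a curve in the tangent bundle. -/
def velocity (γ : ℝ → M) (t : ℝ) : TangentBundle 𝓘(ℝ, E) M :=
  ⟨γ t, mfderiv 𝓘(ℝ, ℝ) 𝓘(ℝ, E) γ t (1 : ℝ)⟩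

/-- `γ` is a geodesic on (an open interval containing) `[0, 1]` with initial point `p` and initial
velocity `X`: it solves `(∇/dt) γ' = 0`. -/
def IsGeodesicFrom (cov : Connection E M) (p : M) (X : TangentSpace 𝓘(ℝ, E) p) (γ : ℝ → M) :
    Prop :=
  velocity γ 0 = (⟨p, X⟩ : TangentBundle 𝓘(ℝ, E) M) ∧
    ∃ ε > 0, ContMDiffOn 𝓘(ℝ, ℝ) 𝓘(ℝ, E) 2 γ (Set.Ioo (-ε) (1 + ε)) ∧
      ∀ t ∈ Set.Ioo (-ε) (1 + ε), covDerivAlong cov (velocity γ) t = 0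

/-- The domain of the exponential map `exp_p`: the tangent vectors `X` at `p` for which the geodesic
with initial velocity `X` exists up to time `1`. -/
def expDomain (cov : Connection E M) (p : M) : Set (TangentSpace 𝓘(ℝ, E) p) :=
  {X | ∃ γ : ℝ → M, IsGeodesicFrom cov p X γ}

open Classical in
/-- The geodesic `γ^X` with initial point `p` and initial velocity `X` (constant, by convention, for
`X` outside the domain of the exponential map). -/
def geodesic (cov : Connection E M) (p : M) (X : TangentSpace 𝓘(ℝ, E) p) : ℝ → M :=
  if h : ∃ γ : ℝ → M, IsGeodesicFrom cov p X γ then h.choose else fun _ => p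

/-- The exponential map `exp_p X = γ^X(1)`. -/
def expMap (cov : Connection E M) (p : M) (X : TangentSpace 𝓘(ℝ, E) p) : M :=
  geodesic cov p X 1

/-- `V` is a parallel vector field along the curve `γ` on (an open interval containing) `[0, 1]`. -/
def IsParallelAlong (cov : Connection E M) (γ : ℝ → M) (V : ℝ → TangentBundle 𝓘(ℝ, E) M) : Prop :=
  ∃ ε > 0, ContMDiffOn 𝓘(ℝ, ℝ) 𝓘(ℝ, E).tangent 1 V (Set.Ioo (-ε) (1 + ε)) ∧
    ∀ t ∈ Set.Ioo (-ε) (1 + ε), (V t).proj = γ t ∧ covDerivAlong cov V t = 0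

/-- `L` is the parallel transport along the radial geodesic `γ^X` from time `0` to time `1`: it maps
`V(0)` to `V(1)` for the parallel vector fields `V` along `γ^X`. -/
def IsRadialTransport (cov : Connection E M) (p : M) (X : TangentSpace 𝓘(ℝ, E) p)
    (L : TangentSpace 𝓘(ℝ, E) p →L[ℝ] TangentSpace 𝓘(ℝ, E) (expMap cov p X)) : Prop :=
  ∀ v, ∃ V : ℝ → TangentBundle 𝓘(ℝ, E) M, IsParallelAlong cov (geodesic cov p X) V ∧
    V 0 = ⟨p, v⟩ ∧ V 1 = ⟨expMap cov p X, L v⟩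

open Classical in
/-- The parallel transport `PT(X) : T_pM → T_{exp_p X}M` along the radial geodesic `γ^X`. -/
def radialTransport (cov : Connection E M) (p : M) (X : TangentSpace 𝓘(ℝ, E) p) :
    TangentSpace 𝓘(ℝ, E) p →L[ℝ] TangentSpace 𝓘(ℝ, E) (expMap cov p X) :=
  if h : ∃ L, IsRadialTransport cov p X L then h.choose else 0

/-- The differential `(exp_p)_{*, X} : T_pM ≅ T_X(T_pM) → T_{exp_p X}M` of the exponential map. -/
def expDifferential (cov : Connection E M) (p : M) (X : TangentSpace 𝓘(ℝ, E) p) :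
    TangentSpace 𝓘(ℝ, E) p →L[ℝ] TangentSpace 𝓘(ℝ, E) (expMap cov p X) :=
  mfderiv 𝓘(ℝ, E) 𝓘(ℝ, E) (fun Y : E => expMap cov p Y) X

/-- The backward parallel transport `Φ⁻¹(X) = PT(X)⁻¹ ∘ (exp_p)_{*, X} ∈ End T_pM`. -/
def backwardTransport (cov : Connection E M) (p : M) (X : TangentSpace 𝓘(ℝ, E) p) :
    TangentSpace 𝓘(ℝ, E) p →L[ℝ] TangentSpace 𝓘(ℝ, E) p :=
  (radialTransport cov p X).inverse.comp (expDifferential cov p X)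

/-- The infinite order Taylor series of the backward parallel transport at the origin of `T_pM`. -/
def backwardTransportSeries (cov : Connection E M) (p : M) :
    FormalSeries (TangentSpace 𝓘(ℝ, E) p)
      (TangentSpace 𝓘(ℝ, E) p →L[ℝ] TangentSpace 𝓘(ℝ, E) p) :=
  FormalSeries.taylor (E := E) (F := E →L[ℝ] E) (backwardTransport cov p)

end Transport

end AffineManifold

end

/-! The series of the backward parallel transport is the Taylor expansion of the Jacobi equation
along radial geodesics.

Fix `X ∈ T_pM`. For `Y ∈ T_pM`, the field `J(t) = (exp_p)_{*, tX} (t Y)` along the geodesic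
`t ↦ exp_p (t X)` is the variation field of the geodesics with initial velocities `X + s Y`. The
exchange of covariant derivatives in the directions `t` and `s` gives
`∇_t (∇_t J - T(γ', J)) = R(γ', J) γ'`. Transported back to `p`, covariant derivatives along the
geodesic become ordinary ones, and since `t Φ⁻¹(t X) Y` is `J(t)` transported back, this is the
equation `(t a)'' = ρ (t a) + (τ (t a))'` for the curve of endomorphisms `a(t) = Φ⁻¹(t X)`, with
the operators `ρ`, `τ` that are `R(γ', ·) γ'` and `T(γ', ·)` transported back
(`IsExpChart.deriv_backward`). In this equation times `t`, the coefficient of `tᵏ` is the component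
of degree `k` of the equation for `Φ⁻¹` (`TaylorSeries.coeff_taylor_of_jacobi`), once the Taylor
coefficients of `ρ` and `τ` are known to be iterated covariant derivatives of `R` and `T`.

The latter holds because the derivative, in a parallel frame, of a tensor evaluated on parallel
fields is its covariant derivative evaluated on the same fields. As the iterated covariant
derivatives are defined on vector fields on `M`, the tangent vectors at `p` are extended to vector
fields that are parallel along all radial geodesics near `p` (`exists_radially_parallel`);
tensoriality then removes the terms of the product rule in which such a field is differentiated,
and makes the result independent of the extension (`IsTensorial.congr`,
`iteratedDeriv_eq_slotEnd`).

All objects are computed in the preferred chart at `p`, with the Christoffel symbols of the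
connection there. The exponential map and the radial parallel transport are obtained together from
one differential equation that depends linearly on `X`; its solution is the fixed point of an
integral operator on continuous curves, and depends smoothly on `X` by the inverse function theorem
(`CurveSpace.exists_radial_solution`, `exists_isExpChart`). The uniqueness of geodesics and of
parallel fields identifies the result with the exponential map and the parallel transport on the
manifold (`expMap_eq`, `radialTransport_eq`), so that `Φ⁻¹` is smooth near the origin.

The solution of the formal equation is unique as `k (k + 1) ≠ 0` for `k ≥ 1`, and the two series on
the right have no constant term (`FormalSeries.eq_of_number_equation`). -/

noncomputable section

/-! ### Pointwise operations and integration on spaces of continuous curves -/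

namespace CurveSpace

section Pointwise

variable {I : Type*} [TopologicalSpace I] [CompactSpace I]
  {V W : Type*} [NormedAddCommGroup V] [NormedSpace ℝ V] [NormedAddCommGroup W] [NormedSpace ℝ W]

/-- The pointwise application of a bounded bilinear map to continuous curves, as a bounded bilinear
map. -/
def bilinL {A : Type*} [NormedAddCommGroup A] [NormedSpace ℝ A] (B : A →L[ℝ] V →L[ℝ] W) :
    C(I, A) →L[ℝ] C(I, V) →L[ℝ] C(I, W) :=
  LinearMap.mkContinuous₂
    (LinearMap.mk₂ ℝ (fun (a : C(I, A)) (y : C(I, V)) =>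
        (⟨fun t => B (a t) (y t), (B.continuous.comp a.continuous).clm_apply y.continuous⟩ :
          C(I, W)))
      (fun _ _ _ => by ext; simp) (fun _ _ _ => by ext; simp)
      (fun _ _ _ => by ext; simp) (fun _ _ _ => by ext; simp)) ‖B‖ (fun a y => by
        rw [ContinuousMap.norm_le _ (by positivity)]
        intro t
        exact (B.le_opNorm₂ _ _).trans (by
          gcongr
          exacts [a.norm_coe_le_norm t, y.norm_coe_le_norm t]))

set_option synthInstance.maxHeartbeats 200000 in
/-- Pointwise application of a continuous family of operators to a continuous curve, as a bounded
bilinear map. -/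
def applyL : C(I, V →L[ℝ] W) →L[ℝ] C(I, V) →L[ℝ] C(I, W) :=
  bilinL (ContinuousLinearMap.id ℝ (V →L[ℝ] W))

@[simp]
theorem bilinL_apply {A : Type*} [NormedAddCommGroup A] [NormedSpace ℝ A]
    (B : A →L[ℝ] V →L[ℝ] W) (a : C(I, A)) (y : C(I, V)) (t : I) :
    bilinL B a y t = B (a t) (y t) := rfl

/-- Composition with a continuous map is continuous on continuous curves: the compact-open topology
gives the uniform estimate. -/
theorem exists_forall_norm_comp_sub_lt (g : C(V, W)) (y : C(I, V)) {ε : ℝ} (hε : 0 < ε) :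
    ∃ δ > 0, ∀ k : C(I, V), ‖k - y‖ < δ → ∀ t, ‖g (k t) - g (y t)‖ < ε := by
  have hc : Continuous (fun y : C(I, V) => g.comp y) := ContinuousMap.continuous_postcomp _
  obtain ⟨δ, hδ, hball⟩ := Metric.continuousAt_iff.1 hc.continuousAt ε hε
  refine ⟨δ, hδ, fun k hk t => ?_⟩
  have h := hball (x := k) (by rwa [dist_eq_norm])
  rw [dist_eq_norm] at h
  exact (ContinuousMap.norm_coe_le_norm (g.comp k - g.comp y) t).trans_lt h

set_option synthInstance.maxHeartbeats 200000 in
/-- Composition with a continuously differentiable map is differentiable on continuous curves, and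
its derivative is the pointwise application of the derivative. -/
theorem hasFDerivAt_comp_left {f : V → W} {f' : V → V →L[ℝ] W} (hf : Continuous f)
    (hf' : Continuous f') (hd : ∀ x, HasFDerivAt f (f' x) x) (y : C(I, V)) :
    HasFDerivAt (fun y : C(I, V) => (⟨f, hf⟩ : C(V, W)).comp y)
      (applyL ((⟨f', hf'⟩ : C(V, V →L[ℝ] W)).comp y)) y := by
  rw [hasFDerivAt_iff_isLittleO_nhds_zero, Asymptotics.isLittleO_iff]
  intro ε hε
  obtain ⟨δ, hδ, hball⟩ := exists_forall_norm_comp_sub_lt (⟨f', hf'⟩ : C(V, V →L[ℝ] W)) y hε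
  filter_upwards [Metric.ball_mem_nhds (0 : C(I, V)) hδ] with h hh
  rw [ContinuousMap.norm_le _ (by positivity)]
  intro t
  have hbound : ∀ x ∈ segment ℝ (y t) (y t + h t), ‖f' x - f' (y t)‖ ≤ ε := by
    intro x hx
    rw [segment_eq_image'] at hx
    obtain ⟨θ, hθ, rfl⟩ := hx
    have h1 : ‖y + θ • h - y‖ < δ := by
      rw [add_sub_cancel_left, norm_smul, Real.norm_of_nonneg hθ.1]
      calc θ * ‖h‖ ≤ 1 * ‖h‖ := mul_le_mul_of_nonneg_right hθ.2 (norm_nonneg _)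
        _ < δ := by simpa using hh
    simpa using (hball _ h1 t).le
  have key := (convex_segment (y t) (y t + h t)).norm_image_sub_le_of_norm_hasFDerivWithin_le'
    (fun x _ => (hd x).hasFDerivWithinAt) hbound
    (left_mem_segment ℝ _ _) (right_mem_segment ℝ _ _)
  simp only [add_sub_cancel_left] at key
  exact key.trans (mul_le_mul_of_nonneg_left (h.norm_coe_le_norm t) hε.le)

end Pointwise

section Smooth

universe u

variable {I : Type*} [TopologicalSpace I] [CompactSpace I]
  {V : Type u} [NormedAddCommGroup V] [NormedSpace ℝ V]

set_option synthInstance.maxHeartbeats 200000 in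
/-- The induction on the order of differentiability; the target changes from `W` to `V →L[ℝ] W`, and
therefore has to live in the universe of `V`. -/
theorem contDiff_comp_left_nat (n : ℕ) :
    ∀ {W : Type u} [NormedAddCommGroup W] [NormedSpace ℝ W] (f : C(V, W)),
    ContDiff ℝ n f → ContDiff ℝ n (fun y : C(I, V) => f.comp y) := by
  induction n with
  | zero =>
    intro W _ _ f _
    exact contDiff_zero.2 (ContinuousMap.continuous_postcomp f)
  | succ n ih =>
    intro W _ _ f hf
    push_cast at hf ⊢
    obtain ⟨f', hf', hd⟩ := contDiff_succ_iff_hasFDerivAt.1 hf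
    refine contDiff_succ_iff_hasFDerivAt.2
      ⟨fun y => applyL ((⟨f', hf'.continuous⟩ : C(V, V →L[ℝ] W)).comp y), ?_,
        hasFDerivAt_comp_left f.continuous hf'.continuous hd⟩
    exact applyL.contDiff.comp (ih (⟨f', hf'.continuous⟩ : C(V, V →L[ℝ] W)) hf')

set_option synthInstance.maxHeartbeats 200000 in
/-- Composition with a smooth map is a smooth operation on continuous curves. -/
theorem contDiff_comp_left {W : Type u} [NormedAddCommGroup W] [NormedSpace ℝ W] (f : C(V, W))
    (hf : ContDiff ℝ ∞ f) : ContDiff ℝ ∞ (fun y : C(I, V) => f.comp y) :=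
  contDiff_infty.2 fun n => contDiff_comp_left_nat n f (hf.of_le (by exact_mod_cast le_top))

end Smooth

section Integral

variable {V : Type*} [NormedAddCommGroup V] [NormedSpace ℝ V]

/-- The primitive of a continuous curve on `[0, 1]` that vanishes at `0`, as a bounded operator. -/
def primitiveL : C(Set.Icc (0 : ℝ) 1, V) →L[ℝ] C(Set.Icc (0 : ℝ) 1, V) :=
  LinearMap.mkContinuous
    { toFun := fun y => ⟨fun t => ∫ s in (0 : ℝ)..t, Set.IccExtend zero_le_one y s,
        (intervalIntegral.continuous_primitive (fun _ _ =>
          (y.continuous.Icc_extend' (h := zero_le_one)).intervalIntegrable _ _) 0).comp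
          continuous_subtype_val⟩
      map_add' := fun y z => by
        ext t
        exact intervalIntegral.integral_add
          ((y.continuous.Icc_extend' (h := zero_le_one)).intervalIntegrable _ _)
          ((z.continuous.Icc_extend' (h := zero_le_one)).intervalIntegrable _ _)
      map_smul' := fun c y => by
        ext t
        exact intervalIntegral.integral_smul c _ } 1 (fun y => by
    rw [one_mul, ContinuousMap.norm_le _ (norm_nonneg _)]
    intro t
    refine (intervalIntegral.norm_integral_le_of_norm_le_const
      (C := ‖y‖) (fun s _ => y.norm_coe_le_norm _)).trans ?_
    rw [sub_zero, abs_of_nonneg t.2.1]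
    exact mul_le_of_le_one_right (norm_nonneg _) t.2.2)

theorem primitiveL_apply (y : C(Set.Icc (0 : ℝ) 1, V)) (t : Set.Icc (0 : ℝ) 1) :
    primitiveL y t = ∫ s in (0 : ℝ)..t, Set.IccExtend zero_le_one y s := rfl

theorem hasDerivWithinAt_primitiveL [CompleteSpace V] (y : C(Set.Icc (0 : ℝ) 1, V))
    (t : Set.Icc (0 : ℝ) 1) :
    HasDerivWithinAt (Set.IccExtend zero_le_one (primitiveL y)) (y t) (Set.Icc 0 1) t := by
  have h : HasDerivAt (fun t : ℝ => ∫ s in (0 : ℝ)..t, Set.IccExtend zero_le_one y s)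
      (Set.IccExtend zero_le_one y t) t :=
    (y.continuous.Icc_extend' (h := zero_le_one)).integral_hasStrictDerivAt 0 t |>.hasDerivAt
  rw [Set.IccExtend_val] at h
  refine h.hasDerivWithinAt.congr (fun s hs => ?_) ?_
  · rw [Set.IccExtend_of_mem _ _ hs, primitiveL_apply]
  · rw [Set.IccExtend_val, primitiveL_apply]

/-- The constant curves. -/
def constL : V →L[ℝ] C(Set.Icc (0 : ℝ) 1, V) :=
  LinearMap.mkContinuous
    { toFun := fun v => ContinuousMap.const _ v
      map_add' := fun _ _ => rfl
      map_smul' := fun _ _ => rfl } 1 (fun v => by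
    rw [one_mul, ContinuousMap.norm_le _ (norm_nonneg _)]
    intro t
    exact le_rfl)

@[simp]
theorem constL_apply (v : V) (t : Set.Icc (0 : ℝ) 1) : constL v t = v := rfl

/-- The curve `t ↦ y (τ t)`, for a factor `τ ∈ [0, 1]`. -/
def slowDown (τ : Set.Icc (0 : ℝ) 1) (y : C(Set.Icc (0 : ℝ) 1, V)) : C(Set.Icc (0 : ℝ) 1, V) :=
  y.comp ⟨fun t => τ * t, by fun_prop⟩

theorem slowDown_apply (τ t : Set.Icc (0 : ℝ) 1) (y : C(Set.Icc (0 : ℝ) 1, V)) :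
    slowDown τ y t = y (τ * t) := rfl

theorem primitiveL_slowDown (τ t : Set.Icc (0 : ℝ) 1) (y : C(Set.Icc (0 : ℝ) 1, V)) :
    primitiveL y (τ * t) = (τ : ℝ) • primitiveL (slowDown τ y) t := by
  rw [primitiveL_apply, primitiveL_apply]
  have h := intervalIntegral.smul_integral_comp_mul_left (a := 0) (b := t)
    (Set.IccExtend zero_le_one y) (τ : ℝ)
  rw [mul_zero] at h
  rw [Set.Icc.coe_mul, ← h]
  congr 1
  refine intervalIntegral.integral_congr fun s hs => ?_
  rw [Set.uIcc_of_le t.2.1] at hs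
  have hs' : s ∈ Set.Icc (0 : ℝ) 1 := ⟨hs.1, hs.2.trans t.2.2⟩
  have hτs : (τ : ℝ) * s ∈ Set.Icc (0 : ℝ) 1 := (τ * ⟨s, hs'⟩ : Set.Icc (0 : ℝ) 1).2
  rw [Set.IccExtend_of_mem _ _ hτs, Set.IccExtend_of_mem _ _ hs']
  rfl

end Integral

end CurveSpace

/-! ### Smooth dependence of solutions of differential equations on parameters -/

namespace CurveSpace

universe u

/-- The fixed points `y = c₀ + K(X, y)` near `c₀` depend smoothly on the parameter `X` near `0`, if
`K` vanishes for `X = 0`. -/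
theorem exists_smooth_fixedPoint {E C : Type*} [NormedAddCommGroup E] [NormedSpace ℝ E]
    [CompleteSpace E] [NormedAddCommGroup C] [NormedSpace ℝ C] [CompleteSpace C]
    (K : E × C → C) (hK : ContDiff ℝ ∞ K) (hK₀ : ∀ y, K (0, y) = 0) (c₀ : C) {δ : ℝ} (hδ : 0 < δ) :
    ∃ r > 0, ∃ ψ : E → C, ∃ δ' > 0, δ' ≤ δ ∧
      ContDiffOn ℝ ∞ ψ (Metric.ball 0 r) ∧
      (∀ X ∈ Metric.ball (0 : E) r, ψ X ∈ Metric.ball c₀ δ') ∧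
      ∀ X ∈ Metric.ball (0 : E) r, ∀ y ∈ Metric.ball c₀ δ', y = c₀ + K (X, y) ↔ y = ψ X := by
  set L : E →L[ℝ] C := fderiv ℝ K (0, c₀) ∘L ContinuousLinearMap.inl ℝ E C
  -- the derivative in the direction of `C` vanishes, since `K (0, ·) = 0`
  have hK' : HasFDerivAt K (L ∘L ContinuousLinearMap.fst ℝ E C) (0, c₀) := by
    have hd' := ((hK.differentiable (by simp)) (0, c₀)).hasFDerivAt
    refine hd'.congr_fderiv (ContinuousLinearMap.prod_ext ?_ ?_) <;> ext1 v
    · simp [L]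
    · have h1 : HasFDerivAt (fun y : C => K (0, y))
        (fderiv ℝ K (0, c₀) ∘L ContinuousLinearMap.inr ℝ E C) c₀ :=
        HasFDerivAt.comp c₀ (f := fun y : C => ((0 : E), y)) hd'
          (hasFDerivAt_prodMk_right 0 _)
      have h2 : HasFDerivAt (fun y : C => K (0, y)) (0 : C →L[ℝ] C) c₀ :=
        (hasFDerivAt_const (0 : C) _).congr_of_eventuallyEq
          (Filter.Eventually.of_forall fun y => hK₀ y)
      simpa using congrArg (fun L => L v) (h1.unique h2)
  -- the fixed points are the preimages of `(X, c₀)` under `P`, which is invertible near `(0, c₀)`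
  let P : E × C → E × C := fun q => (q.1, q.2 - K q)
  have hP : ContDiff ℝ ∞ P := contDiff_fst.prodMk (contDiff_snd.sub hK)
  let e : (E × C) ≃L[ℝ] E × C :=
    (ContinuousLinearEquiv.refl ℝ E).skewProd (ContinuousLinearEquiv.refl ℝ C) (-L)
  have hP' : HasFDerivAt P (e : E × C →L[ℝ] E × C) (0, c₀) := by
    have h := (hasFDerivAt_fst (𝕜 := ℝ) (p := ((0 : E), c₀))).prodMk
      ((hasFDerivAt_snd (𝕜 := ℝ) (p := ((0 : E), c₀))).sub hK')
    refine h.congr_fderiv ?_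
    ext q <;> simp [e, sub_eq_add_neg]
  have hP0 : P (0, c₀) = (0, c₀) := by simp [P, hK₀]
  have hPc := hP.contDiffAt (x := ((0 : E), c₀))
  let g := hPc.toOpenPartialHomeomorph P hP' (by simp)
  have hgP : ∀ q, g q = P q := fun q => rfl
  have hg0 : ((0 : E), c₀) ∈ g.source :=
    hPc.mem_toOpenPartialHomeomorph_source hP' (by simp)
  have hg0' : ((0 : E), c₀) ∈ g.target := by
    have := g.map_source hg0
    rwa [hgP, hP0] at this
  have hgs : g.symm (0, c₀) = (0, c₀) := by
    have := g.left_inv hg0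
    rwa [hgP, hP0] at this
  -- the derivative stays invertible near the base point
  have hinv : ∀ᶠ q in 𝓝 ((0 : E), c₀),
      fderiv ℝ P q ∈ Set.range ((↑) : ((E × C) ≃L[ℝ] E × C) → (E × C →L[ℝ] E × C)) := by
    have hcont : ContinuousAt (fderiv ℝ P) (0, c₀) :=
      (hP.continuous_fderiv (by simp)).continuousAt
    refine hcont.eventually ?_
    rw [hP'.fderiv]
    exact e.nhds
  have hinv' : ∀ᶠ q in 𝓝 ((0 : E), c₀), q ∈ g.target ∧
      ContDiffAt ℝ ∞ g.symm q := by
    have hc := g.continuousAt_symm hg0'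
    rw [← hgs] at hinv
    filter_upwards [hc.eventually hinv, g.open_target.mem_nhds hg0'] with q hq hqt
    obtain ⟨e', he'⟩ := hq
    refine ⟨hqt, g.contDiffAt_symm (f₀' := e') hqt ?_ hP.contDiffAt⟩
    rw [he']
    exact (hP.differentiable (by simp) _).hasFDerivAt
  obtain ⟨δ₁, hδ₁, hsource⟩ := Metric.mem_nhds_iff.1 (g.open_source.mem_nhds hg0)
  let ψ : E → C := fun X => (g.symm (X, c₀)).2
  have hpath : ContinuousAt (fun X : E => (X, c₀)) 0 := by fun_prop
  have hsm : ∀ᶠ X in 𝓝 (0 : E), (X, c₀) ∈ g.target ∧ ContDiffAt ℝ ∞ ψ X := by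
    filter_upwards [hpath.eventually hinv'] with X hX
    refine ⟨hX.1, ?_⟩
    have h1 : ContDiffAt ℝ ∞ (fun X : E => (X, c₀)) X :=
      contDiffAt_id.prodMk contDiffAt_const
    exact contDiffAt_snd.comp X (ContDiffAt.comp X hX.2 h1)
  have hψ0 : ψ 0 = c₀ := by simp [ψ, hgs]
  set δ' := min δ δ₁
  have hδ' : 0 < δ' := lt_min hδ hδ₁
  have hsmall : ∀ᶠ X in 𝓝 (0 : E), ψ X ∈ Metric.ball c₀ δ' := by
    have := hsm.self_of_nhds.2.continuousAt.eventually
      (Metric.ball_mem_nhds (ψ 0) hδ')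
    rwa [hψ0] at this
  obtain ⟨r, hr, hrs⟩ := Metric.eventually_nhds_iff_ball.1 (hsm.and hsmall)
  refine ⟨min r δ₁, lt_min hr hδ₁, ψ, δ', hδ', min_le_left _ _, ?_, ?_, ?_⟩
  · intro X hX
    exact (hrs X (Metric.ball_subset_ball (min_le_left _ _) hX)).1.2.contDiffWithinAt
  · intro X hX
    exact (hrs X (Metric.ball_subset_ball (min_le_left _ _) hX)).2
  · intro X hX y hy
    have hX' := (hrs X (Metric.ball_subset_ball (min_le_left _ _) hX)).1.1
    have hfst : (g.symm (X, c₀)).1 = X := by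
      have := congrArg Prod.fst (g.right_inv hX')
      simpa [hgP, P] using this
    have hq : (X, y) ∈ g.source := hsource (by
      rw [← ball_prod_same]
      exact ⟨Metric.ball_subset_ball (min_le_right _ _) hX,
        Metric.ball_subset_ball (min_le_right _ _) hy⟩)
    have hiff : y = c₀ + K (X, y) ↔ P (X, y) = (X, c₀) := by
      simp only [P, Prod.mk.injEq, true_and]
      exact sub_eq_iff_eq_add.symm
    refine hiff.trans ⟨fun h => ?_, fun h => ?_⟩
    · have := g.left_inv hq
      rw [hgP, h] at this
      simp [ψ, this]
    · have h2 : g.symm (X, c₀) = (X, y) := Prod.ext hfst h.symm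
      have := g.right_inv hX'
      rwa [h2] at this

theorem contDiff_clm_bilin {Q C₁ C₂ C₃ C₄ : Type*} [NormedAddCommGroup Q] [NormedSpace ℝ Q]
    [NormedAddCommGroup C₁] [NormedSpace ℝ C₁] [NormedAddCommGroup C₂] [NormedSpace ℝ C₂]
    [NormedAddCommGroup C₃] [NormedSpace ℝ C₃] [NormedAddCommGroup C₄] [NormedSpace ℝ C₄]
    {n : ℕ∞ω} (P : C₃ →L[ℝ] C₄) (B : C₁ →L[ℝ] C₂ →L[ℝ] C₃) {g : Q → C₁} {h : Q → C₂}
    (hg : ContDiff ℝ n g) (hh : ContDiff ℝ n h) : ContDiff ℝ n (fun q => P (B (g q) (h q))) :=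
  P.contDiff.comp ((B.contDiff.comp hg).clm_apply hh)

/-- Smooth dependence on parameters for an ordinary differential equation `y' = B(f(y), X)`,
`y(0) = y₀`, that is linear in its parameter `X`. Such solutions are homogeneous,
`y_{τX}(1) = y_X(τ)`, so that the time-one map `Y(X) = y_X(1)` is characterised by its
radial derivative. -/
theorem exists_radial_solution {E V A : Type u} [NormedAddCommGroup E] [NormedSpace ℝ E]
    [CompleteSpace E] [NormedAddCommGroup V] [NormedSpace ℝ V] [CompleteSpace V]
    [NormedAddCommGroup A] [NormedSpace ℝ A] (B : A →L[ℝ] E →L[ℝ] V)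
    (f : V → A) (hf : ContDiff ℝ ∞ f) (y₀ : V) {δ : ℝ} (hδ : 0 < δ) :
    ∃ r > 0, ∃ Y : E → V, ContDiffOn ℝ ∞ Y (Metric.ball 0 r) ∧ Y 0 = y₀ ∧
      fderiv ℝ Y 0 = B (f y₀) ∧
      ∀ X ∈ Metric.ball (0 : E) r, Y X ∈ Metric.ball y₀ δ ∧ fderiv ℝ Y X X = B (f (Y X)) X := by
  set fc : C(V, A) := ⟨f, hf.continuous⟩
  have h1 : ContDiff ℝ ∞ (fun q : E × C(Set.Icc (0 : ℝ) 1, V) => fc.comp q.2) :=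
    (contDiff_comp_left fc hf).comp contDiff_snd
  have h2 : ContDiff ℝ ∞ (fun q : E × C(Set.Icc (0 : ℝ) 1, V) =>
      (constL q.1 : C(Set.Icc (0 : ℝ) 1, E))) :=
    (constL (V := E)).contDiff.comp contDiff_fst
  -- the integral equation, as a fixed point equation for curves
  obtain ⟨r, hr, ψ, δ', hδ', hle, hψ, hmem, huniq⟩ := exists_smooth_fixedPoint
    (fun q : E × C(Set.Icc (0 : ℝ) 1, V) =>
      primitiveL ((bilinL B (I := Set.Icc (0 : ℝ) 1)) (fc.comp q.2) (constL q.1)))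
    (contDiff_clm_bilin primitiveL (bilinL B) h1 h2) (by simp) (constL y₀) hδ
  let one : Set.Icc (0 : ℝ) 1 := ⟨1, by simp⟩
  have hsol : ∀ X ∈ Metric.ball (0 : E) r,
      ψ X = constL y₀ +
        primitiveL ((bilinL B (I := Set.Icc (0 : ℝ) 1)) (fc.comp (ψ X)) (constL X)) :=
    fun X hX => (huniq X hX (ψ X) (hmem X hX)).2 rfl
  -- homogeneity, by uniqueness of the solution
  have hhom : ∀ X ∈ Metric.ball (0 : E) r, ∀ τ : Set.Icc (0 : ℝ) 1,
      ψ ((τ : ℝ) • X) one = ψ X τ := by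
    intro X hX τ
    have hτX : (τ : ℝ) • X ∈ Metric.ball (0 : E) r := by
      rw [mem_ball_zero_iff] at hX ⊢
      rw [norm_smul, Real.norm_of_nonneg τ.2.1]
      exact (mul_le_of_le_one_left (norm_nonneg _) τ.2.2).trans_lt hX
    have hs : slowDown τ (ψ X) ∈ Metric.ball (constL y₀) δ' := by
      rw [mem_ball_iff_norm]
      refine lt_of_le_of_lt ((ContinuousMap.norm_le _ (norm_nonneg _)).2 fun t => ?_)
        (mem_ball_iff_norm.1 (hmem X hX))
      exact (ψ X - constL y₀).norm_coe_le_norm (τ * t)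
    have h := (huniq _ hτX _ hs).1 (by
      ext t
      have h1 := congrArg (fun y => y (τ * t)) (hsol X hX)
      simp only [ContinuousMap.add_apply, constL_apply] at h1
      rw [slowDown_apply, h1, primitiveL_slowDown, ContinuousMap.add_apply, constL_apply,
        ← ContinuousMap.smul_apply, ← map_smul]
      congr 3
      ext s
      simp [slowDown_apply])
    rw [← h, slowDown_apply]
    congr 1
    ext
    simp [one]
  have hball : ∀ X ∈ Metric.ball (0 : E) r, ∀ τ : Set.Icc (0 : ℝ) 1,
      HasDerivWithinAt (fun t : ℝ => ψ (t • X) one) (B (f (ψ X τ)) X) (Set.Icc 0 1) τ := by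
    intro X hX τ
    have h := (hasDerivWithinAt_primitiveL
      ((bilinL B (I := Set.Icc (0 : ℝ) 1)) (fc.comp (ψ X)) (constL X)) τ).const_add y₀
    refine h.congr (fun t ht => ?_) ?_
    · rw [hhom X hX ⟨t, ht⟩, Set.IccExtend_of_mem _ _ ht]
      exact congrArg (fun y => y ⟨t, ht⟩) (hsol X hX)
    · rw [hhom X hX τ, Set.IccExtend_val]
      exact congrArg (fun y => y τ) (hsol X hX)
  have hY : ContDiffOn ℝ ∞ (fun X => ψ X one) (Metric.ball 0 r) :=
    (ContinuousMap.evalCLM (M := V) ℝ one).contDiff.comp_contDiffOn hψ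
  have hder : ∀ X ∈ Metric.ball (0 : E) r, ∀ τ : Set.Icc (0 : ℝ) 1,
      (τ : ℝ) • X ∈ Metric.ball (0 : E) r →
      fderiv ℝ (fun X => ψ X one) ((τ : ℝ) • X) X = B (f (ψ X τ)) X := by
    intro X hX τ hτX
    have hd : DifferentiableAt ℝ (fun X => ψ X one) ((τ : ℝ) • X) :=
      (hY.contDiffAt (Metric.isOpen_ball.mem_nhds hτX)).differentiableAt (by simp)
    have h1 : HasDerivAt (fun t : ℝ => t • X) X (τ : ℝ) := by
      simpa using (hasDerivAt_id (τ : ℝ)).smul_const X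
    have h2 := (hd.hasFDerivAt.comp_hasDerivAt (τ : ℝ) h1).hasDerivWithinAt (s := Set.Icc 0 1)
    exact (uniqueDiffOn_Icc zero_lt_one τ τ.2).eq_deriv _ h2 (hball X hX τ)
  have hψ0 : ∀ τ, ψ 0 τ = y₀ := by
    intro τ
    have := congrArg (fun y => y τ) (hsol 0 (Metric.mem_ball_self hr))
    simpa using this
  refine ⟨r, hr, fun X => ψ X one, hY, hψ0 one, ?_, fun X hX => ⟨?_, ?_⟩⟩
  · ext X
    -- rescale `X` into the ball
    obtain ⟨c, hc, hcX⟩ : ∃ c : ℝ, c ≠ 0 ∧ c • X ∈ Metric.ball (0 : E) r := by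
      have : ∀ᶠ c : ℝ in 𝓝 0, c • X ∈ Metric.ball (0 : E) r := by
        have hcont : ContinuousAt (fun c : ℝ => c • X) 0 := by fun_prop
        exact hcont.eventually (by simp only [zero_smul]; exact Metric.ball_mem_nhds (0 : E) hr)
      obtain ⟨ε, hε, h⟩ := Metric.eventually_nhds_iff_ball.1 this
      exact ⟨ε / 2, by positivity, h _ (by
        rw [mem_ball_zero_iff, Real.norm_of_nonneg (by positivity)]; linarith)⟩
    have h := hder _ hcX ⟨0, by simp⟩ (by simpa using hr)
    have h0 : ψ (c • X) ⟨0, by simp⟩ = y₀ := by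
      rw [← hhom _ hcX ⟨0, by simp⟩]
      simp [hψ0]
    rw [h0, map_smul, map_smul] at h
    simpa using smul_right_injective V hc h
  · have := ((ψ X - constL y₀).norm_coe_le_norm one).trans_lt (mem_ball_iff_norm.1 (hmem X hX))
    exact mem_ball_iff_norm.2 (this.trans_le hle)
  · have h := hder X hX one (by simpa [one] using hX)
    simpa [one] using h

end CurveSpace

/-! ### The exponential map in a chart -/

namespace ChartConnection

variable {E : Type*} [NormedAddCommGroup E] [NormedSpace ℝ E]

/-- Let `G` be the Christoffel symbols of a connection on an open subset `U` of `E`, so that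
`∇_v w = D w (v) + G(v, w)`. The maps `ex` and `P` on the ball of radius `r` are the exponential map
at `x₀` and the parallel transport along the radial geodesics `t ↦ ex (t X)`. Since these geodesics
have the velocity `P (t X) X`, the geodesic equation and the equation of parallel transport become
equations for the radial derivatives of `ex` and `P`. -/
structure IsExpChart (G : E → E →L[ℝ] E →L[ℝ] E) (U : Set E) (x₀ : E) (r : ℝ) (ex : E → E)
    (P : E → E →L[ℝ] E) : Prop where
  pos : 0 < r
  contDiffOn_ex : ContDiffOn ℝ ∞ ex (Metric.ball 0 r)
  contDiffOn_P : ContDiffOn ℝ ∞ P (Metric.ball 0 r)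
  ex_zero : ex 0 = x₀
  P_zero : P 0 = 1
  fderiv_ex_zero : fderiv ℝ ex 0 = ContinuousLinearMap.id ℝ E
  mem : ∀ X ∈ Metric.ball (0 : E) r, ex X ∈ U
  isUnit_P : ∀ X ∈ Metric.ball (0 : E) r, IsUnit (P X)
  fderiv_ex : ∀ X ∈ Metric.ball (0 : E) r, fderiv ℝ ex X X = P X X
  fderiv_P : ∀ X ∈ Metric.ball (0 : E) r, fderiv ℝ P X X = -(G (ex X) (P X X) ∘L P X)

theorem contDiff_bump_smul {F : Type*} [NormedAddCommGroup F] [NormedSpace ℝ F]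
    [FiniteDimensional ℝ E] {U : Set E} (hU : IsOpen U) {x₀ : E} (b : ContDiffBump x₀)
    (hb : Metric.closedBall x₀ b.rOut ⊆ U) {G : E → F} (hG : ContDiffOn ℝ ∞ G U) :
    ContDiff ℝ ∞ (fun x => b x • G x) := by
  rw [contDiff_iff_contDiffAt]
  intro x
  by_cases hx : x ∈ U
  · exact b.contDiff.contDiffAt.smul (hG.contDiffAt (hU.mem_nhds hx))
  · refine (contDiffAt_const (c := (0 : F))).congr_of_eventuallyEq ?_
    have hx' : x ∉ tsupport b := by
      rw [b.tsupport_eq]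
      exact fun h => hx (hb h)
    filter_upwards [(isClosed_tsupport b).isOpen_compl.mem_nhds hx'] with y hy
    rw [image_eq_zero_of_notMem_tsupport hy, zero_smul]

set_option synthInstance.maxHeartbeats 200000 in
/-- The existence of the exponential map and of the radial parallel transport near the origin. The
pair `(x, P)` of a geodesic with initial velocity `X` and the transport along it, whose velocity is
`P X`, solves `x' = P X`, `P' = -G(x, P X) P`: an equation that is linear in `X`. -/
theorem exists_isExpChart [FiniteDimensional ℝ E] {U : Set E} (hU : IsOpen U) {x₀ : E}
    (hx₀ : x₀ ∈ U) {G : E → E →L[ℝ] E →L[ℝ] E} (hG : ContDiffOn ℝ ∞ G U) :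
    ∃ r ex P, IsExpChart G U x₀ r ex P := by
  have : CompleteSpace E := FiniteDimensional.complete ℝ E
  obtain ⟨ε, hε, hεU⟩ := Metric.isOpen_iff.1 hU x₀ hx₀
  let b : ContDiffBump x₀ := ⟨ε / 4, ε / 2, by positivity, by linarith⟩
  have hb : Metric.closedBall x₀ b.rOut ⊆ U :=
    (Metric.closedBall_subset_ball (by change ε / 2 < ε; linarith)).trans hεU
  -- the Christoffel symbols are cut off, to be defined everywhere
  let H : E → E →L[ℝ] E →L[ℝ] E := fun x => b x • G x
  have hH : ContDiff ℝ ∞ H := contDiff_bump_smul hU b hb hG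
  let f : E × (E →L[ℝ] E) → E →L[ℝ] E × (E →L[ℝ] E) := fun y =>
    y.2.prod (-((ContinuousLinearMap.compL ℝ E E E).flip y.2 ∘L H y.1 ∘L y.2))
  have hf_apply : ∀ y X, f y X = (y.2 X, -(H y.1 (y.2 X) ∘L y.2)) := fun y X => rfl
  have hf : ContDiff ℝ ∞ f := by
    rw [contDiff_clm_apply_iff]
    intro X
    simp only [hf_apply]
    have h1 : ContDiff ℝ ∞ (fun y : E × (E →L[ℝ] E) => y.2 X) :=
      contDiff_snd.clm_apply contDiff_const
    exact h1.prodMk ((((hH.comp contDiff_fst).clm_apply h1).clm_comp contDiff_snd).neg)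
  obtain ⟨δ, hδ, hδu⟩ := Metric.isOpen_iff.1 (Units.isOpen (R := E →L[ℝ] E)) 1 isUnit_one
  obtain ⟨r, hr, Y, hY, hY0, hY0', hYr⟩ := CurveSpace.exists_radial_solution
    (ContinuousLinearMap.id ℝ (E →L[ℝ] E × (E →L[ℝ] E))) f hf (x₀, 1)
    (δ := min (ε / 4) δ) (lt_min (by positivity) hδ)
  have hd : ∀ X ∈ Metric.ball (0 : E) r, DifferentiableAt ℝ Y X := fun X hX =>
    (hY.contDiffAt (Metric.isOpen_ball.mem_nhds hX)).differentiableAt (by simp)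
  have hd1 : ∀ X ∈ Metric.ball (0 : E) r, ∀ Z,
      fderiv ℝ (fun X => (Y X).1) X Z = (fderiv ℝ Y X Z).1 := fun X hX Z => by
    rw [(hd X hX).hasFDerivAt.fst.fderiv]; rfl
  have hd2 : ∀ X ∈ Metric.ball (0 : E) r, ∀ Z,
      fderiv ℝ (fun X => (Y X).2) X Z = (fderiv ℝ Y X Z).2 := fun X hX Z => by
    rw [(hd X hX).hasFDerivAt.snd.fderiv]; rfl
  have hmem : ∀ X ∈ Metric.ball (0 : E) r,
      (Y X).1 ∈ Metric.ball x₀ (ε / 4) ∧ (Y X).2 ∈ Metric.ball 1 δ := fun X hX => by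
    have h := (hYr X hX).1
    rw [← ball_prod_same] at h
    exact ⟨Metric.ball_subset_ball (min_le_left _ _) h.1,
      Metric.ball_subset_ball (min_le_right _ _) h.2⟩
  have hHG : ∀ X ∈ Metric.ball (0 : E) r, H (Y X).1 = G (Y X).1 := fun X hX => by
    have h : b (Y X).1 = 1 :=
      b.one_of_mem_closedBall (Metric.ball_subset_closedBall (hmem X hX).1)
    simp [H, h]
  refine ⟨r, fun X => (Y X).1, fun X => (Y X).2, hr, contDiff_fst.comp_contDiffOn hY,
    contDiff_snd.comp_contDiffOn hY, by simp [hY0], by simp [hY0], ?_, ?_, ?_, ?_, ?_⟩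
  · ext Z
    rw [hd1 0 (Metric.mem_ball_self hr), hY0']
    simp [hf_apply]
  · exact fun X hX => hεU (Metric.ball_subset_ball (by linarith) (hmem X hX).1)
  · exact fun X hX => hδu (hmem X hX).2
  · intro X hX
    rw [hd1 X hX, (hYr X hX).2]
    rfl
  · intro X hX
    rw [hd2 X hX, (hYr X hX).2, ← hHG X hX]
    rfl

end ChartConnection

/-! ### Radial geodesics and parallel transport in a chart -/

namespace ChartConnection

variable {E : Type*} [NormedAddCommGroup E] [NormedSpace ℝ E]

/-- The partial derivatives of a twice continuously differentiable map of two real variables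
commute. -/
theorem hasDerivAt_deriv_comm {F : Type*} [NormedAddCommGroup F] [NormedSpace ℝ F]
    {f : ℝ → ℝ → F} {t s : ℝ} (hf : ContDiffAt ℝ 2 (fun q : ℝ × ℝ => f q.1 q.2) (t, s)) :
    HasDerivAt (fun t' => deriv (fun s' => f t' s') s)
      (deriv (fun s' => deriv (fun t' => f t' s') t) s) t := by
  set g : ℝ × ℝ → F := fun q => f q.1 q.2
  have hd : ∀ᶠ q in 𝓝 (t, s), DifferentiableAt ℝ g q := by
    filter_upwards [hf.eventually (by simp)] with q hq using hq.differentiableAt (by simp)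
  have hd2 : HasFDerivAt (fderiv ℝ g) (fderiv ℝ (fderiv ℝ g) (t, s)) (t, s) :=
    ((hf.fderiv_right (m := 1) (by norm_num)).differentiableAt (by simp)).hasFDerivAt
  have hl : ∀ q : ℝ × ℝ, HasDerivAt (fun t' : ℝ => (t', q.2)) ((1 : ℝ), (0 : ℝ)) q.1 := fun q =>
    (hasDerivAt_id q.1).prodMk (hasDerivAt_const q.1 q.2)
  have hr : ∀ q : ℝ × ℝ, HasDerivAt (fun s' : ℝ => (q.1, s')) ((0 : ℝ), (1 : ℝ)) q.2 := fun q =>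
    (hasDerivAt_const q.2 q.1).prodMk (hasDerivAt_id q.2)
  have h1 : (fun t' => deriv (fun s' => f t' s') s) =ᶠ[𝓝 t]
      fun t' => fderiv ℝ g (t', s) (0, 1) := by
    have hc : Tendsto (fun t' : ℝ => (t', s)) (𝓝 t) (𝓝 (t, s)) :=
      (hl (t, s)).continuousAt
    filter_upwards [hc.eventually hd] with t' ht'
    exact (HasFDerivAt.comp_hasDerivAt (f := fun s' : ℝ => (t', s')) s ht'.hasFDerivAt
      (hr (t', s))).deriv
  have h2 : (fun s' => deriv (fun t' => f t' s') t) =ᶠ[𝓝 s]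
      fun s' => fderiv ℝ g (t, s') (1, 0) := by
    have hc : Tendsto (fun s' : ℝ => (t, s')) (𝓝 s) (𝓝 (t, s)) :=
      (hr (t, s)).continuousAt
    filter_upwards [hc.eventually hd] with s' hs'
    exact (HasFDerivAt.comp_hasDerivAt (f := fun t' : ℝ => (t', s')) t hs'.hasFDerivAt
      (hl (t, s'))).deriv
  have h3 : HasDerivAt (fun t' => fderiv ℝ g (t', s) (0, 1))
      (fderiv ℝ (fderiv ℝ g) (t, s) (1, 0) (0, 1)) t := by
    have := (HasFDerivAt.comp_hasDerivAt (f := fun t' : ℝ => (t', s)) t hd2 (hl (t, s))).clm_apply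
      (hasDerivAt_const t ((0 : ℝ), (1 : ℝ)))
    simpa using this
  have h4 : HasDerivAt (fun s' => fderiv ℝ g (t, s') (1, 0))
      (fderiv ℝ (fderiv ℝ g) (t, s) (0, 1) (1, 0)) s := by
    have := (HasFDerivAt.comp_hasDerivAt (f := fun s' : ℝ => (t, s')) s hd2 (hr (t, s))).clm_apply
      (hasDerivAt_const s ((1 : ℝ), (0 : ℝ)))
    simpa using this
  have hsymm : fderiv ℝ (fderiv ℝ g) (t, s) (1, 0) (0, 1) =
      fderiv ℝ (fderiv ℝ g) (t, s) (0, 1) (1, 0) :=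
    (hf.isSymmSndFDerivAt (by simp)) _ _
  rw [h2.deriv_eq, h4.deriv, ← hsymm]
  exact h3.congr_of_eventuallyEq h1

/-- The endomorphism `w ↦ T(v, w)` for the torsion of the connection with Christoffel symbols
`G`. -/
def torsionOp (G : E → E →L[ℝ] E →L[ℝ] E) (x v : E) : E →L[ℝ] E := G x v - (G x).flip v

theorem torsionOp_apply (G : E → E →L[ℝ] E →L[ℝ] E) (x v w : E) :
    torsionOp G x v w = G x v w - G x w v := rfl

/-- The endomorphism `w ↦ R(v, w) v` for the curvature of the connection with Christoffel symbols
`G`. -/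
def curvatureOp (G : E → E →L[ℝ] E →L[ℝ] E) (x v : E) : E →L[ℝ] E :=
  (fderiv ℝ G x v).flip v - ((fderiv ℝ G x).flip v).flip v + G x v ∘L (G x).flip v
    - (G x).flip (G x v v)

theorem curvatureOp_apply (G : E → E →L[ℝ] E →L[ℝ] E) (x v w : E) :
    curvatureOp G x v w = fderiv ℝ G x v w v - fderiv ℝ G x w v v + G x v (G x w v)
      - G x w (G x v v) := rfl

namespace IsExpChart

variable {G : E → E →L[ℝ] E →L[ℝ] E} {U : Set E} {x₀ : E} {r : ℝ} {ex : E → E}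
  {P : E → E →L[ℝ] E}

theorem contDiffAt_ex (h : IsExpChart G U x₀ r ex P) {X : E} (hX : X ∈ Metric.ball 0 r) :
    ContDiffAt ℝ ∞ ex X := h.contDiffOn_ex.contDiffAt (Metric.isOpen_ball.mem_nhds hX)

theorem contDiffAt_P (h : IsExpChart G U x₀ r ex P) {X : E} (hX : X ∈ Metric.ball 0 r) :
    ContDiffAt ℝ ∞ P X := h.contDiffOn_P.contDiffAt (Metric.isOpen_ball.mem_nhds hX)

theorem eventually_smul_mem (h : IsExpChart G U x₀ r ex P) (X : E) :
    ∀ᶠ t : ℝ in 𝓝 0, t • X ∈ Metric.ball (0 : E) r := by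
  have hc : ContinuousAt (fun t : ℝ => t • X) 0 := by fun_prop
  exact hc.eventually_mem (by simp only [zero_smul]; exact Metric.ball_mem_nhds _ h.pos)

theorem _root_.eq_of_eventually_smul_eq {F : Type*} [NormedAddCommGroup F] [NormedSpace ℝ F]
    {f g : ℝ → F} (hf : ContinuousAt f 0) (hg : ContinuousAt g 0)
    (h : ∀ᶠ t in 𝓝 0, t • f t = t • g t) : f 0 = g 0 := by
  have h1 : Tendsto f (𝓝[≠] 0) (𝓝 (f 0)) := hf.tendsto.mono_left nhdsWithin_le_nhds
  have h2 : Tendsto g (𝓝[≠] 0) (𝓝 (g 0)) := hg.tendsto.mono_left nhdsWithin_le_nhds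
  refine tendsto_nhds_unique (h1.congr' ?_) h2
  filter_upwards [h.filter_mono nhdsWithin_le_nhds, self_mem_nhdsWithin] with t ht ht0
  exact smul_right_injective F ht0 ht

theorem hasDerivAt_smul_comp {F : Type*} [NormedAddCommGroup F] [NormedSpace ℝ F] {f : E → F}
    {X : E} {t : ℝ} (hf : DifferentiableAt ℝ f (t • X)) :
    HasDerivAt (fun s : ℝ => f (s • X)) (fderiv ℝ f (t • X) X) t := by
  have h1 : HasDerivAt (fun s : ℝ => s • X) X t := by simpa using (hasDerivAt_id t).smul_const X
  exact hf.hasFDerivAt.comp_hasDerivAt t h1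

/-- The radial geodesic `t ↦ ex (t X)` has the velocity `P (t X) X`. -/
theorem hasDerivAt_ex (h : IsExpChart G U x₀ r ex P) {X : E} {t : ℝ}
    (ht : t • X ∈ Metric.ball (0 : E) r) :
    HasDerivAt (fun s : ℝ => ex (s • X)) (P (t • X) X) t := by
  have hd := hasDerivAt_smul_comp ((h.contDiffAt_ex ht).differentiableAt (by simp))
  rcases eq_or_ne t 0 with rfl | h0
  · simpa [h.fderiv_ex_zero, h.P_zero] using hd
  · have h1 := h.fderiv_ex _ ht
    rw [map_smul, map_smul] at h1
    rwa [smul_right_injective E h0 h1] at hd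

/-- The transport `t ↦ P (t X)` along a radial geodesic is parallel. -/
theorem hasDerivAt_P (h : IsExpChart G U x₀ r ex P) (hU : IsOpen U) (hG : ContDiffOn ℝ ∞ G U)
    {X : E} {t : ℝ} (ht : t • X ∈ Metric.ball (0 : E) r) :
    HasDerivAt (fun s : ℝ => P (s • X)) (-(G (ex (t • X)) (P (t • X) X) ∘L P (t • X))) t := by
  have hd := hasDerivAt_smul_comp ((h.contDiffAt_P ht).differentiableAt (by simp))
  have h1 : ∀ s : ℝ, s • X ∈ Metric.ball (0 : E) r →
      s • fderiv ℝ P (s • X) X = s • (-(G (ex (s • X)) (P (s • X) X) ∘L P (s • X))) := by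
    intro s hs
    have h1 := h.fderiv_P _ hs
    rw [map_smul] at h1
    rw [h1]
    simp
  rcases eq_or_ne t 0 with rfl | h0
  · refine hd.congr_deriv ?_
    have h0 : (0 : E) ∈ Metric.ball (0 : E) r := Metric.mem_ball_self h.pos
    have hc : ContinuousAt (fun s : ℝ => s • X) 0 := by fun_prop
    have hP : ContinuousAt (fun s : ℝ => P (s • X)) 0 :=
      ContinuousAt.comp (by simpa using (h.contDiffAt_P h0).continuousAt) hc
    have he : ContinuousAt (fun s : ℝ => ex (s • X)) 0 :=
      ContinuousAt.comp (by simpa using (h.contDiffAt_ex h0).continuousAt) hc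
    have hGc : ContinuousAt (fun s : ℝ => G (ex (s • X))) 0 :=
      ContinuousAt.comp (g := G) ((hG.contDiffAt (hU.mem_nhds (h.mem _ ht))).continuousAt) he
    have hP' : ContinuousAt (fun s : ℝ => fderiv ℝ P (s • X)) 0 :=
      ContinuousAt.comp (g := fderiv ℝ P) (((h.contDiffAt_P ht).fderiv_right (m := 0)
        (by simp)).continuousAt) hc
    refine (eq_of_eventually_smul_eq (hP'.clm_apply continuousAt_const)
      ((hGc.clm_apply (hP.clm_apply continuousAt_const)).clm_comp hP).neg ?_)
    filter_upwards [h.eventually_smul_mem X] with s hs using h1 s hs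
  · rwa [smul_right_injective _ h0 (h1 t ht)] at hd

set_option synthInstance.maxHeartbeats 200000 in
theorem _root_.HasDerivAt.ringInverse {A : Type*} [NormedRing A] [NormedAlgebra ℝ A]
    [HasSummableGeomSeries A] {p : ℝ → A} {p' : A} {t : ℝ} (hp : HasDerivAt p p' t)
    (hu : IsUnit (p t)) : HasDerivAt (fun s => Ring.inverse (p s))
      (-(Ring.inverse (p t) * p' * Ring.inverse (p t))) t := by
  obtain ⟨u, hu⟩ := hu
  have h1 := hasFDerivAt_ringInverse (𝕜 := ℝ) u
  rw [hu] at h1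
  refine (h1.comp_hasDerivAt t hp).congr_deriv ?_
  simp [← hu]

/-- The inverse `P⁻¹` of the transport satisfies the dual equation. -/
theorem hasDerivAt_inverse_P [FiniteDimensional ℝ E] (h : IsExpChart G U x₀ r ex P) (hU : IsOpen U)
    (hG : ContDiffOn ℝ ∞ G U) {X : E} {t : ℝ} (ht : t • X ∈ Metric.ball (0 : E) r) :
    HasDerivAt (fun s : ℝ => Ring.inverse (P (s • X)))
      (Ring.inverse (P (t • X)) ∘L G (ex (t • X)) (P (t • X) X)) t := by
  have : CompleteSpace E := FiniteDimensional.complete ℝ E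
  have hu := h.isUnit_P _ ht
  refine ((h.hasDerivAt_P hU hG ht).ringInverse hu).congr_deriv ?_
  have h2 := Ring.mul_inverse_cancel _ hu
  simp only [← ContinuousLinearMap.mul_def, mul_neg, neg_mul, neg_neg, mul_assoc, h2, mul_one]

end IsExpChart

end ChartConnection

/-! ### Jacobi fields along radial geodesics -/

namespace ChartConnection.IsExpChart

variable {E : Type*} [NormedAddCommGroup E] [NormedSpace ℝ E]
variable {G : E → E →L[ℝ] E →L[ℝ] E} {U : Set E} {x₀ : E} {r : ℝ} {ex : E → E}
  {P : E → E →L[ℝ] E}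

/-- The variation of the velocities of the radial geodesics in the direction `Y`,
`∂_s (P (t (X + s Y)) (X + s Y))` at `s = 0`. -/
def velocityVariation (P : E → E →L[ℝ] E) (X Y : E) (t : ℝ) : E :=
  t • fderiv ℝ P (t • X) Y X + P (t • X) Y

/-- The Jacobi field `∂_s ex (t (X + s Y))` at `s = 0`. -/
def jacobiField (ex : E → E) (X Y : E) (t : ℝ) : E := t • fderiv ℝ ex (t • X) Y

theorem hasDerivAt_variation {F : Type*} [NormedAddCommGroup F] [NormedSpace ℝ F] {f : E → F}
    {X Y : E} {t : ℝ} (hf : DifferentiableAt ℝ f (t • X)) :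
    HasDerivAt (fun s : ℝ => f (t • (X + s • Y))) (t • fderiv ℝ f (t • X) Y) 0 := by
  have h1 : HasDerivAt (fun s : ℝ => t • (X + s • Y)) (t • Y) 0 := by
    have h := (((hasDerivAt_id (0 : ℝ)).smul_const Y).const_add X).const_smul t
    rwa [one_smul] at h
  have hf' : HasFDerivAt f (fderiv ℝ f (t • X)) (t • (X + (0 : ℝ) • Y)) := by
    simpa using hf.hasFDerivAt
  exact (hf'.comp_hasDerivAt 0 h1).congr_deriv (map_smul _ _ _)

theorem hasDerivAt_ex_variation (h : IsExpChart G U x₀ r ex P) {X : E} (Y : E) {t : ℝ}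
    (ht : t • X ∈ Metric.ball (0 : E) r) :
    HasDerivAt (fun s : ℝ => ex (t • (X + s • Y))) (jacobiField ex X Y t) 0 :=
  hasDerivAt_variation ((h.contDiffAt_ex ht).differentiableAt (by simp))

theorem hasDerivAt_velocity_variation (h : IsExpChart G U x₀ r ex P) {X : E} (Y : E) {t : ℝ}
    (ht : t • X ∈ Metric.ball (0 : E) r) :
    HasDerivAt (fun s : ℝ => P (t • (X + s • Y)) (X + s • Y)) (velocityVariation P X Y t) 0 := by
  have h1 := hasDerivAt_variation (Y := Y) ((h.contDiffAt_P ht).differentiableAt (by simp))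
  have h2 : HasDerivAt (fun s : ℝ => X + s • Y) Y 0 := by
    simpa using ((hasDerivAt_id (0 : ℝ)).smul_const Y).const_add X
  simpa [velocityVariation] using h1.clm_apply h2

theorem contDiffAt_two_var {F : Type*} [NormedAddCommGroup F] [NormedSpace ℝ F] {f : E → F}
    {X Y : E} {t : ℝ} (hf : ContDiffAt ℝ ∞ f (t • X)) :
    ContDiffAt ℝ 2 (fun q : ℝ × ℝ => f (q.1 • (X + q.2 • Y))) (t, 0) := by
  have hf' : ContDiffAt ℝ 2 f ((t, (0 : ℝ)).1 • (X + (t, (0 : ℝ)).2 • Y)) := by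
    simpa using contDiffAt_infty.1 hf 2
  refine ContDiffAt.comp (t, (0 : ℝ)) (f := fun q : ℝ × ℝ => q.1 • (X + q.2 • Y)) hf' ?_
  exact contDiffAt_fst.smul (contDiffAt_const.add (contDiffAt_snd.smul contDiffAt_const))

theorem eventually_variation_mem {X Y : E} {t : ℝ} (ht : t • X ∈ Metric.ball (0 : E) r) :
    ∀ᶠ s : ℝ in 𝓝 0, t • (X + s • Y) ∈ Metric.ball (0 : E) r := by
  have hc : ContinuousAt (fun s : ℝ => t • (X + s • Y)) 0 := by fun_prop
  exact hc.eventually_mem (Metric.isOpen_ball.mem_nhds (by simpa using ht))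

set_option synthInstance.maxHeartbeats 200000 in
theorem hasDerivAt_bilin {x v w : ℝ → E} {x' v' w' : E} {t : ℝ} (hG : DifferentiableAt ℝ G (x t))
    (hx : HasDerivAt x x' t) (hv : HasDerivAt v v' t) (hw : HasDerivAt w w' t) :
    HasDerivAt (fun s => G (x s) (v s) (w s))
      (fderiv ℝ G (x t) x' (v t) (w t) + G (x t) v' (w t) + G (x t) (v t) w') t := by
  have h1 : HasDerivAt (fun s => G (x s)) (fderiv ℝ G (x t) x') t :=
    HasFDerivAt.comp_hasDerivAt (F := E) (E := E →L[ℝ] E →L[ℝ] E) (l := G) (f := x) t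
      hG.hasFDerivAt hx
  have h2 : HasDerivAt (fun s => G (x s) (v s)) (fderiv ℝ G (x t) x' (v t) + G (x t) v') t :=
    h1.clm_apply hv
  exact (h2.clm_apply hw).congr_deriv (by simp)

/-- The derivative of the Jacobi field is the variation of the velocity, by the symmetry of second
derivatives. -/
theorem hasDerivAt_jacobiField (h : IsExpChart G U x₀ r ex P) {X : E} (Y : E) {t : ℝ}
    (ht : t • X ∈ Metric.ball (0 : E) r) :
    HasDerivAt (jacobiField ex X Y) (velocityVariation P X Y t) t := by
  have hm := hasDerivAt_deriv_comm (f := fun t s : ℝ => ex (t • (X + s • Y))) (t := t) (s := 0)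
    (contDiffAt_two_var (h.contDiffAt_ex ht))
  have h1 : (fun s : ℝ => deriv (fun t' : ℝ => ex (t' • (X + s • Y))) t) =ᶠ[𝓝 0]
      fun s => P (t • (X + s • Y)) (X + s • Y) := by
    filter_upwards [eventually_variation_mem ht] with s hs using (h.hasDerivAt_ex hs).deriv
  have h2 : (fun t' : ℝ => deriv (fun s : ℝ => ex (t' • (X + s • Y))) 0) =ᶠ[𝓝 t]
      jacobiField ex X Y := by
    have hc : ContinuousAt (fun t' : ℝ => t' • X) t := by fun_prop
    filter_upwards [hc.eventually_mem (Metric.isOpen_ball.mem_nhds ht)] with t' ht'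
      using (h.hasDerivAt_ex_variation Y ht').deriv
  rw [h1.deriv_eq, (h.hasDerivAt_velocity_variation Y ht).deriv] at hm
  exact hm.congr_of_eventuallyEq h2.symm

/-- The velocity `v = P (t X) X` solves the geodesic equation `v' = -G(v, v)`. -/
theorem hasDerivAt_velocity (h : IsExpChart G U x₀ r ex P) (hU : IsOpen U)
    (hG : ContDiffOn ℝ ∞ G U) {X : E} {t : ℝ} (ht : t • X ∈ Metric.ball (0 : E) r) :
    HasDerivAt (fun s : ℝ => P (s • X) X)
      (-(G (ex (t • X)) (P (t • X) X) (P (t • X) X))) t := by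
  simpa using (h.hasDerivAt_P hU hG ht).clm_apply (hasDerivAt_const t X)

/-- The variation of the geodesic equation. -/
theorem hasDerivAt_velocityVariation (h : IsExpChart G U x₀ r ex P) (hU : IsOpen U)
    (hG : ContDiffOn ℝ ∞ G U) {X : E} (Y : E) {t : ℝ} (ht : t • X ∈ Metric.ball (0 : E) r) :
    HasDerivAt (velocityVariation P X Y)
      (-(fderiv ℝ G (ex (t • X)) (jacobiField ex X Y t) (P (t • X) X) (P (t • X) X)
        + G (ex (t • X)) (velocityVariation P X Y t) (P (t • X) X)
        + G (ex (t • X)) (P (t • X) X) (velocityVariation P X Y t))) t := by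
  have hsm : ContDiffAt ℝ 2 (fun q : ℝ × ℝ => P (q.1 • (X + q.2 • Y)) (X + q.2 • Y)) (t, 0) :=
    (contDiffAt_two_var (h.contDiffAt_P ht)).clm_apply
      (contDiffAt_const.add (contDiffAt_snd.smul contDiffAt_const))
  have hm := hasDerivAt_deriv_comm (f := fun t s : ℝ => P (t • (X + s • Y)) (X + s • Y)) hsm
  have h1 : (fun s : ℝ => deriv (fun t' : ℝ => P (t' • (X + s • Y)) (X + s • Y)) t) =ᶠ[𝓝 0]
      fun s => -(G (ex (t • (X + s • Y))) (P (t • (X + s • Y)) (X + s • Y))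
        (P (t • (X + s • Y)) (X + s • Y))) := by
    filter_upwards [eventually_variation_mem ht] with s hs
      using (h.hasDerivAt_velocity hU hG hs).deriv
  have h2 : (fun t' : ℝ => deriv (fun s : ℝ => P (t' • (X + s • Y)) (X + s • Y)) 0) =ᶠ[𝓝 t]
      velocityVariation P X Y := by
    have hc : ContinuousAt (fun t' : ℝ => t' • X) t := by fun_prop
    filter_upwards [hc.eventually_mem (Metric.isOpen_ball.mem_nhds ht)] with t' ht'
      using (h.hasDerivAt_velocity_variation Y ht').deriv
  have hv := h.hasDerivAt_velocity_variation Y ht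
  have hx0 : t • (X + (0 : ℝ) • Y) = t • X := by simp
  have hG' : DifferentiableAt ℝ G (ex (t • (X + (0 : ℝ) • Y))) := by
    rw [hx0]
    exact (hG.contDiffAt (hU.mem_nhds (h.mem _ ht))).differentiableAt (by simp)
  have h3 := (hasDerivAt_bilin hG' (h.hasDerivAt_ex_variation Y ht) hv hv).neg
  rw [h1.deriv_eq] at hm
  refine (hm.congr_of_eventuallyEq h2.symm).congr_deriv (h3.deriv.trans ?_)
  simp only [zero_smul, add_zero]

/-- The Jacobi field transported back to the origin. -/
def pulledJacobiField (ex : E → E) (P : E → E →L[ℝ] E) (X Y : E) (t : ℝ) : E :=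
  Ring.inverse (P (t • X)) (jacobiField ex X Y t)

/-- The covariant derivative `∇_s` of the velocity field, transported back to the origin. -/
def pulledVelocityVariation (G : E → E →L[ℝ] E →L[ℝ] E) (ex : E → E) (P : E → E →L[ℝ] E)
    (X Y : E) (t : ℝ) : E :=
  Ring.inverse (P (t • X)) (velocityVariation P X Y t
    + G (ex (t • X)) (jacobiField ex X Y t) (P (t • X) X))

theorem P_inverse_P (h : IsExpChart G U x₀ r ex P) {X : E} (hX : X ∈ Metric.ball (0 : E) r)
    (Z : E) : P X (Ring.inverse (P X) Z) = Z :=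
  congrArg (fun L : E →L[ℝ] E => L Z) (Ring.mul_inverse_cancel _ (h.isUnit_P X hX))

theorem inverse_P_P (h : IsExpChart G U x₀ r ex P) {X : E} (hX : X ∈ Metric.ball (0 : E) r)
    (Z : E) : Ring.inverse (P X) (P X Z) = Z :=
  congrArg (fun L : E →L[ℝ] E => L Z) (Ring.inverse_mul_cancel _ (h.isUnit_P X hX))

/-- The torsion operator `w ↦ T(X, w)` along a radial geodesic, transported back to the origin. -/
def pulledTorsionOp (G : E → E →L[ℝ] E →L[ℝ] E) (ex : E → E) (P : E → E →L[ℝ] E) (X : E) (t : ℝ) :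
    E →L[ℝ] E :=
  Ring.inverse (P (t • X)) ∘L torsionOp G (ex (t • X)) (P (t • X) X) ∘L P (t • X)

/-- The curvature operator `w ↦ R(X, w) X` along a radial geodesic, transported back to the
origin. -/
def pulledCurvatureOp (G : E → E →L[ℝ] E →L[ℝ] E) (ex : E → E) (P : E → E →L[ℝ] E) (X : E)
    (t : ℝ) : E →L[ℝ] E :=
  Ring.inverse (P (t • X)) ∘L curvatureOp G (ex (t • X)) (P (t • X) X) ∘L P (t • X)

/-- The commutation of covariant derivatives `∇_t ∂_s = ∇_s ∂_t + T(∂_t, ∂_s)`. -/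
theorem hasDerivAt_pulledJacobiField [FiniteDimensional ℝ E] (h : IsExpChart G U x₀ r ex P)
    (hU : IsOpen U) (hG : ContDiffOn ℝ ∞ G U) {X : E} (Y : E) {t : ℝ}
    (ht : t • X ∈ Metric.ball (0 : E) r) :
    HasDerivAt (pulledJacobiField ex P X Y) (pulledVelocityVariation G ex P X Y t
      + pulledTorsionOp G ex P X t (pulledJacobiField ex P X Y t)) t := by
  refine ((h.hasDerivAt_inverse_P hU hG ht).clm_apply
    (h.hasDerivAt_jacobiField Y ht)).congr_deriv ?_
  simp only [pulledVelocityVariation, pulledTorsionOp, pulledJacobiField,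
    ContinuousLinearMap.comp_apply, h.P_inverse_P ht, torsionOp_apply]
  rw [← map_add, ← map_add]
  congr 1
  abel

/-- The commutation of covariant derivatives `∇_t ∇_s ∂_t = ∇_s ∇_t ∂_t + R(∂_t, ∂_s) ∂_t`, whose
first term vanishes for a variation by geodesics. -/
theorem hasDerivAt_pulledVelocityVariation [FiniteDimensional ℝ E]
    (h : IsExpChart G U x₀ r ex P) (hU : IsOpen U) (hG : ContDiffOn ℝ ∞ G U) {X : E} (Y : E)
    {t : ℝ} (ht : t • X ∈ Metric.ball (0 : E) r) :
    HasDerivAt (pulledVelocityVariation G ex P X Y)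
      (pulledCurvatureOp G ex P X t (pulledJacobiField ex P X Y t)) t := by
  have h1 := hasDerivAt_bilin
    ((hG.contDiffAt (hU.mem_nhds (h.mem _ ht))).differentiableAt (by simp))
    (h.hasDerivAt_ex ht) (h.hasDerivAt_jacobiField Y ht) (h.hasDerivAt_velocity hU hG ht)
  refine ((h.hasDerivAt_inverse_P hU hG ht).clm_apply
    ((h.hasDerivAt_velocityVariation hU hG Y ht).add h1)).congr_deriv ?_
  simp only [pulledCurvatureOp, pulledJacobiField, ContinuousLinearMap.comp_apply,
    h.P_inverse_P ht, curvatureOp_apply, Pi.add_apply, map_add, map_neg, map_sub]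
  abel

end ChartConnection.IsExpChart

/-! ### Taylor series of functions of one variable -/

namespace TaylorSeries

variable {W : Type*} [NormedRing W] [NormedAlgebra ℝ W]

/-- The Taylor series at `0` of a function of one real variable with values in an algebra. -/
def taylor (f : ℝ → W) : PowerSeries W := PowerSeries.mk fun k => (k ! : ℝ)⁻¹ • iteratedDeriv k f 0

theorem coeff_taylor (f : ℝ → W) (k : ℕ) :
    PowerSeries.coeff k (taylor f) = (k ! : ℝ)⁻¹ • iteratedDeriv k f 0 := PowerSeries.coeff_mk _ _

theorem taylor_congr {f g : ℝ → W} (h : f =ᶠ[𝓝 0] g) : taylor f = taylor g := by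
  ext k
  rw [coeff_taylor, coeff_taylor, h.iteratedDeriv_eq]

theorem taylor_sub {f g : ℝ → W} (hf : ContDiffAt ℝ ∞ f 0) (hg : ContDiffAt ℝ ∞ g 0) :
    taylor (fun t => f t - g t) = taylor f - taylor g := by
  ext k
  rw [map_sub, coeff_taylor, coeff_taylor, coeff_taylor, ← smul_sub,
    iteratedDeriv_fun_sub (contDiffAt_infty.1 hf k) (contDiffAt_infty.1 hg k)]

theorem taylor_mul {f g : ℝ → W} (hf : ContDiffAt ℝ ∞ f 0) (hg : ContDiffAt ℝ ∞ g 0) :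
    taylor (fun t => f t * g t) = taylor f * taylor g := by
  ext k
  rw [PowerSeries.coeff_mul, coeff_taylor,
    iteratedDeriv_fun_mul (contDiffAt_infty.1 hf k) (contDiffAt_infty.1 hg k),
    Finset.Nat.sum_antidiagonal_eq_sum_range_succ_mk, Finset.smul_sum]
  refine Finset.sum_congr rfl fun i hi => ?_
  have hik : i ≤ k := Nat.lt_succ_iff.1 (Finset.mem_range.1 hi)
  rw [coeff_taylor, coeff_taylor, smul_mul_smul_comm, mul_assoc, ← nsmul_eq_mul,
    ← Nat.cast_smul_eq_nsmul ℝ, smul_smul, Nat.cast_choose ℝ hik]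
  congr 1
  have := k.factorial_ne_zero
  field_simp

theorem coeff_taylor_deriv (f : ℝ → W) (k : ℕ) :
    PowerSeries.coeff k (taylor (deriv f)) =
      ((k : ℝ) + 1) • PowerSeries.coeff (k + 1) (taylor f) := by
  rw [coeff_taylor, coeff_taylor, iteratedDeriv_succ', smul_smul]
  congr 1
  rw [Nat.factorial_succ]
  push_cast
  have := k.factorial_ne_zero
  field_simp

theorem taylor_smul_one : taylor (fun t : ℝ => t • (1 : W)) = PowerSeries.X := by
  have hd : deriv (fun t : ℝ => t • (1 : W)) = fun _ => 1 := by
    ext t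
    simpa using ((hasDerivAt_id t).smul_const (1 : W)).deriv
  ext k
  rw [coeff_taylor, PowerSeries.coeff_X]
  rcases k with _ | _ | k
  · simp
  · simp [iteratedDeriv_succ', hd]
  · rw [iteratedDeriv_succ', hd, iteratedDeriv_succ', deriv_const']
    simp

theorem taylor_smul {f : ℝ → W} (hf : ContDiffAt ℝ ∞ f 0) :
    taylor (fun t => t • f t) = PowerSeries.X * taylor f := by
  have h1 : ContDiffAt ℝ ∞ (fun t : ℝ => t • (1 : W)) 0 := contDiffAt_id.smul contDiffAt_const
  rw [← taylor_smul_one, ← taylor_mul h1 hf]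
  simp

/-- The Taylor coefficients of a solution of `(t a)'' = ρ (t a) + (τ (t a))'`. -/
theorem coeff_taylor_of_jacobi {a ρ τ : ℝ → W} (ha : ContDiffAt ℝ ∞ a 0) (hρ : ContDiffAt ℝ ∞ ρ 0)
    (hτ : ContDiffAt ℝ ∞ τ 0)
    (h : ∀ᶠ t in 𝓝 0, deriv (fun s => deriv (fun s => s • a s) s - τ s * (s • a s)) t =
      ρ t * (t • a t)) (n : ℕ) :
    ((n : ℝ) * (n + 1)) • PowerSeries.coeff n (taylor a) =
      PowerSeries.coeff n (PowerSeries.X ^ 2 * taylor ρ * taylor a) +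
        (n : ℝ) • PowerSeries.coeff n (PowerSeries.X * taylor τ * taylor a) := by
  have hm : ContDiffAt ℝ ∞ (fun s => s • a s) 0 := contDiffAt_id.smul ha
  have hm' : ContDiffAt ℝ ∞ (deriv (fun s => s • a s)) 0 := by
    have h1 := hm.fderiv_right (m := ∞) (by simp)
    exact h1.clm_apply contDiffAt_const
  have h1 := taylor_congr (f := deriv _) (g := fun t => ρ t * (t • a t)) h
  have h2 := taylor_sub hm' (hτ.mul hm)
  rcases n with _ | n
  · simp [PowerSeries.coeff_mul, pow_two, mul_assoc]
  · have h3 := congrArg (PowerSeries.coeff n) h1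
    rw [coeff_taylor_deriv, h2, map_sub, coeff_taylor_deriv, taylor_mul hτ hm, taylor_mul hρ hm,
      taylor_smul ha, PowerSeries.coeff_succ_X_mul, ← mul_assoc, ← mul_assoc,
      (PowerSeries.commute_X _).eq, (PowerSeries.commute_X _).eq, mul_assoc, mul_assoc] at h3
    rw [pow_two, mul_assoc, mul_assoc, PowerSeries.coeff_succ_X_mul, mul_assoc, ← h3, smul_sub,
      smul_smul]
    push_cast
    rw [add_assoc (n : ℝ) 1 1]
    norm_num

end TaylorSeries

/-! ### The Jacobi equation for the backward parallel transport -/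

namespace ChartConnection.IsExpChart

variable {E : Type*} [NormedAddCommGroup E] [NormedSpace ℝ E] [FiniteDimensional ℝ E]
variable {G : E → E →L[ℝ] E →L[ℝ] E} {U : Set E} {x₀ : E} {r : ℝ} {ex : E → E}
  {P : E → E →L[ℝ] E}

theorem _root_.ContDiffAt.ringInverse' {A Q : Type*} [NormedRing A] [NormedAlgebra ℝ A]
    [HasSummableGeomSeries A] [NormedAddCommGroup Q] [NormedSpace ℝ Q] {p : Q → A} {q : Q}
    {n : ℕ∞ω} (hp : ContDiffAt ℝ n p q) (hu : IsUnit (p q)) :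
    ContDiffAt ℝ n (fun q => Ring.inverse (p q)) q := by
  obtain ⟨u, hu⟩ := hu
  exact ContDiffAt.comp q (hu ▸ contDiffAt_ringInverse ℝ u) hp

theorem contDiffAt_inverse_P (h : IsExpChart G U x₀ r ex P) {X : E}
    (hX : X ∈ Metric.ball (0 : E) r) : ContDiffAt ℝ ∞ (fun X => Ring.inverse (P X)) X := by
  have : CompleteSpace E := FiniteDimensional.complete ℝ E
  exact (h.contDiffAt_P hX).ringInverse' (h.isUnit_P X hX)

/-- The backward parallel transport in the chart. -/
def backward (ex : E → E) (P : E → E →L[ℝ] E) (X : E) : E →L[ℝ] E :=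
  Ring.inverse (P X) * fderiv ℝ ex X

theorem contDiffAt_backward (h : IsExpChart G U x₀ r ex P) {X : E}
    (hX : X ∈ Metric.ball (0 : E) r) : ContDiffAt ℝ ∞ (backward ex P) X :=
  (h.contDiffAt_inverse_P hX).mul ((h.contDiffAt_ex hX).fderiv_right (by simp))

theorem contDiffAt_comp_smul {F : Type*} [NormedAddCommGroup F] [NormedSpace ℝ F] {f : E → F}
    {X : E} {t : ℝ} (hf : ContDiffAt ℝ ∞ f (t • X)) :
    ContDiffAt ℝ ∞ (fun s : ℝ => f (s • X)) t :=
  ContDiffAt.comp t (f := fun s : ℝ => s • X) hf (contDiffAt_id.smul contDiffAt_const)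

/-- Smoothness at a point of a map into the bounded operators is smoothness of its values on
vectors. -/
theorem _root_.contDiffAt_clm_apply_iff' {Q F : Type*} [NormedAddCommGroup Q] [NormedSpace ℝ Q]
    [NormedAddCommGroup F] [NormedSpace ℝ F] {f : Q → E →L[ℝ] F} {q : Q} :
    ContDiffAt ℝ ∞ f q ↔ ∀ y, ContDiffAt ℝ ∞ (fun x => f x y) q := by
  refine ⟨fun h y => h.clm_apply contDiffAt_const, fun h => ?_⟩
  have : CompleteSpace E := FiniteDimensional.complete ℝ E
  let d := Module.finrank ℝ E
  have hd : d = Module.finrank ℝ (Fin d → ℝ) := (Module.finrank_fin_fun ℝ).symm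
  let e₁ := ContinuousLinearEquiv.ofFinrankEq hd
  let e₂ := (e₁.arrowCongr (1 : F ≃L[ℝ] F)).trans (ContinuousLinearEquiv.piRing (Fin d))
  rw [← Function.id_comp f, ← e₂.symm_comp_self]
  exact e₂.symm.contDiff.contDiffAt.comp q (contDiffAt_pi.mpr fun i => h _)

theorem contDiffAt_pulledTorsionOp (h : IsExpChart G U x₀ r ex P) (hU : IsOpen U)
    (hG : ContDiffOn ℝ ∞ G U) (X : E) : ContDiffAt ℝ ∞ (pulledTorsionOp G ex P X) 0 := by
  have h0 : (0 : ℝ) • X ∈ Metric.ball (0 : E) r := by simpa using h.pos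
  have hQ := contDiffAt_comp_smul (h.contDiffAt_inverse_P h0)
  have hP := contDiffAt_comp_smul (h.contDiffAt_P h0)
  have hg := contDiffAt_comp_smul (f := fun X => G (ex X))
    (ContDiffAt.comp ((0 : ℝ) • X) (hG.contDiffAt (hU.mem_nhds (h.mem _ h0)))
      (h.contDiffAt_ex h0))
  rw [contDiffAt_clm_apply_iff']
  intro Y
  have hv := hP.clm_apply (contDiffAt_const (c := X))
  have hy := hP.clm_apply (contDiffAt_const (c := Y))
  exact hQ.clm_apply (((hg.clm_apply hv).clm_apply hy).sub ((hg.clm_apply hy).clm_apply hv))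

theorem _root_.ContDiffAt.fderiv_comp_apply {Q V A : Type*} [NormedAddCommGroup Q]
    [NormedSpace ℝ Q] [NormedAddCommGroup V] [NormedSpace ℝ V] [NormedAddCommGroup A]
    [NormedSpace ℝ A] {g : V → A} {x v : Q → V} {q : Q} (hg : ContDiffAt ℝ ∞ g (x q))
    (hx : ContDiffAt ℝ ∞ x q) (hv : ContDiffAt ℝ ∞ v q) :
    ContDiffAt ℝ ∞ (fun s => fderiv ℝ g (x s) (v s)) q :=
  (ContDiffAt.comp q (hg.fderiv_right (by simp)) hx).clm_apply hv

set_option synthInstance.maxHeartbeats 200000 in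
theorem contDiffAt_pulledCurvatureOp (h : IsExpChart G U x₀ r ex P) (hU : IsOpen U)
    (hG : ContDiffOn ℝ ∞ G U) (X : E) : ContDiffAt ℝ ∞ (pulledCurvatureOp G ex P X) 0 := by
  have h0 : (0 : ℝ) • X ∈ Metric.ball (0 : E) r := by simpa using h.pos
  have hQ := contDiffAt_comp_smul (h.contDiffAt_inverse_P h0)
  have hP := contDiffAt_comp_smul (h.contDiffAt_P h0)
  have hx := contDiffAt_comp_smul (h.contDiffAt_ex h0)
  have hG0 := hG.contDiffAt (hU.mem_nhds (h.mem _ h0))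
  have hg := contDiffAt_comp_smul (f := fun X => G (ex X))
    (ContDiffAt.comp ((0 : ℝ) • X) hG0 (h.contDiffAt_ex h0))
  rw [contDiffAt_clm_apply_iff']
  intro Y
  have hv := hP.clm_apply (contDiffAt_const (c := X))
  have hy := hP.clm_apply (contDiffAt_const (c := Y))
  have hgv := hg.clm_apply hv
  have hgy := hg.clm_apply hy
  have hdv := hG0.fderiv_comp_apply (x := fun s : ℝ => ex (s • X)) hx hv
  have hdy := hG0.fderiv_comp_apply (x := fun s : ℝ => ex (s • X)) hx hy
  exact hQ.clm_apply ((((hdv.clm_apply hy).clm_apply hv).sub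
    ((hdy.clm_apply hv).clm_apply hv)).add (hgv.clm_apply (hgy.clm_apply hv)) |>.sub
      (hgy.clm_apply (hgv.clm_apply hv)))

/-- The Jacobi equation `(t Φ⁻¹)'' = ρ (t Φ⁻¹) + (τ (t Φ⁻¹))'` for the backward parallel transport
`Φ⁻¹(t X)` along a radial geodesic: applied to a vector, `t Φ⁻¹(t X)` is a Jacobi field transported
back to the origin, and `ρ`, `τ` are the curvature and torsion operators transported back. -/
theorem deriv_backward (h : IsExpChart G U x₀ r ex P) (hU : IsOpen U) (hG : ContDiffOn ℝ ∞ G U)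
    (X : E) :
    ∀ᶠ t in 𝓝 (0 : ℝ), deriv (fun s : ℝ => deriv (fun s : ℝ => s • backward ex P (s • X)) s
        - pulledTorsionOp G ex P X s * (s • backward ex P (s • X))) t =
      pulledCurvatureOp G ex P X t * (t • backward ex P (t • X)) := by
  have h0 : (0 : ℝ) • X ∈ Metric.ball (0 : E) r := by simpa using h.pos
  have hm : ContDiffAt ℝ ∞ (fun s : ℝ => s • backward ex P (s • X)) 0 :=
    contDiffAt_id.smul (contDiffAt_comp_smul (h.contDiffAt_backward h0))
  have hm' : ContDiffAt ℝ ∞ (deriv (fun s : ℝ => s • backward ex P (s • X))) 0 := by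
    have h1 := hm.fderiv_right (m := ∞) (by simp)
    exact h1.clm_apply contDiffAt_const
  have hK := hm'.sub ((h.contDiffAt_pulledTorsionOp hU hG X).mul hm)
  have hmY : ∀ Y (t : ℝ), (t • backward ex P (t • X)) Y = pulledJacobiField ex P X Y t := by
    intro Y t
    simp [backward, pulledJacobiField, jacobiField]
  have hev : ∀ᶠ t in 𝓝 (0 : ℝ), t • X ∈ Metric.ball (0 : E) r ∧
      DifferentiableAt ℝ (fun s : ℝ => s • backward ex P (s • X)) t := by
    refine (h.eventually_smul_mem X).and ?_
    filter_upwards [(contDiffAt_infty.1 hm 1).eventually (by simp)] with t ht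
      using ht.differentiableAt (by simp)
  have hKY : ∀ᶠ t in 𝓝 (0 : ℝ), ∀ Y, (deriv (fun s : ℝ => s • backward ex P (s • X)) t
        - pulledTorsionOp G ex P X t * (t • backward ex P (t • X))) Y =
      pulledVelocityVariation G ex P X Y t := by
    filter_upwards [hev] with t ht Y
    have h1 := ht.2.hasDerivAt.clm_apply (hasDerivAt_const t Y)
    rw [map_zero, add_zero] at h1
    simp only [hmY] at h1
    have h2 := h1.unique (h.hasDerivAt_pulledJacobiField hU hG Y ht.1)
    rw [sub_apply, h2, mul_apply_eq_comp, hmY]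
    abel
  filter_upwards [hKY.eventually_nhds, hev,
    (contDiffAt_infty.1 hK 1).eventually (by simp)] with t ht1 ht2 ht3
  ext Y
  have h1 := (ht3.differentiableAt (by simp)).hasDerivAt.clm_apply (hasDerivAt_const t Y)
  simp only [map_zero, add_zero] at h1
  have h2 := h.hasDerivAt_pulledVelocityVariation hU hG Y ht2.1
  have h3 := h1.unique (h2.congr_of_eventuallyEq (ht1.mono fun s hs => hs Y))
  rw [mul_apply_eq_comp, hmY, ← h3]

end ChartConnection.IsExpChart

/-! ### Vector fields in a chart -/

namespace AffineManifold

variable {E : Type*} [NormedAddCommGroup E] [NormedSpace ℝ E]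
  {M : Type*} [TopologicalSpace M] [ChartedSpace E M] [IsManifold 𝓘(ℝ, E) ∞ M]

section Chart

/-- The isomorphism `T_xM → E` given by the preferred chart at `p`, for `x` in its domain (zero for
other `x`). -/
def coord (p x : M) : TangentSpace 𝓘(ℝ, E) x →L[ℝ] E :=
  (trivializationAt E (TangentSpace 𝓘(ℝ, E) : M → Type _) p).continuousLinearMapAt ℝ x

/-- The inverse `E → T_xM` of the isomorphism given by the preferred chart at `p`. -/
def frame (p x : M) : E →L[ℝ] TangentSpace 𝓘(ℝ, E) x :=
  (trivializationAt E (TangentSpace 𝓘(ℝ, E) : M → Type _) p).symmL ℝ x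

/-- The representation of a vector field in the preferred chart at `p`, meaningful on its target. -/
def rep (p : M) (σ : Π x : M, TangentSpace 𝓘(ℝ, E) x) (y : E) : E :=
  coord p ((extChartAt 𝓘(ℝ, E) p).symm y) (σ ((extChartAt 𝓘(ℝ, E) p).symm y))

variable {p x : M}

theorem mem_baseSet (hx : x ∈ (extChartAt 𝓘(ℝ, E) p).source) :
    x ∈ (trivializationAt E (TangentSpace 𝓘(ℝ, E) : M → Type _) p).baseSet := by
  simpa using hx

theorem coord_apply (hx : x ∈ (extChartAt 𝓘(ℝ, E) p).source) (v : TangentSpace 𝓘(ℝ, E) x) :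
    coord p x v = (trivializationAt E (TangentSpace 𝓘(ℝ, E) : M → Type _) p ⟨x, v⟩).2 :=
  Trivialization.continuousLinearMapAt_apply_of_mem ℝ _ (mem_baseSet hx) v

theorem coord_frame (hx : x ∈ (extChartAt 𝓘(ℝ, E) p).source) (v : E) :
    coord p x (frame p x v) = v :=
  Trivialization.continuousLinearMapAt_symmL _ (mem_baseSet hx) v

theorem frame_coord (hx : x ∈ (extChartAt 𝓘(ℝ, E) p).source) (v : TangentSpace 𝓘(ℝ, E) x) :
    frame p x (coord p x v) = v :=
  Trivialization.symmL_continuousLinearMapAt _ (mem_baseSet hx) v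

theorem coord_injective (hx : x ∈ (extChartAt 𝓘(ℝ, E) p).source) :
    Function.Injective (coord (E := E) p x) :=
  Function.LeftInverse.injective (frame_coord hx)

theorem coord_eq_mfderiv (hx : x ∈ (extChartAt 𝓘(ℝ, E) p).source) :
    coord p x = mfderiv 𝓘(ℝ, E) 𝓘(ℝ, E) (extChartAt 𝓘(ℝ, E) p) x :=
  TangentBundle.continuousLinearMapAt_trivializationAt (by simpa using hx)

/-- At `p` itself, the preferred chart identifies `T_pM` with `E` by the identity, since `T_pM` is
defined as `E`. -/
theorem coord_self (v : TangentSpace 𝓘(ℝ, E) p) : coord p p v = v := by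
  rw [coord_eq_mfderiv (mem_extChartAt_source p), mfderiv_extChartAt_self]; rfl

theorem rep_apply (hx : x ∈ (extChartAt 𝓘(ℝ, E) p).source)
    (σ : Π x : M, TangentSpace 𝓘(ℝ, E) x) :
    rep p σ (extChartAt 𝓘(ℝ, E) p x) = coord p x (σ x) := by
  unfold rep
  rw [(extChartAt 𝓘(ℝ, E) p).left_inv hx]

theorem mdifferentiableAt_chart (hx : x ∈ (extChartAt 𝓘(ℝ, E) p).source) :
    MDifferentiableAt 𝓘(ℝ, E) 𝓘(ℝ, E) (extChartAt 𝓘(ℝ, E) p) x :=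
  mdifferentiableAt_extChartAt (by simpa using hx)

theorem contMDiffAt_chart_symm {y : E} (hy : y ∈ (extChartAt 𝓘(ℝ, E) p).target) :
    ContMDiffAt 𝓘(ℝ, E) 𝓘(ℝ, E) ∞ (extChartAt 𝓘(ℝ, E) p).symm y :=
  (contMDiffOn_extChartAt_symm p).contMDiffAt ((isOpen_extChartAt_target p).mem_nhds hy)

theorem eventuallyEq_comp_chart {Z : Type*} (f : M → Z)
    (hx : x ∈ (extChartAt 𝓘(ℝ, E) p).source) :
    f =ᶠ[𝓝 x] (f ∘ (extChartAt 𝓘(ℝ, E) p).symm) ∘ extChartAt 𝓘(ℝ, E) p := by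
  filter_upwards [extChartAt_source_mem_nhds' hx] with z hz
  rw [Function.comp_apply, Function.comp_apply, (extChartAt 𝓘(ℝ, E) p).left_inv hz]

theorem mdifferentiableAt_iff_chart {F : Type*} [NormedAddCommGroup F] [NormedSpace ℝ F]
    {f : M → F} (hx : x ∈ (extChartAt 𝓘(ℝ, E) p).source) :
    MDifferentiableAt 𝓘(ℝ, E) 𝓘(ℝ, F) f x ↔
      DifferentiableAt ℝ (f ∘ (extChartAt 𝓘(ℝ, E) p).symm) (extChartAt 𝓘(ℝ, E) p x) := by
  rw [← mdifferentiableAt_iff_differentiableAt]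
  refine ⟨fun h => ?_, fun h => ?_⟩
  · refine MDifferentiableAt.comp (extChartAt 𝓘(ℝ, E) p x) (I' := 𝓘(ℝ, E)) ?_
      ((contMDiffAt_chart_symm ((extChartAt 𝓘(ℝ, E) p).map_source hx)).mdifferentiableAt (by simp))
    rwa [(extChartAt 𝓘(ℝ, E) p).left_inv hx]
  · exact (MDifferentiableAt.comp x h (mdifferentiableAt_chart hx)).congr_of_eventuallyEq
      (eventuallyEq_comp_chart f hx)

theorem contMDiffAt_iff_chart {F : Type*} [NormedAddCommGroup F] [NormedSpace ℝ F]
    {f : M → F} (hx : x ∈ (extChartAt 𝓘(ℝ, E) p).source) :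
    ContMDiffAt 𝓘(ℝ, E) 𝓘(ℝ, F) ∞ f x ↔
      ContDiffAt ℝ ∞ (f ∘ (extChartAt 𝓘(ℝ, E) p).symm) (extChartAt 𝓘(ℝ, E) p x) := by
  rw [← contMDiffAt_iff_contDiffAt]
  refine ⟨fun h => ?_, fun h => ?_⟩
  · refine ContMDiffAt.comp (extChartAt 𝓘(ℝ, E) p x) (I' := 𝓘(ℝ, E)) ?_
      (contMDiffAt_chart_symm ((extChartAt 𝓘(ℝ, E) p).map_source hx))
    rwa [(extChartAt 𝓘(ℝ, E) p).left_inv hx]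
  · exact (ContMDiffAt.comp x h (contMDiffAt_extChartAt' (by simpa using hx))).congr_of_eventuallyEq
      (eventuallyEq_comp_chart f hx)

theorem mfderiv_eq_chart {F : Type*} [NormedAddCommGroup F] [NormedSpace ℝ F]
    {f : M → F} (hx : x ∈ (extChartAt 𝓘(ℝ, E) p).source)
    (hf : MDifferentiableAt 𝓘(ℝ, E) 𝓘(ℝ, F) f x) (v : TangentSpace 𝓘(ℝ, E) x) :
    mfderiv 𝓘(ℝ, E) 𝓘(ℝ, F) f x v =
      fderiv ℝ (f ∘ (extChartAt 𝓘(ℝ, E) p).symm) (extChartAt 𝓘(ℝ, E) p x) (coord p x v) := by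
  have hd := (mdifferentiableAt_iff_chart hx).1 hf
  rw [(eventuallyEq_comp_chart f hx).mfderiv_eq,
    mfderiv_comp x hd.mdifferentiableAt (mdifferentiableAt_chart hx), mfderiv_eq_fderiv,
    coord_eq_mfderiv hx]
  rfl

theorem rep_eventuallyEq (hx : x ∈ (extChartAt 𝓘(ℝ, E) p).source)
    (σ : Π x : M, TangentSpace 𝓘(ℝ, E) x) :
    (fun z => (trivializationAt E (TangentSpace 𝓘(ℝ, E) : M → Type _) p ⟨z, σ z⟩).2) ∘
      (extChartAt 𝓘(ℝ, E) p).symm =ᶠ[𝓝 (extChartAt 𝓘(ℝ, E) p x)] rep p σ := by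
  filter_upwards [(isOpen_extChartAt_target p).mem_nhds ((extChartAt 𝓘(ℝ, E) p).map_source hx)]
    with y hy
  exact (coord_apply ((extChartAt 𝓘(ℝ, E) p).map_target hy) _).symm

theorem mdifferentiableAt_section_iff_rep (hx : x ∈ (extChartAt 𝓘(ℝ, E) p).source)
    {σ : Π x : M, TangentSpace 𝓘(ℝ, E) x} :
    MDiffAt (T% σ) x ↔ DifferentiableAt ℝ (rep p σ) (extChartAt 𝓘(ℝ, E) p x) := by
  rw [(trivializationAt E (TangentSpace 𝓘(ℝ, E) : M → Type _) p).mdifferentiableAt_section_iff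
    𝓘(ℝ, E) σ (mem_baseSet hx), mdifferentiableAt_iff_chart hx]
  exact (rep_eventuallyEq hx σ).differentiableAt_iff

theorem contMDiffAt_section_iff_rep (hx : x ∈ (extChartAt 𝓘(ℝ, E) p).source)
    {σ : Π x : M, TangentSpace 𝓘(ℝ, E) x} :
    ContMDiffAt 𝓘(ℝ, E) (𝓘(ℝ, E).prod 𝓘(ℝ, E)) ∞ (T% σ) x ↔
      ContDiffAt ℝ ∞ (rep p σ) (extChartAt 𝓘(ℝ, E) p x) := by
  rw [(trivializationAt E (TangentSpace 𝓘(ℝ, E) : M → Type _) p).contMDiffAt_section_iff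
    (mem_baseSet hx), contMDiffAt_iff_chart hx]
  have h : _ =ᶠ[_] _ := rep_eventuallyEq hx σ
  exact ⟨fun h' => h'.congr_of_eventuallyEq h.symm, fun h' => h'.congr_of_eventuallyEq h⟩

theorem contDiffOn_rep (X : VField E M) :
    ContDiffOn ℝ ∞ (rep p X) (extChartAt 𝓘(ℝ, E) p).target := by
  intro y hy
  have h := (contMDiffAt_section_iff_rep ((extChartAt 𝓘(ℝ, E) p).map_target hy)).1
    (X.contMDiff ((extChartAt 𝓘(ℝ, E) p).symm y))
  rw [(extChartAt 𝓘(ℝ, E) p).right_inv hy] at h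
  exact h.contDiffWithinAt

theorem rep_add (σ σ' : Π x : M, TangentSpace 𝓘(ℝ, E) x) :
    rep p (σ + σ') = rep p σ + rep p σ' := by
  ext y
  exact map_add (coord p ((extChartAt 𝓘(ℝ, E) p).symm y)) _ _

theorem rep_smul (f : M → ℝ) (σ : Π x : M, TangentSpace 𝓘(ℝ, E) x) (y : E) :
    rep p (f • σ) y = (f ∘ (extChartAt 𝓘(ℝ, E) p).symm) y • rep p σ y :=
  map_smul (coord p ((extChartAt 𝓘(ℝ, E) p).symm y)) _ _

/-- The flat covariant derivative in the preferred chart at `p`. The Christoffel symbols measure the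
difference of a connection to it. -/
def flatCov (p : M) (σ : Π x : M, TangentSpace 𝓘(ℝ, E) x) (x : M) :
    TangentSpace 𝓘(ℝ, E) x →L[ℝ] TangentSpace 𝓘(ℝ, E) x :=
  frame p x ∘L fderiv ℝ (rep p σ) (extChartAt 𝓘(ℝ, E) p x) ∘L coord p x

theorem isCovariantDerivativeOn_flatCov :
    IsCovariantDerivativeOn E (flatCov (E := E) p) (extChartAt 𝓘(ℝ, E) p).source where
  add {σ σ' x} hσ hσ' hx := by
    rw [mdifferentiableAt_section_iff_rep hx] at hσ hσ'
    ext v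
    simp only [flatCov, rep_add, fderiv_add hσ hσ']
    simp
  leibniz {σ g x} hσ hg hx := by
    rw [mdifferentiableAt_section_iff_rep hx] at hσ
    have hg' := (mdifferentiableAt_iff_chart hx).1 hg
    ext v
    have h1 : rep p (g • σ) = (g ∘ (extChartAt 𝓘(ℝ, E) p).symm) • rep p σ :=
      funext fun y => rep_smul g σ y
    have h2 : d% g x v = fderiv ℝ (g ∘ (extChartAt 𝓘(ℝ, E) p).symm)
      (extChartAt 𝓘(ℝ, E) p x) (coord p x v) := mfderiv_eq_chart hx hg v
    have h3 : (g ∘ (extChartAt 𝓘(ℝ, E) p).symm) (extChartAt 𝓘(ℝ, E) p x) = g x := by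
      rw [Function.comp_apply, (extChartAt 𝓘(ℝ, E) p).left_inv hx]
    simp only [flatCov, h1, fderiv_smul hg' hσ, h3, rep_apply hx, ContinuousLinearMap.comp_apply,
      add_apply, smul_apply, ContinuousLinearMap.smulRight_apply, h2, map_add,
      map_smul, frame_coord hx]

end Chart

end AffineManifold

/-! ### Christoffel symbols, torsion and curvature in a chart -/

namespace AffineManifold

variable {E : Type*} [NormedAddCommGroup E] [NormedSpace ℝ E] [FiniteDimensional ℝ E]
  {M : Type*} [TopologicalSpace M] [ChartedSpace E M] [IsManifold 𝓘(ℝ, E) ∞ M]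
  {p x : M}

/-- The Lie bracket of vector fields is computed in the preferred chart. -/
theorem rep_mlieBracket {y : E} (hy : y ∈ (extChartAt 𝓘(ℝ, E) p).target) (X Y : VField E M) :
    rep p (lie X Y) y = VectorField.lieBracket ℝ (rep p X) (rep p Y) y := by
  have : CompleteSpace E := FiniteDimensional.complete ℝ E
  have hpull : ∀ σ : Π x : M, TangentSpace 𝓘(ℝ, E) x, ∀ z ∈ (extChartAt 𝓘(ℝ, E) p).target,
      VectorField.mpullback 𝓘(ℝ, E) 𝓘(ℝ, E) (extChartAt 𝓘(ℝ, E) p).symm σ z = rep p σ z := by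
    intro σ z hz
    have h1 := TangentBundle.symmL_trivializationAt (I := 𝓘(ℝ, E)) (x₀ := p)
      (x := (extChartAt 𝓘(ℝ, E) p).symm z)
      (by simpa using (extChartAt 𝓘(ℝ, E) p).map_target hz)
    rw [(extChartAt 𝓘(ℝ, E) p).right_inv hz] at h1
    have h1' : mfderiv 𝓘(ℝ, E) 𝓘(ℝ, E) (extChartAt 𝓘(ℝ, E) p).symm z =
        frame (E := E) p ((extChartAt 𝓘(ℝ, E) p).symm z) := by
      refine Eq.trans ?_ h1.symm
      rw [modelWithCornersSelf_coe, Set.range_id, mfderivWithin_univ]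
    have hm := (extChartAt 𝓘(ℝ, E) p).map_target hz
    rw [VectorField.mpullback_apply, h1']
    have h2 : (frame (E := E) p ((extChartAt 𝓘(ℝ, E) p).symm z)).inverse =
        coord (E := E) p ((extChartAt 𝓘(ℝ, E) p).symm z) :=
      ContinuousLinearMap.inverse_eq (by ext v; exact frame_coord hm v)
        (by ext v; exact coord_frame hm v)
    exact DFunLike.congr_fun h2 (σ ((extChartAt 𝓘(ℝ, E) p).symm z))
  have hnhds := (isOpen_extChartAt_target (I := 𝓘(ℝ, E)) p).mem_nhds hy
  rw [← hpull _ y hy]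
  have h := VectorField.mpullback_mlieBracket (I := 𝓘(ℝ, E)) (I' := 𝓘(ℝ, E)) (n := ∞)
    (f := (extChartAt 𝓘(ℝ, E) p).symm) (V := X) (W := Y) (x₀ := y)
    (X.mdifferentiableAt _) (Y.mdifferentiableAt _) (contMDiffAt_chart_symm hy)
    (by simp only [minSmoothness_of_isRCLikeNormedField]; exact ENat.LEInfty.out)
  refine h.trans ?_
  have h3 := Filter.EventuallyEq.mlieBracket_vectorField_eq (I := 𝓘(ℝ, E)) (x := y)
    (V₁ := VectorField.mpullback 𝓘(ℝ, E) 𝓘(ℝ, E) (extChartAt 𝓘(ℝ, E) p).symm X) (V := rep p X)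
    (W₁ := VectorField.mpullback 𝓘(ℝ, E) 𝓘(ℝ, E) (extChartAt 𝓘(ℝ, E) p).symm Y) (W := rep p Y)
    (by filter_upwards [hnhds] with z hz using hpull _ z hz)
    (by filter_upwards [hnhds] with z hz using hpull _ z hz)
  refine h3.trans ?_
  have h4 := congrFun (VectorField.mlieBracketWithin_eq_lieBracketWithin (𝕜 := ℝ) (V := rep p X)
    (W := rep p Y) (s := Set.univ)) y
  exact (congrFun VectorField.mlieBracketWithin_univ y).symm.trans
    (h4.trans (congrFun VectorField.lieBracketWithin_univ y))

variable [T2Space M]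

/-- The linear extension of vectors in the model space to vector fields that are constant near `p`
in the preferred chart. -/
def extendL (p : M) : E →ₗ[ℝ] VField E M := extendVector (E := E) p

theorem rep_extendL {y : E} (hy : y ∈ (extChartAt 𝓘(ℝ, E) p).target) (v : E) :
    rep p (extendL p v) y =
      Classical.arbitrary (SmoothBumpFunction 𝓘(ℝ, E) p) ((extChartAt 𝓘(ℝ, E) p).symm y) • v := by
  have hm := (extChartAt 𝓘(ℝ, E) p).map_target hy
  have h1 : FiberBundle.extend E (x := p) v ((extChartAt 𝓘(ℝ, E) p).symm y) =
      frame p ((extChartAt 𝓘(ℝ, E) p).symm y) v := by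
    refine (extend_eq_symmₗ p (by simpa using hm) _).trans ?_
    exact congrArg (frame p _) (coord_self (E := E) (p := p) v)
  refine (map_smul (coord p ((extChartAt 𝓘(ℝ, E) p).symm y)) _ _).trans ?_
  rw [h1, coord_frame hm]

/-- A neighbourhood of the base point in the preferred chart at `p` where the vector fields
`extendVector p v` are constant. -/
def flatDomain (p : M) : Set E :=
  interior ((extChartAt 𝓘(ℝ, E) p).target ∩ (extChartAt 𝓘(ℝ, E) p).symm ⁻¹'
    {x | Classical.arbitrary (SmoothBumpFunction 𝓘(ℝ, E) p) x = 1})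

theorem isOpen_flatDomain : IsOpen (flatDomain (E := E) p) := isOpen_interior

theorem flatDomain_subset : flatDomain (E := E) p ⊆ (extChartAt 𝓘(ℝ, E) p).target :=
  interior_subset.trans Set.inter_subset_left

theorem mem_flatDomain : extChartAt 𝓘(ℝ, E) p p ∈ flatDomain (E := E) p := by
  rw [flatDomain, mem_interior_iff_mem_nhds]
  refine inter_mem (extChartAt_target_mem_nhds p) ?_
  refine (continuousAt_extChartAt_symm p).preimage_mem_nhds ?_
  rw [extChartAt_to_inv]
  exact (Classical.arbitrary (SmoothBumpFunction 𝓘(ℝ, E) p)).eventuallyEq_one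

theorem rep_extendL_of_mem {y : E} (hy : y ∈ flatDomain (E := E) p) (v : E) :
    rep p (extendL p v) y = v := by
  have h := interior_subset hy
  rw [rep_extendL h.1, show Classical.arbitrary (SmoothBumpFunction 𝓘(ℝ, E) p) _ = 1 from h.2,
    one_smul]

variable (cov : Connection E M) [CovariantDerivative.ContMDiffCovariantDerivative cov ∞]

/-- The representation in the preferred chart at `p`, at a point, as a linear map on vector
fields. -/
def repL (p : M) (y : E) : VField E M →ₗ[ℝ] E where
  toFun X := rep p X y
  map_add' X Y := congrFun (rep_add (X : Π x : M, TangentSpace 𝓘(ℝ, E) x) Y) y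
  map_smul' _ _ := map_smul (coord p ((extChartAt 𝓘(ℝ, E) p).symm y)) _ _

/-- The Christoffel symbols of a connection in the preferred chart at `p`; the first argument is the
direction of differentiation. -/
def christoffel (p : M) (y : E) : E →L[ℝ] E →L[ℝ] E :=
  LinearMap.toContinuousLinearMap (LinearMap.toContinuousLinearMap.toLinearMap ∘ₗ
    (((nabla cov).compl₁₂ (extendL p) (extendL p)).compr₂ (repL p y)))

theorem christoffel_apply (y v w : E) :
    christoffel cov p y v w = rep p (nabla cov (extendL p v) (extendL p w)) y := rfl

theorem contDiffOn_christoffel :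
    ContDiffOn ℝ ∞ (christoffel cov p) (extChartAt 𝓘(ℝ, E) p).target :=
  contDiffOn_clm_apply.2 fun v => contDiffOn_clm_apply.2 fun w =>
    contDiffOn_rep (nabla cov (extendL p v) (extendL p w))

/-- The covariant derivative in the preferred chart. The difference to the flat covariant derivative
is tensorial, hence determined by its values on fields that are constant in the chart. -/
theorem coord_cov (hx : x ∈ (extChartAt 𝓘(ℝ, E) p).source)
    (hxU : extChartAt 𝓘(ℝ, E) p x ∈ flatDomain (E := E) p)
    {σ : Π x : M, TangentSpace 𝓘(ℝ, E) x} (hσ : MDiffAt (T% σ) x) (w : TangentSpace 𝓘(ℝ, E) x) :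
    coord p x (cov σ x w) =
      fderiv ℝ (rep p σ) (extChartAt 𝓘(ℝ, E) p x) (coord p x w) +
        christoffel cov p (extChartAt 𝓘(ℝ, E) p x) (coord p x w) (coord p x (σ x)) := by
  have hcov := cov.isCovariantDerivativeOn (s := (extChartAt 𝓘(ℝ, E) p).source)
  have hflat := isCovariantDerivativeOn_flatCov (E := E) (p := p)
  have key : ∀ {σ : Π x : M, TangentSpace 𝓘(ℝ, E) x}, MDiffAt (T% σ) x → coord p x (cov σ x w) =
      fderiv ℝ (rep p σ) (extChartAt 𝓘(ℝ, E) p x) (coord p x w) +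
        coord p x (hcov.difference hflat x (σ x) w) := by
    intro σ hσ
    rw [IsCovariantDerivativeOn.difference_apply hcov hflat hx hσ, sub_apply, map_sub,
      flatCov, ContinuousLinearMap.comp_apply, ContinuousLinearMap.comp_apply, coord_frame hx]
    abel
  have hext : ∀ v : E, extendL p v x = frame p x v := by
    intro v
    apply coord_injective hx
    rw [← rep_apply hx, rep_extendL_of_mem hxU, coord_frame hx]
  have hconst : ∀ v : E, fderiv ℝ (rep p (extendL p v)) (extChartAt 𝓘(ℝ, E) p x) = 0 := by
    intro v
    have h : rep p (extendL p v) =ᶠ[𝓝 (extChartAt 𝓘(ℝ, E) p x)] fun _ => v := by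
      filter_upwards [isOpen_flatDomain.mem_nhds hxU] with y hy using rep_extendL_of_mem hy v
    rw [h.fderiv_eq]
    exact fderiv_const_apply v
  rw [key hσ]
  have h1 := key ((extendL p (coord p x (σ x))).mdifferentiableAt x)
  rw [hconst, hext, frame_coord hx, zero_apply, zero_add] at h1
  rw [← h1, christoffel_apply, rep_apply hx]
  congr 2
  change _ = cov _ x _
  rw [hext, frame_coord hx]

theorem rep_nabla {y : E} (hy : y ∈ flatDomain (E := E) p) (X Y : VField E M) :
    rep p (nabla cov X Y) y = fderiv ℝ (rep p Y) y (rep p X y) +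
      christoffel cov p y (rep p X y) (rep p Y y) := by
  have ht := flatDomain_subset hy
  have hx := (extChartAt 𝓘(ℝ, E) p).map_target ht
  have h := coord_cov cov hx (by rwa [(extChartAt 𝓘(ℝ, E) p).right_inv ht]) (Y.mdifferentiableAt _)
    (X ((extChartAt 𝓘(ℝ, E) p).symm y))
  rw [(extChartAt 𝓘(ℝ, E) p).right_inv ht] at h
  exact h

theorem rep_torsionTensor {y : E} (hy : y ∈ flatDomain (E := E) p) (Y : Fin 2 → VField E M) :
    rep p (torsionTensor cov Y) y =
      ChartConnection.torsionOp (christoffel cov p) y (rep p (Y 0) y) (rep p (Y 1) y) := by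
  have h : rep p (torsionTensor cov Y) y = rep p (nabla cov (Y 0) (Y 1)) y
      - rep p (nabla cov (Y 1) (Y 0)) y - rep p (lie (Y 0) (Y 1)) y := by
    change repL p y (nabla cov (Y 0) (Y 1) - nabla cov (Y 1) (Y 0) - lie (Y 0) (Y 1)) = _
    rw [map_sub, map_sub]
    rfl
  rw [h, rep_nabla cov hy, rep_nabla cov hy, rep_mlieBracket (flatDomain_subset hy),
    VectorField.lieBracket, ChartConnection.torsionOp_apply]
  abel

/-- The curvature `R(v, w) z` of the connection with Christoffel symbols `G`. -/
def _root_.ChartConnection.curvature (G : E → E →L[ℝ] E →L[ℝ] E) (x v w z : E) : E :=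
  fderiv ℝ G x v w z - fderiv ℝ G x w v z + G x v (G x w z) - G x w (G x v z)

theorem rep_nabla_nabla {y : E} (hy : y ∈ flatDomain (E := E) p) (X Y Z : VField E M) :
    rep p (nabla cov X (nabla cov Y Z)) y =
      fderiv ℝ (fderiv ℝ (rep p Z)) y (rep p X y) (rep p Y y) +
      fderiv ℝ (rep p Z) y (fderiv ℝ (rep p Y) y (rep p X y)) +
      fderiv ℝ (christoffel cov p) y (rep p X y) (rep p Y y) (rep p Z y) +
      christoffel cov p y (fderiv ℝ (rep p Y) y (rep p X y)) (rep p Z y) +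
      christoffel cov p y (rep p Y y) (fderiv ℝ (rep p Z) y (rep p X y)) +
      christoffel cov p y (rep p X y) (fderiv ℝ (rep p Z) y (rep p Y y) +
        christoffel cov p y (rep p Y y) (rep p Z y)) := by
  have hnhds := isOpen_flatDomain.mem_nhds hy
  have htn := (isOpen_extChartAt_target (I := 𝓘(ℝ, E)) p).mem_nhds (flatDomain_subset hy)
  have hev : rep p (nabla cov Y Z) =ᶠ[𝓝 y] fun y => fderiv ℝ (rep p Z) y (rep p Y y) +
      christoffel cov p y (rep p Y y) (rep p Z y) := by
    filter_upwards [hnhds] with z hz using rep_nabla cov hz Y Z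
  have hG : HasFDerivAt (christoffel cov p) (fderiv ℝ (christoffel cov p) y) y :=
    (((contDiffOn_christoffel cov).contDiffAt htn).differentiableAt (by simp)).hasFDerivAt
  have hY : HasFDerivAt (rep p Y) (fderiv ℝ (rep p Y) y) y :=
    (((contDiffOn_rep Y).contDiffAt htn).differentiableAt (by simp)).hasFDerivAt
  have hZ : HasFDerivAt (rep p Z) (fderiv ℝ (rep p Z) y) y :=
    (((contDiffOn_rep Z).contDiffAt htn).differentiableAt (by simp)).hasFDerivAt
  have hZ' : HasFDerivAt (fderiv ℝ (rep p Z)) (fderiv ℝ (fderiv ℝ (rep p Z)) y) y :=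
    ((((contDiffOn_rep Z).contDiffAt htn).fderiv_right (m := 1)
      (by norm_cast)).differentiableAt (by simp)).hasFDerivAt
  have h := (hZ'.clm_apply hY).add ((hG.clm_apply hY).clm_apply hZ)
  rw [rep_nabla cov hy, rep_nabla cov hy, (h.congr_of_eventuallyEq hev).fderiv]
  simp only [add_apply, ContinuousLinearMap.comp_apply, ContinuousLinearMap.flip_apply]
  abel

theorem rep_curvatureTensor {y : E} (hy : y ∈ flatDomain (E := E) p) (Y : Fin 3 → VField E M) :
    rep p (curvatureTensor cov Y) y =
      ChartConnection.curvature (christoffel cov p) y (rep p (Y 0) y) (rep p (Y 1) y)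
        (rep p (Y 2) y) := by
  have h : rep p (curvatureTensor cov Y) y = rep p (nabla cov (Y 0) (nabla cov (Y 1) (Y 2))) y
      - rep p (nabla cov (Y 1) (nabla cov (Y 0) (Y 2))) y
      - rep p (nabla cov (lie (Y 0) (Y 1)) (Y 2)) y := by
    change repL p y (nabla cov (Y 0) (nabla cov (Y 1) (Y 2))
      - nabla cov (Y 1) (nabla cov (Y 0) (Y 2)) - nabla cov (lie (Y 0) (Y 1)) (Y 2)) = _
    rw [map_sub, map_sub]
    rfl
  have hsymm : IsSymmSndFDerivAt ℝ (rep p (Y 2)) y :=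
    ((contDiffOn_rep (Y 2)).contDiffAt ((isOpen_extChartAt_target (I := 𝓘(ℝ, E)) p).mem_nhds
      (flatDomain_subset hy))).isSymmSndFDerivAt
        (by simp only [minSmoothness_of_isRCLikeNormedField]; exact ENat.LEInfty.out)
  rw [h, rep_nabla_nabla cov hy, rep_nabla_nabla cov hy, rep_nabla cov hy,
    rep_mlieBracket (flatDomain_subset hy), VectorField.lieBracket, ChartConnection.curvature,
    hsymm.eq (rep p (Y 0) y) (rep p (Y 1) y)]
  simp only [map_add, map_sub, sub_apply]
  abel

end AffineManifold

/-! ### Covariant derivatives along curves in a chart -/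

namespace AffineManifold

variable {E : Type*} [NormedAddCommGroup E] [NormedSpace ℝ E]
  {M : Type*} [TopologicalSpace M] [ChartedSpace E M] [IsManifold 𝓘(ℝ, E) ∞ M]
  {p : M}

theorem hasDerivAt_chart_curve {γ : ℝ → M} {t : ℝ}
    (hsrc : γ t ∈ (extChartAt 𝓘(ℝ, E) p).source) (hγ : MDifferentiableAt 𝓘(ℝ, ℝ) 𝓘(ℝ, E) γ t) :
    HasDerivAt (fun s => extChartAt 𝓘(ℝ, E) p (γ s))
      (coord p (γ t) (mfderiv 𝓘(ℝ, ℝ) 𝓘(ℝ, E) γ t (1 : ℝ))) t := by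
  have h : HasFDerivAt (E := ℝ) (F := E) (fun s => extChartAt 𝓘(ℝ, E) p (γ s))
      ((mfderiv 𝓘(ℝ, E) 𝓘(ℝ, E) (extChartAt 𝓘(ℝ, E) p) (γ t)).comp
        (mfderiv 𝓘(ℝ, ℝ) 𝓘(ℝ, E) γ t)) t :=
    (HasMFDerivAt.comp t (mdifferentiableAt_chart hsrc).hasMFDerivAt hγ.hasMFDerivAt).hasFDerivAt
  rw [coord_eq_mfderiv hsrc]
  have key : ∀ L : ℝ →L[ℝ] E, HasFDerivAt (fun s => extChartAt 𝓘(ℝ, E) p (γ s)) L t →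
      HasDerivAt (fun s => extChartAt 𝓘(ℝ, E) p (γ s)) (L 1) t := fun L hL => hL.hasDerivAt
  exact key _ h

theorem differentiableAt_coord_curve {V : ℝ → TangentBundle 𝓘(ℝ, E) M} {t : ℝ}
    (hsrc : (V t).proj ∈ (extChartAt 𝓘(ℝ, E) p).source) :
    MDifferentiableAt 𝓘(ℝ, ℝ) 𝓘(ℝ, E).tangent V t ↔
      MDifferentiableAt 𝓘(ℝ, ℝ) 𝓘(ℝ, E) (fun s => (V s).proj) t ∧
        DifferentiableAt ℝ
          (fun s => (trivializationAt E (TangentSpace 𝓘(ℝ, E) : M → Type _) p (V s)).2) t := by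
  rw [← mdifferentiableAt_iff_differentiableAt]
  exact (trivializationAt E (TangentSpace 𝓘(ℝ, E) : M → Type _) p).mdifferentiableAt_totalSpace_iff
    𝓘(ℝ, E) V ((Trivialization.mem_source _).2 (mem_baseSet hsrc))

theorem frame_apply {x : M} (hx : x ∈ (extChartAt 𝓘(ℝ, E) p).source) (v : E) :
    frame p x v = (trivializationAt E (TangentSpace 𝓘(ℝ, E) : M → Type _) p).symm x v :=
  Trivialization.symmL_apply _ (mem_baseSet hx) v

theorem eventually_curve_mem {V : ℝ → TangentBundle 𝓘(ℝ, E) M} {t : ℝ}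
    (hV : MDifferentiableAt 𝓘(ℝ, ℝ) 𝓘(ℝ, E).tangent V t)
    (hsrc : (V t).proj ∈ (extChartAt 𝓘(ℝ, E) p).source) :
    ∀ᶠ s in 𝓝 t, (V s).proj ∈ (extChartAt 𝓘(ℝ, E) p).source :=
  (((differentiableAt_coord_curve hsrc).1 hV).1.continuousAt).preimage_mem_nhds
    ((isOpen_extChartAt_source p).mem_nhds hsrc)

theorem coord_curve_eventuallyEq {V : ℝ → TangentBundle 𝓘(ℝ, E) M} {t : ℝ}
    (hV : MDifferentiableAt 𝓘(ℝ, ℝ) 𝓘(ℝ, E).tangent V t)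
    (hsrc : (V t).proj ∈ (extChartAt 𝓘(ℝ, E) p).source) :
    (fun s => (trivializationAt E (TangentSpace 𝓘(ℝ, E) : M → Type _) p (V s)).2) =ᶠ[𝓝 t]
      fun s => coord p (V s).proj (V s).2 := by
  filter_upwards [eventually_curve_mem hV hsrc] with s hs using (coord_apply hs _).symm

variable [FiniteDimensional ℝ E] [T2Space M]
variable (cov : Connection E M) [CovariantDerivative.ContMDiffCovariantDerivative cov ∞]

/-- The covariant derivative along a curve in the preferred chart at `p`. By definition it is
computed in the chart at the base point `q` of `V t`; the derivative of the transition map `D`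
appears both in the derivative of the components and in the covariant derivative of the extension,
and cancels. -/
theorem coord_covDerivAlong {V : ℝ → TangentBundle 𝓘(ℝ, E) M} {t : ℝ}
    (hV : MDifferentiableAt 𝓘(ℝ, ℝ) 𝓘(ℝ, E).tangent V t)
    (hsrc : (V t).proj ∈ (extChartAt 𝓘(ℝ, E) p).source)
    (hU : extChartAt 𝓘(ℝ, E) p (V t).proj ∈ flatDomain (E := E) p) :
    coord p (V t).proj (covDerivAlong cov V t) =
      deriv (fun s => coord p (V s).proj (V s).2) t +
        christoffel cov p (extChartAt 𝓘(ℝ, E) p (V t).proj)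
          (deriv (fun s => extChartAt 𝓘(ℝ, E) p (V s).proj) t) (coord p (V t).proj (V t).2) := by
  set q := (V t).proj with hq
  have hγ := ((differentiableAt_coord_curve hsrc).1 hV).1
  have hqq : q ∈ (extChartAt 𝓘(ℝ, E) q).source := mem_extChartAt_source q
  have hc := ((differentiableAt_coord_curve (p := q) (t := t) hqq).1 hV).2.hasDerivAt
  -- the transition from the trivialization at `q` to the one at `p`
  let D : M → E →L[ℝ] E := fun x => (coord p x).comp (frame (E := E) q x)
  have hD : MDifferentiableAt 𝓘(ℝ, E) 𝓘(ℝ, E →L[ℝ] E) D q := by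
    have h1 : MDifferentiableAt 𝓘(ℝ, E) 𝓘(ℝ, E →L[ℝ] E) (fun b : M =>
        ((trivializationAt E (TangentSpace 𝓘(ℝ, E) : M → Type _) q).coordChangeL ℝ
          (trivializationAt E (TangentSpace 𝓘(ℝ, E) : M → Type _) p) b : E →L[ℝ] E)) q :=
      mdifferentiableAt_coordChangeL (mem_baseSet hqq) (mem_baseSet hsrc)
    refine h1.congr_of_eventuallyEq ?_
    filter_upwards [extChartAt_source_mem_nhds' hsrc, extChartAt_source_mem_nhds' hqq]
      with x hxp hxq
    ext v
    refine (coord_apply hxp _).trans ?_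
    refine (congrArg (fun w => (trivializationAt E (TangentSpace 𝓘(ℝ, E) : M → Type _) p
      ⟨x, w⟩).2) (frame_apply hxq v)).trans ?_
    exact (Trivialization.coordChangeL_apply _ _ ⟨mem_baseSet hxq, mem_baseSet hxp⟩ v).symm
  have hDφ := ((mdifferentiableAt_iff_chart hsrc).1 hD).hasFDerivAt
  have hx := hasDerivAt_chart_curve hsrc hγ
  have hDγ := hDφ.comp_hasDerivAt t hx
  have hprod := hDγ.clm_apply hc
  have hsrcev := eventually_curve_mem hV hsrc
  have hqev := eventually_curve_mem hV hqq
  have hval : D q = (D ∘ (extChartAt 𝓘(ℝ, E) p).symm) (extChartAt 𝓘(ℝ, E) p q) := by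
    rw [Function.comp_apply, (extChartAt 𝓘(ℝ, E) p).left_inv hsrc]
  have hcoord : (fun s => coord p (V s).proj (V s).2) =ᶠ[𝓝 t] fun s =>
      ((D ∘ (extChartAt 𝓘(ℝ, E) p).symm) ∘ fun s => extChartAt 𝓘(ℝ, E) p (V s).proj) s
        ((trivializationAt E (TangentSpace 𝓘(ℝ, E) : M → Type _) q (V s)).2) := by
    filter_upwards [hsrcev, hqev] with s hs hs'
    simp only [Function.comp_apply]
    rw [(extChartAt 𝓘(ℝ, E) p).left_inv hs]
    have h2 := coord_apply hs' (V s).2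
    change _ = coord p (V s).proj (frame q (V s).proj _)
    rw [← frame_coord hs' (V s).2, h2]
  rw [hcoord.deriv_eq, hprod.deriv, hx.deriv]
  have hext := FiberBundle.mdifferentiableAt_extend (I := 𝓘(ℝ, E)) (F := E) (V t).2
  have hrep : rep p (FiberBundle.extend E (V t).2) =ᶠ[𝓝 (extChartAt 𝓘(ℝ, E) p q)] fun y =>
      (D ∘ (extChartAt 𝓘(ℝ, E) p).symm) y
        ((trivializationAt E (TangentSpace 𝓘(ℝ, E) : M → Type _) q (V t)).2) := by
    have hcont : ContinuousAt (extChartAt 𝓘(ℝ, E) p).symm (extChartAt 𝓘(ℝ, E) p q) :=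
      continuousAt_extChartAt_symm' hsrc
    have hm : (extChartAt 𝓘(ℝ, E) q).source ∈
        𝓝 ((extChartAt 𝓘(ℝ, E) p).symm (extChartAt 𝓘(ℝ, E) p q)) := by
      rw [(extChartAt 𝓘(ℝ, E) p).left_inv hsrc]
      exact extChartAt_source_mem_nhds q
    filter_upwards [hcont.preimage_mem_nhds hm] with y hy
    exact congrArg (coord p _) (frame_apply hy _).symm
  have h3 := coord_cov cov hsrc hU hext
    (mfderiv 𝓘(ℝ, ℝ) 𝓘(ℝ, E) (fun s => (V s).proj) t (1 : ℝ))
  have h4 : fderiv ℝ (rep p (FiberBundle.extend E (V t).2)) (extChartAt 𝓘(ℝ, E) p q) =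
      (fderiv ℝ (D ∘ (extChartAt 𝓘(ℝ, E) p).symm) (extChartAt 𝓘(ℝ, E) p q)).flip
        ((trivializationAt E (TangentSpace 𝓘(ℝ, E) : M → Type _) q (V t)).2) := by
    rw [hrep.fderiv_eq]
    refine (hDφ.clm_apply (hasFDerivAt_const _ _)).fderiv.trans ?_
    simp
  rw [h4, FiberBundle.extend_apply_self] at h3
  have h5 : coord p q (covDerivAlong cov V t) = coord p q (frame q q (deriv (fun s =>
      (trivializationAt E (TangentSpace 𝓘(ℝ, E) : M → Type _) q (V s)).2) t)) +
      coord p q (cov (FiberBundle.extend E (V t).2) q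
        (mfderiv 𝓘(ℝ, ℝ) 𝓘(ℝ, E) (fun s => (V s).proj) t (1 : ℝ))) :=
    by rw [frame_apply hqq]; exact map_add (coord p q) _ _
  rw [h5, h3]
  simp only [Function.comp_apply, (extChartAt 𝓘(ℝ, E) p).left_inv hsrc, ← hq,
    ContinuousLinearMap.flip_apply]
  change D q _ + _ = _
  abel

end AffineManifold

/-! ### Uniqueness of geodesics -/

/-- Local uniqueness of the geodesics of the connection with Christoffel symbols `G`. -/
theorem ChartConnection.eventuallyEq_of_geodesic {E : Type*} [NormedAddCommGroup E]
    [NormedSpace ℝ E] {G : E → E →L[ℝ] E →L[ℝ] E} {x₁ x₂ : ℝ → E} {t : ℝ}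
    (hG : ContDiffAt ℝ ∞ G (x₁ t)) (h1 : ContDiffAt ℝ 2 x₁ t) (h2 : ContDiffAt ℝ 2 x₂ t)
    (hx : x₁ t = x₂ t) (hv : deriv x₁ t = deriv x₂ t)
    (he1 : ∀ᶠ s in 𝓝 t, deriv (deriv x₁) s + G (x₁ s) (deriv x₁ s) (deriv x₁ s) = 0)
    (he2 : ∀ᶠ s in 𝓝 t, deriv (deriv x₂) s + G (x₂ s) (deriv x₂ s) (deriv x₂ s) = 0) :
    x₁ =ᶠ[𝓝 t] x₂ := by
  let F : E × E → E × E := fun z => (z.2, -(G z.1 z.2 z.2))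
  have hF : ContDiffAt ℝ 1 F (x₁ t, deriv x₁ t) := by
    refine contDiffAt_snd.prodMk ?_
    have hG1 : ContDiffAt ℝ 1 (fun z : E × E => G z.1) (x₁ t, deriv x₁ t) :=
      ContDiffAt.comp (x₁ t, deriv x₁ t) (g := G) (f := Prod.fst)
        (contDiffAt_infty.1 hG 1) contDiffAt_fst
    exact ((hG1.clm_apply contDiffAt_snd).clm_apply contDiffAt_snd).neg
  obtain ⟨K, u, hu, hK⟩ := hF.exists_lipschitzOnWith
  have main : ∀ {x : ℝ → E}, ContDiffAt ℝ 2 x t →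
      (∀ᶠ s in 𝓝 t, deriv (deriv x) s + G (x s) (deriv x s) (deriv x s) = 0) →
      x t = x₁ t → deriv x t = deriv x₁ t →
      ∀ᶠ s in 𝓝 t, HasDerivAt (fun s => (x s, deriv x s)) (F (x s, deriv x s)) s ∧
        (x s, deriv x s) ∈ u := by
    intro x hx he h0 h0'
    have hd : ContDiffAt ℝ 1 (deriv x) t := by
      have := hx.fderiv_right (m := 1) (by norm_num)
      exact this.clm_apply contDiffAt_const
    have hc : ContinuousAt (fun s => (x s, deriv x s)) t :=
      hx.continuousAt.prodMk hd.continuousAt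
    have hmem : ∀ᶠ s in 𝓝 t, (x s, deriv x s) ∈ u := by
      refine hc.preimage_mem_nhds ?_
      rwa [h0, h0']
    filter_upwards [hmem, he, hx.eventually (by simp), hd.eventually (by simp)]
      with s hs1 hs2 hs3 hs4
    refine ⟨?_, hs1⟩
    have h3 : HasDerivAt (deriv x) (-(G (x s) (deriv x s) (deriv x s))) s := by
      rw [← eq_neg_of_add_eq_zero_left hs2]
      exact (hs4.differentiableAt (by simp)).hasDerivAt
    exact ((hs3.differentiableAt (by simp)).hasDerivAt).prodMk h3
  have h := ODE_solution_unique_of_eventually (v := fun _ => F) (s := fun _ => u) (K := K)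
    (Eventually.of_forall fun _ => hK) (main h1 he1 rfl rfl) (main h2 he2 hx.symm hv.symm)
    (by simp only [hx, hv])
  filter_upwards [h] with s hs using congrArg Prod.fst hs

namespace AffineManifold

variable {E : Type*} [NormedAddCommGroup E] [NormedSpace ℝ E]
  {M : Type*} [TopologicalSpace M] [ChartedSpace E M] [IsManifold 𝓘(ℝ, E) ∞ M]
  {p : M}

theorem deriv_chart_curve_eventuallyEq {γ : ℝ → M} {t : ℝ}
    (hsrc : γ t ∈ (extChartAt 𝓘(ℝ, E) p).source) (hγ : ContMDiffAt 𝓘(ℝ, ℝ) 𝓘(ℝ, E) 2 γ t) :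
    ∀ᶠ s in 𝓝 t, coord p (γ s) (velocity (E := E) γ s).2 =
      deriv (fun s => extChartAt 𝓘(ℝ, E) p (γ s)) s := by
  filter_upwards [(contMDiffAt_iff_contMDiffAt_nhds (by simp)).1 hγ,
    hγ.continuousAt.preimage_mem_nhds ((isOpen_extChartAt_source p).mem_nhds hsrc)] with s hs hs'
  exact (hasDerivAt_chart_curve hs' (hs.mdifferentiableAt (by simp))).deriv.symm

theorem contDiffAt_chart_curve {γ : ℝ → M} {t : ℝ}
    (hsrc : γ t ∈ (extChartAt 𝓘(ℝ, E) p).source) (hγ : ContMDiffAt 𝓘(ℝ, ℝ) 𝓘(ℝ, E) 2 γ t) :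
    ContDiffAt ℝ 2 (fun s => extChartAt 𝓘(ℝ, E) p (γ s)) t := by
  rw [← contMDiffAt_iff_contDiffAt]
  exact ContMDiffAt.comp t (contMDiffAt_extChartAt' (by simpa using hsrc)) hγ

theorem contDiffAt_deriv_chart_curve {γ : ℝ → M} {t : ℝ}
    (hsrc : γ t ∈ (extChartAt 𝓘(ℝ, E) p).source) (hγ : ContMDiffAt 𝓘(ℝ, ℝ) 𝓘(ℝ, E) 2 γ t) :
    ContDiffAt ℝ 1 (deriv (fun s => extChartAt 𝓘(ℝ, E) p (γ s))) t :=
  ((contDiffAt_chart_curve hsrc hγ).fderiv_right (m := 1) (by norm_num)).clm_apply contDiffAt_const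

theorem mdifferentiableAt_velocity {γ : ℝ → M} {t : ℝ}
    (hsrc : γ t ∈ (extChartAt 𝓘(ℝ, E) p).source) (hγ : ContMDiffAt 𝓘(ℝ, ℝ) 𝓘(ℝ, E) 2 γ t) :
    MDifferentiableAt 𝓘(ℝ, ℝ) 𝓘(ℝ, E).tangent (velocity (E := E) γ) t := by
  rw [differentiableAt_coord_curve (p := p) hsrc]
  refine ⟨hγ.mdifferentiableAt (by simp), ?_⟩
  refine DifferentiableAt.congr_of_eventuallyEq
    ((contDiffAt_deriv_chart_curve hsrc hγ).differentiableAt (by simp)) ?_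
  filter_upwards [deriv_chart_curve_eventuallyEq hsrc hγ,
    hγ.continuousAt.preimage_mem_nhds ((isOpen_extChartAt_source p).mem_nhds hsrc)] with s hs hs'
  rw [← hs]
  exact (coord_apply hs' _).symm

variable [FiniteDimensional ℝ E] [T2Space M]
variable (cov : Connection E M) [CovariantDerivative.ContMDiffCovariantDerivative cov ∞]

theorem covDerivAlong_eq_zero_iff {V : ℝ → TangentBundle 𝓘(ℝ, E) M} {t : ℝ}
    (hV : MDifferentiableAt 𝓘(ℝ, ℝ) 𝓘(ℝ, E).tangent V t)
    (hsrc : (V t).proj ∈ (extChartAt 𝓘(ℝ, E) p).source)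
    (hU : extChartAt 𝓘(ℝ, E) p (V t).proj ∈ flatDomain (E := E) p) :
    covDerivAlong cov V t = 0 ↔ deriv (fun s => coord p (V s).proj (V s).2) t +
        christoffel cov p (extChartAt 𝓘(ℝ, E) p (V t).proj)
          (deriv (fun s => extChartAt 𝓘(ℝ, E) p (V s).proj) t)
          (coord p (V t).proj (V t).2) = 0 := by
  rw [← coord_covDerivAlong cov hV hsrc hU]
  exact ⟨fun h => by rw [h, map_zero], fun h => coord_injective hsrc (h.trans (map_zero _).symm)⟩

/-- The geodesic equation in the preferred chart at `p`. -/
theorem covDerivAlong_velocity_eq_zero_iff {γ : ℝ → M} {t : ℝ}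
    (hγ : ContMDiffAt 𝓘(ℝ, ℝ) 𝓘(ℝ, E) 2 γ t) (hsrc : γ t ∈ (extChartAt 𝓘(ℝ, E) p).source)
    (hU : extChartAt 𝓘(ℝ, E) p (γ t) ∈ flatDomain (E := E) p) :
    covDerivAlong cov (velocity γ) t = 0 ↔
      deriv (deriv fun s => extChartAt 𝓘(ℝ, E) p (γ s)) t +
        christoffel cov p (extChartAt 𝓘(ℝ, E) p (γ t))
          (deriv (fun s => extChartAt 𝓘(ℝ, E) p (γ s)) t)
          (deriv (fun s => extChartAt 𝓘(ℝ, E) p (γ s)) t) = 0 := by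
  rw [covDerivAlong_eq_zero_iff cov (mdifferentiableAt_velocity hsrc hγ) hsrc hU]
  have h : (fun s => coord p (velocity (E := E) γ s).proj (velocity γ s).2) =ᶠ[𝓝 t]
      deriv fun s => extChartAt 𝓘(ℝ, E) p (γ s) := deriv_chart_curve_eventuallyEq hsrc hγ
  rw [h.deriv_eq, h.eq_of_nhds]
  rfl

/-- A curve that solves the geodesic equation on an interval and agrees to first order with a
geodesic that stays in the chart domain agrees with that geodesic. -/
theorem eqOn_of_geodesic {γ c : ℝ → M} {a b : ℝ} (h0 : (0 : ℝ) ∈ Set.Ioo a b)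
    (hγ : ContMDiffOn 𝓘(ℝ, ℝ) 𝓘(ℝ, E) 2 γ (Set.Ioo a b))
    (hc : ContMDiffOn 𝓘(ℝ, ℝ) 𝓘(ℝ, E) 2 c (Set.Ioo a b))
    (hγ' : ∀ t ∈ Set.Ioo a b, covDerivAlong cov (velocity γ) t = 0)
    (hc' : ∀ t ∈ Set.Ioo a b, covDerivAlong cov (velocity c) t = 0)
    (hsrc : ∀ t ∈ Set.Ioo a b, c t ∈ (extChartAt 𝓘(ℝ, E) p).source)
    (hU : ∀ t ∈ Set.Ioo a b, extChartAt 𝓘(ℝ, E) p (c t) ∈ flatDomain (E := E) p)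
    (hv : velocity (E := E) γ 0 = velocity c 0) : Set.EqOn γ c (Set.Ioo a b) := by
  have hloc : ∀ t ∈ Set.Ioo a b, γ t = c t → deriv (fun s => extChartAt 𝓘(ℝ, E) p (γ s)) t =
      deriv (fun s => extChartAt 𝓘(ℝ, E) p (c s)) t → γ =ᶠ[𝓝 t] c := by
    intro t ht hp hd
    have hn := Ioo_mem_nhds ht.1 ht.2
    have hγt := hγ.contMDiffAt hn
    have hct := hc.contMDiffAt hn
    have hsrct := hsrc t ht
    have hUt := hU t ht
    have hsrcγ : γ t ∈ (extChartAt 𝓘(ℝ, E) p).source := by rwa [hp]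
    have hUγ : extChartAt 𝓘(ℝ, E) p (γ t) ∈ flatDomain (E := E) p := by rwa [hp]
    have hsev : ∀ᶠ s in 𝓝 t, γ s ∈ (extChartAt 𝓘(ℝ, E) p).source :=
      hγt.continuousAt.preimage_mem_nhds ((isOpen_extChartAt_source p).mem_nhds hsrcγ)
    have hUev : ∀ᶠ s in 𝓝 t, extChartAt 𝓘(ℝ, E) p (γ s) ∈ flatDomain (E := E) p :=
      (contDiffAt_chart_curve hsrcγ hγt).continuousAt.preimage_mem_nhds
        (isOpen_flatDomain.mem_nhds hUγ)
    have h := ChartConnection.eventuallyEq_of_geodesic (G := christoffel cov p)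
      (x₁ := fun s => extChartAt 𝓘(ℝ, E) p (γ s)) (x₂ := fun s => extChartAt 𝓘(ℝ, E) p (c s))
      ((contDiffOn_christoffel cov).contDiffAt ((isOpen_extChartAt_target p).mem_nhds
        (flatDomain_subset hUγ))) (contDiffAt_chart_curve hsrcγ hγt)
      (contDiffAt_chart_curve hsrct hct) (by simp only [hp]) hd
      (by
        filter_upwards [hn, hsev, hUev] with s hs hs1 hs2
        exact (covDerivAlong_velocity_eq_zero_iff cov (hγ.contMDiffAt (Ioo_mem_nhds hs.1 hs.2))
          hs1 hs2).1 (hγ' s hs))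
      (by
        filter_upwards [hn] with s hs
        exact (covDerivAlong_velocity_eq_zero_iff cov (hc.contMDiffAt (Ioo_mem_nhds hs.1 hs.2))
          (hsrc s hs) (hU s hs)).1 (hc' s hs))
    filter_upwards [h, hsev, hn] with s hs hs1 hs2
    exact (extChartAt 𝓘(ℝ, E) p).injOn hs1 (hsrc s hs2) hs
  have hsub : Set.Ioo a b ⊆ {t | γ =ᶠ[𝓝 t] c} := by
    refine isPreconnected_Ioo.subset_of_closure_inter_subset
      (isOpen_iff_mem_nhds.2 fun t ht => ht.eventually_nhds) ⟨0, h0, ?_⟩ ?_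
    · have hn := Ioo_mem_nhds h0.1 h0.2
      have hp : γ 0 = c 0 := congrArg TotalSpace.proj hv
      have hsrcγ : γ 0 ∈ (extChartAt 𝓘(ℝ, E) p).source := by rw [hp]; exact hsrc 0 h0
      refine hloc 0 h0 hp ?_
      rw [← (deriv_chart_curve_eventuallyEq hsrcγ (hγ.contMDiffAt hn)).self_of_nhds,
        ← (deriv_chart_curve_eventuallyEq (hsrc 0 h0) (hc.contMDiffAt hn)).self_of_nhds]
      exact congrArg (fun v : TangentBundle 𝓘(ℝ, E) M => coord p v.proj v.2) hv
    · rintro t ⟨htc, ht⟩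
      have hn := Ioo_mem_nhds ht.1 ht.2
      have hγt := hγ.contMDiffAt hn
      have hct := hc.contMDiffAt hn
      rw [mem_closure_iff_frequently] at htc
      have hp : γ t = c t := tendsto_nhds_unique_of_frequently_eq hγt.continuousAt
        hct.continuousAt (htc.mono fun s hs => Filter.EventuallyEq.eq_of_nhds hs)
      have hsrcγ : γ t ∈ (extChartAt 𝓘(ℝ, E) p).source := by rw [hp]; exact hsrc t ht
      refine hloc t ht hp ?_
      refine tendsto_nhds_unique_of_frequently_eq
        (contDiffAt_deriv_chart_curve hsrcγ hγt).continuousAt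
        (contDiffAt_deriv_chart_curve (hsrc t ht) hct).continuousAt (htc.mono fun s hs => ?_)
      have hs' : γ =ᶠ[𝓝 s] c := hs
      exact (hs'.fun_comp (extChartAt 𝓘(ℝ, E) p)).deriv_eq
  exact fun t ht => Filter.EventuallyEq.eq_of_nhds (hsub ht)

end AffineManifold

/-! ### Radial geodesics on the manifold -/

namespace AffineManifold

variable {E : Type*} [NormedAddCommGroup E] [NormedSpace ℝ E]
  {M : Type*} [TopologicalSpace M] [ChartedSpace E M] [IsManifold 𝓘(ℝ, E) ∞ M]
  {p : M}

theorem tangentBundle_ext {V W : TangentBundle 𝓘(ℝ, E) M}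
    (hsrc : V.proj ∈ (extChartAt 𝓘(ℝ, E) p).source) (h : V.proj = W.proj)
    (h' : coord p V.proj V.2 = coord p W.proj W.2) : V = W := by
  obtain ⟨a, v⟩ := V
  obtain ⟨b, w⟩ := W
  obtain rfl : a = b := h
  exact congrArg (TotalSpace.mk a) (coord_injective hsrc h')

/-- The curve in the tangent bundle with base point `x` and components `c` in the preferred chart
at `p`. -/
def lift (p : M) (x c : ℝ → E) (s : ℝ) : TangentBundle 𝓘(ℝ, E) M :=
  ⟨(extChartAt 𝓘(ℝ, E) p).symm (x s), frame p ((extChartAt 𝓘(ℝ, E) p).symm (x s)) (c s)⟩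

theorem contMDiffAt_chart_symm_comp {Q : Type*} [NormedAddCommGroup Q] [NormedSpace ℝ Q]
    {x : Q → E} {t : Q} (hx : ContDiffAt ℝ ∞ x t)
    (ht : x t ∈ (extChartAt 𝓘(ℝ, E) p).target) :
    ContMDiffAt 𝓘(ℝ, Q) 𝓘(ℝ, E) ∞ (fun s => (extChartAt 𝓘(ℝ, E) p).symm (x s)) t :=
  ContMDiffAt.comp t (contMDiffAt_chart_symm ht) hx.contMDiffAt

theorem contMDiffAt_lift {x c : ℝ → E} {t : ℝ} (hx : ContDiffAt ℝ ∞ x t)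
    (hc : ContDiffAt ℝ ∞ c t) (ht : x t ∈ (extChartAt 𝓘(ℝ, E) p).target) :
    ContMDiffAt 𝓘(ℝ, ℝ) 𝓘(ℝ, E).tangent ∞ (lift p x c) t := by
  have hm := (extChartAt 𝓘(ℝ, E) p).map_target ht
  refine ((trivializationAt E (TangentSpace 𝓘(ℝ, E) : M → Type _) p).contMDiffAt_iff
    ((Trivialization.mem_source _).2 (mem_baseSet hm))).2
    ⟨contMDiffAt_chart_symm_comp hx ht, hc.contMDiffAt.congr_of_eventuallyEq ?_⟩
  filter_upwards [hx.continuousAt.preimage_mem_nhds ((isOpen_extChartAt_target p).mem_nhds ht)]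
    with s hs
  have hs' := (extChartAt 𝓘(ℝ, E) p).map_target hs
  exact (coord_apply hs' _).symm.trans (coord_frame hs' _)

variable [FiniteDimensional ℝ E] [T2Space M]
variable {cov : Connection E M} [CovariantDerivative.ContMDiffCovariantDerivative cov ∞]
variable {r : ℝ} {ex : E → E} {P : E → E →L[ℝ] E}

open ChartConnection

/-- `ex` and `P` are the exponential map at `p` and the parallel transport along the radial
geodesics, on the ball of radius `r`, in the preferred chart at `p`. -/
abbrev IsNormalChart (cov : Connection E M) [CovariantDerivative.ContMDiffCovariantDerivative cov ∞]
    (p : M) (r : ℝ) (ex : E → E) (P : E → E →L[ℝ] E) : Prop :=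
  IsExpChart (christoffel cov p) (flatDomain (E := E) p) (extChartAt 𝓘(ℝ, E) p p) r ex P

theorem ex_mem_target (h : IsNormalChart cov p r ex P) {X : E} (hX : X ∈ Metric.ball (0 : E) r) :
    ex X ∈ (extChartAt 𝓘(ℝ, E) p).target := flatDomain_subset (h.mem X hX)

theorem contDiffAt_radial (h : IsNormalChart cov p r ex P) {X : E} {t : ℝ}
    (ht : t • X ∈ Metric.ball (0 : E) r) :
    ContDiffAt ℝ ∞ (fun s : ℝ => ex (s • X)) t :=
  IsExpChart.contDiffAt_comp_smul (h.contDiffAt_ex ht)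

theorem eventually_smul_mem_ball {X : E} {t : ℝ}
    (ht : t • X ∈ Metric.ball (0 : E) r) :
    ∀ᶠ s : ℝ in 𝓝 t, s • X ∈ Metric.ball (0 : E) r :=
  (by fun_prop : ContinuousAt (fun s : ℝ => s • X) t).preimage_mem_nhds
    (Metric.isOpen_ball.mem_nhds ht)

theorem chart_radial_eventuallyEq (h : IsNormalChart cov p r ex P) {X : E} {t : ℝ}
    (ht : t • X ∈ Metric.ball (0 : E) r) :
    (fun s : ℝ => extChartAt 𝓘(ℝ, E) p ((extChartAt 𝓘(ℝ, E) p).symm (ex (s • X)))) =ᶠ[𝓝 t]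
      fun s => ex (s • X) := by
  filter_upwards [eventually_smul_mem_ball ht] with s hs
  exact (extChartAt 𝓘(ℝ, E) p).right_inv (ex_mem_target h hs)

theorem deriv_radial_eventuallyEq (h : IsNormalChart cov p r ex P) {X : E} {t : ℝ}
    (ht : t • X ∈ Metric.ball (0 : E) r) :
    deriv (fun s : ℝ => ex (s • X)) =ᶠ[𝓝 t] fun s => P (s • X) X := by
  filter_upwards [eventually_smul_mem_ball ht] with s hs using (h.hasDerivAt_ex hs).deriv

theorem hasDerivAt_P_apply (h : IsNormalChart cov p r ex P) {X : E} {t : ℝ}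
    (ht : t • X ∈ Metric.ball (0 : E) r) (v : E) :
    HasDerivAt (fun s : ℝ => P (s • X) v)
      (-(christoffel cov p (ex (t • X)) (P (t • X) X) (P (t • X) v))) t := by
  have h1 := (h.hasDerivAt_P isOpen_flatDomain
    ((contDiffOn_christoffel cov).mono flatDomain_subset) ht).clm_apply (hasDerivAt_const t v)
  rw [map_zero, add_zero] at h1
  exact h1

theorem covDerivAlong_velocity_radial (h : IsNormalChart cov p r ex P) {X : E} {t : ℝ}
    (ht : t • X ∈ Metric.ball (0 : E) r) :
    covDerivAlong cov
      (velocity fun s : ℝ => (extChartAt 𝓘(ℝ, E) p).symm (ex (s • X))) t = 0 := by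
  have hT := ex_mem_target h ht
  have hx := chart_radial_eventuallyEq h ht
  have hd := deriv_radial_eventuallyEq h ht
  rw [covDerivAlong_velocity_eq_zero_iff cov
    ((contMDiffAt_chart_symm_comp (contDiffAt_radial h ht) hT).of_le ENat.LEInfty.out)
    ((extChartAt 𝓘(ℝ, E) p).map_target hT)
    (by rw [(extChartAt 𝓘(ℝ, E) p).right_inv hT]; exact h.mem _ ht),
    hx.deriv.deriv_eq, hx.deriv_eq, (extChartAt 𝓘(ℝ, E) p).right_inv hT, hd.deriv_eq,
    (hasDerivAt_P_apply h ht X).deriv, hd.eq_of_nhds]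
  exact neg_add_cancel _

/-- The vector field with components `P (t X) v` is parallel along the radial geodesic. -/
theorem covDerivAlong_lift (h : IsNormalChart cov p r ex P) {X : E} {t : ℝ}
    (ht : t • X ∈ Metric.ball (0 : E) r) (v : E) :
    covDerivAlong cov (lift p (fun s : ℝ => ex (s • X)) fun s => P (s • X) v) t = 0 := by
  have hT := ex_mem_target h ht
  have hx := chart_radial_eventuallyEq h ht
  have hd := deriv_radial_eventuallyEq h ht
  have hm := (extChartAt 𝓘(ℝ, E) p).map_target hT
  have hPv : ContDiffAt ℝ ∞ (fun s : ℝ => P (s • X) v) t :=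
    (IsExpChart.contDiffAt_comp_smul (h.contDiffAt_P ht)).clm_apply contDiffAt_const
  have hc : (fun s : ℝ => coord p (lift p (fun s : ℝ => ex (s • X)) (fun s => P (s • X) v) s).proj
      (lift p (fun s : ℝ => ex (s • X)) (fun s => P (s • X) v) s).2) =ᶠ[𝓝 t]
      fun s => P (s • X) v := by
    filter_upwards [eventually_smul_mem_ball ht] with s hs
    exact coord_frame ((extChartAt 𝓘(ℝ, E) p).map_target (ex_mem_target h hs)) _
  rw [covDerivAlong_eq_zero_iff cov
    ((contMDiffAt_lift (contDiffAt_radial h ht) hPv hT).mdifferentiableAt (by simp)) hm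
    (by
      change extChartAt 𝓘(ℝ, E) p ((extChartAt 𝓘(ℝ, E) p).symm (ex (t • X))) ∈ _
      rw [(extChartAt 𝓘(ℝ, E) p).right_inv hT]; exact h.mem _ ht),
    hc.deriv_eq, (hasDerivAt_P_apply h ht v).deriv, hc.eq_of_nhds]
  change -_ + christoffel cov p (extChartAt 𝓘(ℝ, E) p
    ((extChartAt 𝓘(ℝ, E) p).symm (ex (t • X)))) (deriv (fun s : ℝ => extChartAt 𝓘(ℝ, E) p
      ((extChartAt 𝓘(ℝ, E) p).symm (ex (s • X)))) t) _ = 0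
  rw [hx.deriv_eq, hd.eq_of_nhds, (extChartAt 𝓘(ℝ, E) p).right_inv hT]
  exact neg_add_cancel _

theorem smul_mem_ball {X : E} (hX : X ∈ Metric.ball (0 : E) (r / 2)) {t : ℝ}
    (ht : t ∈ Set.Ioo (-1 : ℝ) (1 + 1)) : t • X ∈ Metric.ball (0 : E) r := by
  rw [mem_ball_zero_iff] at hX ⊢
  have h1 : |t| ≤ 2 := abs_le.2 ⟨by linarith [ht.1], by linarith [ht.2]⟩
  have h2 : ‖t • X‖ ≤ 2 * ‖X‖ := by
    rw [norm_smul, Real.norm_eq_abs]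
    exact mul_le_mul_of_nonneg_right h1 (norm_nonneg X)
  linarith

theorem radial_zero (h : IsNormalChart cov p r ex P) (X : E) :
    (extChartAt 𝓘(ℝ, E) p).symm (ex ((0 : ℝ) • X)) = p := by
  rw [zero_smul, h.ex_zero, extChartAt_to_inv]

theorem velocity_radial_zero (h : IsNormalChart cov p r ex P) (X : E) :
    velocity (E := E) (fun s : ℝ => (extChartAt 𝓘(ℝ, E) p).symm (ex (s • X))) 0 =
      (⟨p, X⟩ : TangentBundle 𝓘(ℝ, E) M) := by
  have h0 : (0 : ℝ) • X ∈ Metric.ball (0 : E) r := by simpa using h.pos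
  have hT := ex_mem_target h h0
  have hm := (extChartAt 𝓘(ℝ, E) p).map_target hT
  refine tangentBundle_ext (p := p) hm (radial_zero h X) ?_
  have h1 := (deriv_chart_curve_eventuallyEq hm ((contMDiffAt_chart_symm_comp
    (contDiffAt_radial h h0) hT).of_le ENat.LEInfty.out)).self_of_nhds
  refine h1.trans ?_
  rw [(chart_radial_eventuallyEq h h0).deriv_eq, (h.hasDerivAt_ex h0).deriv, zero_smul, h.P_zero]
  exact (coord_self (E := E) (p := p) X).symm

/-- For `X` in the ball of radius `r / 2`, the radial curve `t ↦ ex (t X)` is defined for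
`-1 < t < 2` and is the geodesic with initial velocity `X`. -/
theorem isGeodesicFrom_radial (h : IsNormalChart cov p r ex P) {X : E}
    (hX : X ∈ Metric.ball (0 : E) (r / 2)) :
    IsGeodesicFrom cov p X fun s : ℝ => (extChartAt 𝓘(ℝ, E) p).symm (ex (s • X)) := by
  refine ⟨velocity_radial_zero h X, 1, one_pos, fun t ht => ?_, fun t ht => ?_⟩
  · have ht' := smul_mem_ball hX ht
    exact ((contMDiffAt_chart_symm_comp (contDiffAt_radial h ht')
      (ex_mem_target h ht')).of_le ENat.LEInfty.out).contMDiffWithinAt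
  · exact covDerivAlong_velocity_radial h (smul_mem_ball hX ht)

/-- The chosen geodesic is the radial one, by uniqueness. -/
theorem geodesic_eqOn (h : IsNormalChart cov p r ex P) {X : E}
    (hX : X ∈ Metric.ball (0 : E) (r / 2)) :
    ∃ δ > 0, δ ≤ 1 ∧ Set.EqOn (geodesic cov p X)
      (fun s : ℝ => (extChartAt 𝓘(ℝ, E) p).symm (ex (s • X))) (Set.Ioo (-δ) (1 + δ)) := by
  have hex : ∃ γ : ℝ → M, IsGeodesicFrom cov p X γ := ⟨_, isGeodesicFrom_radial h hX⟩
  have hg : IsGeodesicFrom cov p X (geodesic cov p X) := by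
    have h1 : geodesic cov p X = hex.choose := dif_pos hex
    rw [h1]
    exact hex.choose_spec
  obtain ⟨hv, ε, hε, hsm, hcov⟩ := hg
  have hδ : 0 < min ε 1 := lt_min hε one_pos
  have hmem : ∀ t ∈ Set.Ioo (-min ε 1) (1 + min ε 1), t • X ∈ Metric.ball (0 : E) r :=
    fun t ht => smul_mem_ball hX ⟨by linarith [ht.1, min_le_right ε 1],
      by linarith [ht.2, min_le_right ε 1]⟩
  have hsub : Set.Ioo (-min ε 1) (1 + min ε 1) ⊆ Set.Ioo (-ε) (1 + ε) :=
    Set.Ioo_subset_Ioo (by linarith [min_le_left ε 1]) (by linarith [min_le_left ε 1])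
  refine ⟨min ε 1, hδ, min_le_right _ _, eqOn_of_geodesic (p := p) cov
    ⟨by linarith, by linarith⟩ (hsm.mono hsub) (fun t ht => ?_) (fun t ht => hcov t (hsub ht))
    (fun t ht => covDerivAlong_velocity_radial h (hmem t ht))
    (fun t ht => (extChartAt 𝓘(ℝ, E) p).map_target (ex_mem_target h (hmem t ht)))
    (fun t ht => ?_) (hv.trans (velocity_radial_zero h X).symm)⟩
  · exact ((contMDiffAt_chart_symm_comp (contDiffAt_radial h (hmem t ht))
      (ex_mem_target h (hmem t ht))).of_le ENat.LEInfty.out).contMDiffWithinAt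
  · rw [(extChartAt 𝓘(ℝ, E) p).right_inv (ex_mem_target h (hmem t ht))]
    exact h.mem _ (hmem t ht)

theorem expMap_eq (h : IsNormalChart cov p r ex P) {X : E} (hX : X ∈ Metric.ball (0 : E) (r / 2)) :
    expMap cov p X = (extChartAt 𝓘(ℝ, E) p).symm (ex X) := by
  obtain ⟨δ, hδ, -, heq⟩ := geodesic_eqOn h hX
  have h1 := heq (x := 1) ⟨by linarith, by linarith⟩
  simp only [one_smul] at h1
  exact h1

end AffineManifold

/-! ### The backward parallel transport in a chart -/

namespace AffineManifold

variable {E : Type*} [NormedAddCommGroup E] [NormedSpace ℝ E]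
  {M : Type*} [TopologicalSpace M] [ChartedSpace E M] [IsManifold 𝓘(ℝ, E) ∞ M]
  {p : M} [FiniteDimensional ℝ E] [T2Space M]
variable {cov : Connection E M} [CovariantDerivative.ContMDiffCovariantDerivative cov ∞]
variable {r : ℝ} {ex : E → E} {P : E → E →L[ℝ] E}

open ChartConnection

theorem expDomain_mem_nhds (h : IsNormalChart cov p r ex P) : expDomain cov p ∈ 𝓝 0 := by
  have h1 : Metric.ball (0 : E) (r / 2) ∈ 𝓝 (0 : E) := Metric.ball_mem_nhds _ (half_pos h.pos)
  exact Filter.mem_of_superset h1 fun X hX => ⟨_, isGeodesicFrom_radial h hX⟩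

theorem mem_ball_of_half (h : IsNormalChart cov p r ex P) {X : E}
    (hX : X ∈ Metric.ball (0 : E) (r / 2)) : X ∈ Metric.ball (0 : E) r :=
  Metric.ball_subset_ball (by linarith [h.pos]) hX

theorem expMap_mem_source (h : IsNormalChart cov p r ex P) {X : E}
    (hX : X ∈ Metric.ball (0 : E) (r / 2)) :
    expMap cov p X ∈ (extChartAt 𝓘(ℝ, E) p).source := by
  rw [expMap_eq h hX]
  exact (extChartAt 𝓘(ℝ, E) p).map_target (ex_mem_target h (mem_ball_of_half h hX))

/-- Parallel fields along a radial geodesic have the components given by `P`. -/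
theorem coord_of_isParallelAlong (h : IsNormalChart cov p r ex P) {X : E}
    (hX : X ∈ Metric.ball (0 : E) (r / 2)) {V : ℝ → TangentBundle 𝓘(ℝ, E) M}
    (hV : IsParallelAlong cov (geodesic cov p X) V) :
    coord p (V 1).proj (V 1).2 = P X (coord p (V 0).proj (V 0).2) := by
  have : CompleteSpace E := FiniteDimensional.complete ℝ E
  obtain ⟨δ, hδ, hδ1, heq⟩ := geodesic_eqOn h hX
  obtain ⟨ε, hε, hsm, hpar⟩ := hV
  set η := min ε δ with hη
  have hη0 : 0 < η := lt_min hε hδ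
  have hsubε : Set.Ioo (-η) (1 + η) ⊆ Set.Ioo (-ε) (1 + ε) :=
    Set.Ioo_subset_Ioo (by linarith [min_le_left ε δ]) (by linarith [min_le_left ε δ])
  have hsubδ : Set.Ioo (-η) (1 + η) ⊆ Set.Ioo (-δ) (1 + δ) :=
    Set.Ioo_subset_Ioo (by linarith [min_le_right ε δ]) (by linarith [min_le_right ε δ])
  have hball : ∀ t ∈ Set.Ioo (-η) (1 + η), t • X ∈ Metric.ball (0 : E) r := fun t ht =>
    smul_mem_ball hX ⟨by linarith [(hsubδ ht).1], by linarith [(hsubδ ht).2]⟩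
  have hproj : ∀ t ∈ Set.Ioo (-η) (1 + η),
      (V t).proj = (extChartAt 𝓘(ℝ, E) p).symm (ex (t • X)) := fun t ht =>
    (hpar t (hsubε ht)).1.trans (heq (hsubδ ht))
  have hsrc : ∀ t ∈ Set.Ioo (-η) (1 + η), (V t).proj ∈ (extChartAt 𝓘(ℝ, E) p).source := by
    intro t ht
    rw [hproj t ht]
    exact (extChartAt 𝓘(ℝ, E) p).map_target (ex_mem_target h (hball t ht))
  have hchart : ∀ t ∈ Set.Ioo (-η) (1 + η), extChartAt 𝓘(ℝ, E) p (V t).proj = ex (t • X) := by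
    intro t ht
    rw [hproj t ht, (extChartAt 𝓘(ℝ, E) p).right_inv (ex_mem_target h (hball t ht))]
  let c : ℝ → E := fun s => coord p (V s).proj (V s).2
  -- transported back to the origin, the components of a parallel field are constant
  have hderiv : ∀ t ∈ Set.Ioo (-η) (1 + η),
      HasDerivAt (fun s : ℝ => Ring.inverse (P (s • X)) (c s)) 0 t := by
    intro t ht
    have hn := Ioo_mem_nhds ht.1 ht.2
    have hVt : MDifferentiableAt 𝓘(ℝ, ℝ) 𝓘(ℝ, E).tangent V t :=
      (hsm.contMDiffAt (Filter.mem_of_superset hn hsubε)).mdifferentiableAt (by simp)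
    have hcd : DifferentiableAt ℝ c t :=
      ((differentiableAt_coord_curve (hsrc t ht)).1 hVt).2.congr_of_eventuallyEq
        (coord_curve_eventuallyEq hVt (hsrc t ht)).symm
    have hxev : (fun s => extChartAt 𝓘(ℝ, E) p (V s).proj) =ᶠ[𝓝 t] fun s => ex (s • X) := by
      filter_upwards [hn] with s hs using hchart s hs
    have h1 := (covDerivAlong_eq_zero_iff cov hVt (hsrc t ht)
      (by rw [hchart t ht]; exact h.mem _ (hball t ht))).1 (hpar t (hsubε ht)).2
    rw [hxev.deriv_eq, (h.hasDerivAt_ex (hball t ht)).deriv, hchart t ht] at h1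
    have h2 := (h.hasDerivAt_inverse_P isOpen_flatDomain
      ((contDiffOn_christoffel cov).mono flatDomain_subset) (hball t ht)).clm_apply
        hcd.hasDerivAt
    refine h2.congr_deriv ?_
    rw [ContinuousLinearMap.comp_apply, ← map_add, add_comm]
    exact (congrArg _ h1).trans (map_zero _)
  have h01 : Set.Icc (0 : ℝ) 1 ⊆ Set.Ioo (-η) (1 + η) :=
    fun t ht => ⟨by linarith [ht.1], by linarith [ht.2]⟩
  have hconst := constant_of_has_deriv_right_zero
    (f := fun s : ℝ => Ring.inverse (P (s • X)) (c s)) (a := 0) (b := 1)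
    (fun t ht => (hderiv t (h01 ht)).continuousAt.continuousWithinAt)
    (fun t ht => (hderiv t (h01 ⟨ht.1, ht.2.le⟩)).hasDerivWithinAt) 1 ⟨zero_le_one, le_rfl⟩
  simp only [one_smul, zero_smul, h.P_zero, Ring.inverse_one] at hconst
  rw [show (1 : E →L[ℝ] E) (c 0) = c 0 from rfl] at hconst
  change c 1 = P X (c 0)
  rw [← hconst, ← mul_apply_eq_comp,
    Ring.mul_inverse_cancel _ (h.isUnit_P X (mem_ball_of_half h hX))]
  rfl

theorem isRadialTransport_P (h : IsNormalChart cov p r ex P) {X : E}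
    (hX : X ∈ Metric.ball (0 : E) (r / 2)) :
    IsRadialTransport cov p X ((frame p (expMap cov p X)).comp (P X)) := by
  intro v
  obtain ⟨δ, hδ, hδ1, heq⟩ := geodesic_eqOn h hX
  have hball : ∀ t ∈ Set.Ioo (-δ) (1 + δ), t • X ∈ Metric.ball (0 : E) r := fun t ht =>
    smul_mem_ball hX ⟨by linarith [ht.1], by linarith [ht.2]⟩
  refine ⟨lift p (fun s : ℝ => ex (s • X)) (fun s => P (s • X) v), ⟨δ, hδ, fun t ht => ?_,
    fun t ht => ⟨(heq ht).symm, covDerivAlong_lift h (hball t ht) v⟩⟩, ?_, ?_⟩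
  · have hP : ContDiffAt ℝ ∞ (fun s : ℝ => P (s • X) v) t :=
      (IsExpChart.contDiffAt_comp_smul (h.contDiffAt_P (hball t ht))).clm_apply contDiffAt_const
    exact ((contMDiffAt_lift (contDiffAt_radial h (hball t ht)) hP
      (ex_mem_target h (hball t ht))).of_le ENat.LEInfty.out).contMDiffWithinAt
  · have h0 : (0 : ℝ) • X ∈ Metric.ball (0 : E) r := by simpa using h.pos
    have hm := (extChartAt 𝓘(ℝ, E) p).map_target (ex_mem_target h h0)
    refine tangentBundle_ext (p := p) hm (radial_zero h X) ((coord_frame hm _).trans ?_)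
    refine (congrArg (fun L : E →L[ℝ] E => L v)
      (by rw [zero_smul, h.P_zero] : P ((0 : ℝ) • X) = 1)).trans ?_
    exact (coord_self (E := E) (p := p) v).symm
  · have hm := (extChartAt 𝓘(ℝ, E) p).map_target
      (ex_mem_target h (hball 1 ⟨by linarith, by linarith⟩))
    have hm' := expMap_mem_source h hX
    refine tangentBundle_ext (p := p) hm ?_ ((coord_frame hm _).trans ?_)
    · change (extChartAt 𝓘(ℝ, E) p).symm (ex ((1 : ℝ) • X)) = expMap cov p X
      rw [one_smul, expMap_eq h hX]
    · simp only [one_smul]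
      exact (coord_frame hm' _).symm

theorem radialTransport_eq (h : IsNormalChart cov p r ex P) {X : E}
    (hX : X ∈ Metric.ball (0 : E) (r / 2)) :
    radialTransport cov p X = (frame p (expMap cov p X)).comp (P X) := by
  have hex : ∃ L, IsRadialTransport cov p X L := ⟨_, isRadialTransport_P h hX⟩
  have h1 : radialTransport cov p X = hex.choose := dif_pos hex
  have hspec : IsRadialTransport cov p X (radialTransport cov p X) := by
    rw [h1]
    exact hex.choose_spec
  ext v
  obtain ⟨V, hV, hV0, hV1⟩ := hspec v
  have h2 := coord_of_isParallelAlong h hX hV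
  rw [hV0, hV1] at h2
  refine coord_injective (expMap_mem_source h hX) (h2.trans ?_)
  refine Eq.trans ?_ (coord_frame (expMap_mem_source h hX) _).symm
  exact congrArg (P X) (coord_self v)

theorem coord_expDifferential (h : IsNormalChart cov p r ex P) {X : E}
    (hX : X ∈ Metric.ball (0 : E) (r / 2)) (v : E) :
    coord p (expMap cov p X) (expDifferential cov p X v) = fderiv ℝ ex X v := by
  have hXr := mem_ball_of_half h hX
  have hsrc := expMap_mem_source h hX
  have hn := Metric.isOpen_ball.mem_nhds hX
  have hev : (fun Y : E => expMap cov p Y) =ᶠ[𝓝 X] fun Y => (extChartAt 𝓘(ℝ, E) p).symm (ex Y) := by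
    filter_upwards [hn] with Y hY using expMap_eq h hY
  have hd : MDifferentiableAt 𝓘(ℝ, E) 𝓘(ℝ, E) (fun Y : E => expMap cov p Y) X :=
    ((contMDiffAt_chart_symm_comp (h.contDiffAt_ex hXr)
      (ex_mem_target h hXr)).mdifferentiableAt (by simp)).congr_of_eventuallyEq hev
  have h1 : HasFDerivAt (E := E) (F := E) (fun Y => extChartAt 𝓘(ℝ, E) p (expMap cov p Y))
      ((mfderiv 𝓘(ℝ, E) 𝓘(ℝ, E) (extChartAt 𝓘(ℝ, E) p) (expMap cov p X)).comp
        (mfderiv 𝓘(ℝ, E) 𝓘(ℝ, E) (fun Y : E => expMap cov p Y) X)) X :=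
    (HasMFDerivAt.comp X (mdifferentiableAt_chart hsrc).hasMFDerivAt hd.hasMFDerivAt).hasFDerivAt
  have h2 : (fun Y : E => extChartAt 𝓘(ℝ, E) p (expMap cov p Y)) =ᶠ[𝓝 X] ex := by
    filter_upwards [hn] with Y hY
    rw [expMap_eq h hY, (extChartAt 𝓘(ℝ, E) p).right_inv
      (ex_mem_target h (mem_ball_of_half h hY))]
  rw [coord_eq_mfderiv hsrc, ← h2.fderiv_eq]
  have key : ∀ L : E →L[ℝ] E, HasFDerivAt (fun Y : E => extChartAt 𝓘(ℝ, E) p (expMap cov p Y)) L X →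
      L v = fderiv ℝ (fun Y : E => extChartAt 𝓘(ℝ, E) p (expMap cov p Y)) X v :=
    fun L hL => by rw [hL.fderiv]
  exact key _ h1

/-- Near the origin, the backward parallel transport is computed in the preferred chart. -/
theorem backwardTransport_eq (h : IsNormalChart cov p r ex P) {X : E}
    (hX : X ∈ Metric.ball (0 : E) (r / 2)) :
    backwardTransport cov p X = IsExpChart.backward ex P X := by
  have hu := h.isUnit_P X (mem_ball_of_half h hX)
  have hsrc := expMap_mem_source h hX
  have hmul : P X * Ring.inverse (P X) = 1 := Ring.mul_inverse_cancel _ hu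
  have hmul' : Ring.inverse (P X) * P X = 1 := Ring.inverse_mul_cancel _ hu
  have hinv : (radialTransport cov p X).inverse =
      (Ring.inverse (P X)).comp (coord p (expMap cov p X)) := by
    rw [radialTransport_eq h hX]
    refine ContinuousLinearMap.inverse_eq ?_ ?_
    · ext v
      have h1 : P X (Ring.inverse (P X) (coord p (expMap cov p X) v)) =
          coord p (expMap cov p X) v := DFunLike.congr_fun hmul _
      refine (congrArg (frame p (expMap cov p X)) h1).trans (frame_coord hsrc v)
    · ext v
      refine (congrArg (fun w : E => (Ring.inverse (P X) : E →L[ℝ] E) w)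
        (coord_frame hsrc (P X v))).trans ?_
      exact DFunLike.congr_fun hmul' v
  ext v
  refine (DFunLike.congr_fun hinv (expDifferential cov p X v)).trans ?_
  exact congrArg (fun w : E => (Ring.inverse (P X) : E →L[ℝ] E) w) (coord_expDifferential h hX v)

theorem backwardTransport_eventuallyEq (h : IsNormalChart cov p r ex P) :
    (backwardTransport cov p : E → E →L[ℝ] E) =ᶠ[𝓝 (0 : E)] IsExpChart.backward ex P := by
  filter_upwards [Metric.ball_mem_nhds (0 : E) (half_pos h.pos)] with X hX
    using backwardTransport_eq h hX

end AffineManifold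

/-! ### Tensoriality -/

namespace AffineManifold

variable {E : Type*} [NormedAddCommGroup E] [NormedSpace ℝ E]
  {M : Type*} [TopologicalSpace M] [ChartedSpace E M] [IsManifold 𝓘(ℝ, E) ∞ M]

/-- The product of a smooth function and a smooth vector field. -/
def smulField (f : C^∞⟮𝓘(ℝ, E), M; ℝ⟯) (X : VField E M) : VField E M :=
  ⟨fun x => f x • X x, f.contMDiff.smul_section X.contMDiff⟩

/-- The derivative of a smooth function in the direction of a smooth vector field. -/
def dirDeriv (X : VField E M) (f : C^∞⟮𝓘(ℝ, E), M; ℝ⟯) : C^∞⟮𝓘(ℝ, E), M; ℝ⟯ :=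
  ⟨fun x => mfderiv 𝓘(ℝ, E) 𝓘(ℝ, ℝ) f x (X x), fun x => by
    have hx : x ∈ (extChartAt 𝓘(ℝ, E) x).source := mem_extChartAt_source x
    have ht := (extChartAt 𝓘(ℝ, E) x).map_source hx
    have hn := (isOpen_extChartAt_target (I := 𝓘(ℝ, E)) x).mem_nhds ht
    refine (contMDiffAt_iff_chart hx).2 ?_
    refine (((contMDiffAt_iff_chart hx).1 (f.contMDiff x)).fderiv_right (m := ∞)
      (by simp)).clm_apply ((contDiffOn_rep X).contDiffAt hn) |>.congr_of_eventuallyEq ?_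
    filter_upwards [hn] with y hy
    have hm := (extChartAt 𝓘(ℝ, E) x).map_target hy
    have h := mfderiv_eq_chart hm ((f.contMDiff _).mdifferentiableAt (by simp))
      (X ((extChartAt 𝓘(ℝ, E) x).symm y))
    rw [(extChartAt 𝓘(ℝ, E) x).right_inv hy] at h
    exact h⟩

/-- A tensor field that is linear over the smooth functions in each slot. -/
def IsTensorial {n : ℕ} (S : TField E M n) : Prop :=
  ∀ (f : C^∞⟮𝓘(ℝ, E), M; ℝ⟯) (Y : Fin n → VField E M) (i : Fin n) (Z : VField E M),
    S (Function.update Y i (smulField f Z)) = smulField f (S (Function.update Y i Z))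

theorem smulField_add (f : C^∞⟮𝓘(ℝ, E), M; ℝ⟯) (X Y : VField E M) :
    smulField f (X + Y) = smulField f X + smulField f Y := by
  ext x
  exact smul_add (f x) (X x) (Y x)

theorem smulField_sub (f : C^∞⟮𝓘(ℝ, E), M; ℝ⟯) (X Y : VField E M) :
    smulField f (X - Y) = smulField f X - smulField f Y := by
  ext x
  exact smul_sub (f x) (X x) (Y x)

theorem smulField_sum {ι : Type*} (f : C^∞⟮𝓘(ℝ, E), M; ℝ⟯) (s : Finset ι) (X : ι → VField E M) :
    smulField f (∑ i ∈ s, X i) = ∑ i ∈ s, smulField f (X i) :=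
  map_sum (AddMonoidHom.mk' (smulField f) (smulField_add f)) X s

theorem VField.sum_apply {ι : Type*} (s : Finset ι) (X : ι → VField E M) (x : M) :
    (∑ i ∈ s, X i) x = ∑ i ∈ s, X i x :=
  map_sum (AddMonoidHom.mk' (fun X : VField E M => X x) fun _ _ => rfl) X s

section Nabla

variable (cov : Connection E M) [CovariantDerivative.ContMDiffCovariantDerivative cov ∞]

theorem nabla_smulField_left (f : C^∞⟮𝓘(ℝ, E), M; ℝ⟯) (X Y : VField E M) :
    nabla cov (smulField f X) Y = smulField f (nabla cov X Y) := by
  ext x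
  exact map_smul (cov Y x) (f x) (X x)

theorem nabla_smulField_right (f : C^∞⟮𝓘(ℝ, E), M; ℝ⟯) (X Y : VField E M) :
    nabla cov X (smulField f Y) =
      smulField f (nabla cov X Y) + smulField (dirDeriv X f) Y := by
  ext x
  have h := cov.isCovariantDerivativeOnUniv.leibniz (g := f) (Y.mdifferentiableAt x)
    ((f.contMDiff x).mdifferentiableAt (by simp))
  exact DFunLike.congr_fun h (X x)

variable [FiniteDimensional ℝ E]

/-- The covariant derivative of a tensor field that is linear over the smooth functions is so, too:
the terms with the derivative of the function cancel. -/
theorem IsTensorial.covDeriv {n : ℕ} {S : TField E M n} (hS : IsTensorial S) :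
    IsTensorial (covDeriv cov S) := by
  intro f Y i Z
  obtain ⟨X, Y, rfl⟩ : ∃ X Y', Y = Fin.cons X Y' := ⟨Y 0, Fin.tail Y, (Fin.cons_self_tail Y).symm⟩
  refine Fin.cases ?_ (fun i => ?_) i
  · rw [Fin.update_cons_zero, Fin.update_cons_zero, covDeriv_apply, covDeriv_apply,
      nabla_smulField_left, smulField_sub, smulField_sum]
    congr 1
    refine Finset.sum_congr rfl fun j _ => ?_
    rw [nabla_smulField_left, hS]
  · rw [← Fin.cons_update, ← Fin.cons_update, covDeriv_apply, covDeriv_apply, hS,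
      nabla_smulField_right, smulField_sub, smulField_sum]
    have h1 : ∀ j, S (Function.update (Function.update Y i (smulField f Z)) j
        (nabla cov X (Function.update Y i (smulField f Z) j))) =
        smulField f (S (Function.update (Function.update Y i Z) j
          (nabla cov X (Function.update Y i Z j)))) +
        if j = i then smulField (dirDeriv X f) (S (Function.update Y i Z)) else 0 := by
      intro j
      by_cases hj : j = i
      · subst hj
        rw [if_pos rfl, Function.update_self, Function.update_self, Function.update_idem,
          Function.update_idem, nabla_smulField_right, S.map_update_add, hS, hS]
      · rw [if_neg hj, add_zero, Function.update_of_ne hj, Function.update_of_ne hj,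
          Function.update_comm (Ne.symm hj), Function.update_comm (Ne.symm hj), hS]
    rw [Finset.sum_congr rfl fun j _ => h1 j, Finset.sum_add_distrib, Finset.sum_ite_eq',
      if_pos (Finset.mem_univ i)]
    abel

theorem IsTensorial.iterCovDeriv {n : ℕ} {S : TField E M n} (hS : IsTensorial S) (k : ℕ) :
    IsTensorial (iterCovDeriv cov S k) := by
  induction k with
  | zero => exact hS
  | succ k ih => exact ih.covDeriv cov

end Nabla

section Pointwise

variable [FiniteDimensional ℝ E] [T2Space M]

theorem extendL_apply {p z : M} (hz : z ∈ (extChartAt 𝓘(ℝ, E) p).source) (v : E) :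
    extendL p v z = Classical.arbitrary (SmoothBumpFunction 𝓘(ℝ, E) p) z • frame p z v := by
  apply coord_injective hz
  have h := rep_extendL ((extChartAt 𝓘(ℝ, E) p).map_source hz) v
  rw [rep_apply hz, (extChartAt 𝓘(ℝ, E) p).left_inv hz] at h
  rw [h, map_smul, coord_frame hz]

/-- A tensor field that is linear over the smooth functions depends at each point only on the
values of its arguments at that point: near the point, an argument that vanishes there is a
combination of fields with coefficients that vanish there. -/
theorem IsTensorial.eq_zero {n : ℕ} {S : TField E M n} (hS : IsTensorial S)
    {Y : Fin n → VField E M} {i : Fin n} {x : M} (h : Y i x = 0) : S Y x = 0 := by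
  -- `β² Yᵢ` is a combination of the fields `extendL x (b a)`, which are defined everywhere, with
  -- coefficients `f a` that vanish at `x`
  let β := Classical.arbitrary (SmoothBumpFunction 𝓘(ℝ, E) x)
  let b := Module.finBasis ℝ E
  have hg : ∀ a, ContMDiffOn 𝓘(ℝ, E) 𝓘(ℝ, ℝ) ∞
      (fun z => LinearMap.toContinuousLinearMap (b.coord a) (coord x z (Y i z)))
      (chartAt E x).source := by
    intro a z hz
    have hz' : z ∈ (extChartAt 𝓘(ℝ, E) x).source := by simpa using hz
    refine ((contMDiffAt_iff_chart hz').2 ?_).contMDiffWithinAt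
    exact (LinearMap.toContinuousLinearMap (b.coord a)).contDiff.contDiffAt.comp _
      ((contDiffOn_rep (Y i)).contDiffAt ((isOpen_extChartAt_target x).mem_nhds
        ((extChartAt 𝓘(ℝ, E) x).map_source hz')))
  let f : Fin (Module.finrank ℝ E) → C^∞⟮𝓘(ℝ, E), M; ℝ⟯ := fun a =>
    ⟨fun z => β z • LinearMap.toContinuousLinearMap (b.coord a) (coord x z (Y i z)),
      β.contMDiff_smul (hg a)⟩
  let β2 : C^∞⟮𝓘(ℝ, E), M; ℝ⟯ := ⟨fun z => β z * β z, β.contMDiff.mul β.contMDiff⟩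
  have hdec : smulField β2 (Y i) = ∑ a, smulField (f a) (extendL x (b a)) := by
    ext z
    rw [VField.sum_apply]
    change (β z * β z) • Y i z = ∑ a, (β z • b.coord a (coord x z (Y i z))) • extendL x (b a) z
    by_cases hz : z ∈ (extChartAt 𝓘(ℝ, E) x).source
    · simp_rw [extendL_apply hz]
      have h1 : ∑ a, b.coord a (coord x z (Y i z)) • b a = coord x z (Y i z) :=
        b.sum_repr (coord x z (Y i z))
      have h2 : Y i z = ∑ a, b.coord a (coord x z (Y i z)) • frame x z (b a) := by
        conv_lhs => rw [← frame_coord hz (Y i z), ← h1, map_sum]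
        simp only [map_smul]
      conv_lhs => rw [h2, Finset.smul_sum]
      refine Finset.sum_congr rfl fun a _ => ?_
      rw [smul_smul, smul_smul, smul_eq_mul]
      congr 1
      change _ = _ * β z
      ring
    · have h0 : β z = 0 := bump_eq_zero x (by simpa using hz)
      simp [h0]
  have h1 : smulField β2 (S Y) x =
      (∑ a, smulField (f a) (S (Function.update Y i (extendL x (b a))))) x := by
    have h2 := hS β2 Y i (Y i)
    rw [Function.update_eq_self, hdec, MultilinearMap.map_update_sum] at h2
    rw [← h2]
    exact congrArg (fun W : VField E M => W x) (Finset.sum_congr rfl fun a _ => hS _ _ _ _)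
  rw [VField.sum_apply] at h1
  have hβ : β x = 1 := β.eq_one
  have h2 : smulField β2 (S Y) x = S Y x := by
    change (β x * β x) • S Y x = _
    rw [hβ, one_mul, one_smul]
  rw [← h2, h1]
  refine Finset.sum_eq_zero fun a _ => ?_
  change (β x • b.coord a (coord x x (Y i x))) • S _ x = 0
  rw [h, map_zero, map_zero, smul_zero, zero_smul]

theorem rep_smulField (p : M) (f : C^∞⟮𝓘(ℝ, E), M; ℝ⟯) (X : VField E M) (y : E) :
    rep p (smulField f X) y = f ((extChartAt 𝓘(ℝ, E) p).symm y) • rep p X y :=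
  map_smul (coord p ((extChartAt 𝓘(ℝ, E) p).symm y)) _ _

variable (cov : Connection E M) [CovariantDerivative.ContMDiffCovariantDerivative cov ∞]

theorem isTensorial_torsionTensor : IsTensorial (torsionTensor cov) := by
  intro f Y i Z
  ext x
  apply coord_injective (mem_extChartAt_source x)
  rw [← rep_apply (mem_extChartAt_source x), ← rep_apply (mem_extChartAt_source x),
    rep_smulField, rep_torsionTensor cov mem_flatDomain, rep_torsionTensor cov mem_flatDomain]
  rw [ChartConnection.torsionOp_apply, ChartConnection.torsionOp_apply]
  fin_cases i <;> simp [rep_smulField, smul_sub]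

section

variable {G : E → E →L[ℝ] E →L[ℝ] E} {y : E}

theorem curvature_smul₁ (c : ℝ) (v w z : E) : ChartConnection.curvature G y (c • v) w z =
    c • ChartConnection.curvature G y v w z := by
  have h : fderiv ℝ G y (c • v) = c • fderiv ℝ G y v := (fderiv ℝ G y).map_smul c v
  simp only [ChartConnection.curvature, h, map_smul, smul_apply, smul_sub, smul_add]

theorem curvature_smul₂ (c : ℝ) (v w z : E) : ChartConnection.curvature G y v (c • w) z =
    c • ChartConnection.curvature G y v w z := by
  have h : fderiv ℝ G y (c • w) = c • fderiv ℝ G y w := (fderiv ℝ G y).map_smul c w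
  simp only [ChartConnection.curvature, h, map_smul, smul_apply, smul_sub, smul_add]

theorem curvature_smul₃ (c : ℝ) (v w z : E) : ChartConnection.curvature G y v w (c • z) =
    c • ChartConnection.curvature G y v w z := by
  simp only [ChartConnection.curvature, map_smul, smul_sub, smul_add]

end

theorem isTensorial_curvatureTensor : IsTensorial (curvatureTensor cov) := by
  intro f Y i Z
  ext x
  apply coord_injective (mem_extChartAt_source x)
  rw [← rep_apply (mem_extChartAt_source x), ← rep_apply (mem_extChartAt_source x),
    rep_smulField, rep_curvatureTensor cov mem_flatDomain, rep_curvatureTensor cov mem_flatDomain]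
  fin_cases i
  · simp [rep_smulField, curvature_smul₁]
  · simp [rep_smulField, curvature_smul₂]
  · simp [rep_smulField, curvature_smul₃]

end Pointwise

end AffineManifold

/-! ### Iterated covariant derivatives along radial geodesics -/

namespace AffineManifold

variable {E : Type*} [NormedAddCommGroup E] [NormedSpace ℝ E]
  {M : Type*} [TopologicalSpace M] [ChartedSpace E M] [IsManifold 𝓘(ℝ, E) ∞ M]
  {p : M} [FiniteDimensional ℝ E] [T2Space M]

open ChartConnection

/-- A vector field with given smooth components in the preferred chart near a point, obtained by
cutting off. -/
theorem exists_rep_eventuallyEq {w : E → E}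
    (hw : ∀ᶠ y in 𝓝 (extChartAt 𝓘(ℝ, E) p p), ContDiffAt ℝ ∞ w y) :
    ∃ V : VField E M, rep p V =ᶠ[𝓝 (extChartAt 𝓘(ℝ, E) p p)] w := by
  have h1 : ∀ᶠ x in 𝓝 p, x ∈ (extChartAt 𝓘(ℝ, E) p).source ∧
      ContDiffAt ℝ ∞ w (extChartAt 𝓘(ℝ, E) p x) :=
    Filter.Eventually.and (extChartAt_source_mem_nhds (I := 𝓘(ℝ, E)) p)
      ((continuousAt_extChartAt p).eventually hw)
  obtain ⟨u, hu, huo, hpu⟩ := eventually_nhds_iff.1 h1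
  obtain ⟨b, -, hb⟩ := (SmoothBumpFunction.nhds_basis_tsupport (I := 𝓘(ℝ, E)) p).mem_iff.1
    (huo.mem_nhds hpu)
  let σ : Π x : M, TangentSpace 𝓘(ℝ, E) x := fun x => frame p x (w (extChartAt 𝓘(ℝ, E) p x))
  have hrep : ∀ y ∈ (extChartAt 𝓘(ℝ, E) p).target, rep p σ y = w y := by
    intro y hy
    refine (coord_frame ((extChartAt 𝓘(ℝ, E) p).map_target hy) _).trans ?_
    rw [(extChartAt 𝓘(ℝ, E) p).right_inv hy]
  have hσ : ContMDiffOn 𝓘(ℝ, E) (𝓘(ℝ, E).prod 𝓘(ℝ, E)) ∞ (T% σ) u := by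
    intro x hx
    refine ((contMDiffAt_section_iff_rep (hu x hx).1).2 ?_).contMDiffWithinAt
    refine (hu x hx).2.congr_of_eventuallyEq ?_
    filter_upwards [(isOpen_extChartAt_target (I := 𝓘(ℝ, E)) p).mem_nhds
      ((extChartAt 𝓘(ℝ, E) p).map_source (hu x hx).1)] with y hy using hrep y hy
  refine ⟨⟨fun x => b x • σ x,
    ContMDiffOn.smul_section_of_tsupport b.contMDiff.contMDiffOn huo hb hσ⟩, ?_⟩
  have h2 : ∀ᶠ y in 𝓝 (extChartAt 𝓘(ℝ, E) p p), b ((extChartAt 𝓘(ℝ, E) p).symm y) = 1 := by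
    have h3 := (continuousAt_extChartAt_symm (I := 𝓘(ℝ, E)) p).tendsto
    rw [extChartAt_to_inv] at h3
    exact h3.eventually b.eventuallyEq_one
  filter_upwards [h2, extChartAt_target_mem_nhds (I := 𝓘(ℝ, E)) p] with y hy hyt
  refine (map_smul (coord p ((extChartAt 𝓘(ℝ, E) p).symm y)) (b _) _).trans ?_
  rw [hy, one_smul]
  exact hrep y hyt

variable {cov : Connection E M} [CovariantDerivative.ContMDiffCovariantDerivative cov ∞]
variable {r : ℝ} {ex : E → E} {P : E → E →L[ℝ] E}

/-- The local inverse of the exponential map is smooth on a neighbourhood of the base point. -/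
theorem _root_.ChartConnection.IsExpChart.exists_local_inverse
    {G : E → E →L[ℝ] E →L[ℝ] E} {U : Set E} {x₀ : E} (h : IsExpChart G U x₀ r ex P) :
    ∃ l : E → E, (∀ᶠ Z in 𝓝 (0 : E), l (ex Z) = Z) ∧
      ∀ᶠ y in 𝓝 x₀, ContDiffAt ℝ ∞ l y ∧ l y ∈ Metric.ball (0 : E) r := by
  have : CompleteSpace E := FiniteDimensional.complete ℝ E
  have h0 : (0 : E) ∈ Metric.ball (0 : E) r := by simpa using h.pos
  have hex := h.contDiffAt_ex h0
  have hd : HasFDerivAt ex ((ContinuousLinearEquiv.refl ℝ E : E ≃L[ℝ] E) : E →L[ℝ] E) 0 := by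
    have h1 := (hex.differentiableAt (by simp)).hasFDerivAt
    rw [h.fderiv_ex_zero] at h1
    exact h1
  let e := hex.toOpenPartialHomeomorph ex hd (by simp)
  have hs : (0 : E) ∈ e.source := hex.mem_toOpenPartialHomeomorph_source hd (by simp)
  have ht : x₀ ∈ e.target := by
    have h1 := e.map_source hs
    rwa [show e 0 = x₀ from h.ex_zero] at h1
  have hsymm : e.symm x₀ = 0 := by
    have h1 := e.left_inv hs
    rwa [show e 0 = x₀ from h.ex_zero] at h1
  refine ⟨e.symm, ?_, ?_⟩
  · filter_upwards [e.open_source.mem_nhds hs] with Z hZ using e.left_inv hZ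
  · have hu : ∀ᶠ Z in 𝓝 (0 : E), IsUnit (fderiv ℝ ex Z) := by
      have hc : ContinuousAt (fderiv ℝ ex) 0 :=
        (hex.fderiv_right (m := ∞) (by simp)).continuousAt
      refine hc.eventually (Units.isOpen.mem_nhds ?_)
      rw [h.fderiv_ex_zero]
      exact isUnit_one
    have hc : ContinuousAt e.symm x₀ := e.symm.continuousAt ht
    have hc' : Tendsto e.symm (𝓝 x₀) (𝓝 0) := by
      have h2 := hc.tendsto
      rwa [hsymm] at h2
    filter_upwards [e.open_target.mem_nhds ht, hc'.eventually hu,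
      hc'.eventually (Metric.ball_mem_nhds (0 : E) h.pos)] with y hy hyu hyb
    refine ⟨?_, hyb⟩
    have hey := h.contDiffAt_ex hyb
    obtain ⟨L, hL⟩ := hyu
    refine e.contDiffAt_symm (f₀' := ContinuousLinearEquiv.unitsEquiv ℝ E L) hy ?_ hey
    have h3 := (hey.differentiableAt (by simp)).hasFDerivAt
    rw [← hL] at h3
    exact h3

/-- A tangent vector at the base point extends to a vector field that near the base point is
parallel along the radial geodesics. -/
theorem exists_radially_parallel (h : IsNormalChart cov p r ex P) (v : E) :
    ∃ V : VField E M, ∀ᶠ Z in 𝓝 (0 : E), rep p V (ex Z) = P Z v := by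
  obtain ⟨l, hl, hl'⟩ := h.exists_local_inverse
  obtain ⟨V, hV⟩ := exists_rep_eventuallyEq (p := p) (w := fun y => P (l y) v) (by
    filter_upwards [hl'] with y hy
    exact ((h.contDiffAt_P hy.2).comp y hy.1).clm_apply contDiffAt_const)
  refine ⟨V, ?_⟩
  have hc : Tendsto ex (𝓝 0) (𝓝 (extChartAt 𝓘(ℝ, E) p p)) := by
    have h1 := (h.contDiffAt_ex (by simpa using h.pos)).continuousAt.tendsto (x := (0 : E))
    rwa [h.ex_zero] at h1
  filter_upwards [hc.eventually hV, hl] with Z hZ hlZ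
  rw [hZ, hlZ]

/-- The values of a vector field along a radial geodesic, in the preferred chart and transported
back to the base point. -/
def pulledField (p : M) (ex : E → E) (P : E → E →L[ℝ] E) (X : E) (W : VField E M) (t : ℝ) : E :=
  Ring.inverse (P (t • X)) (rep p W (ex (t • X)))

theorem pulledField_zero (h : IsNormalChart cov p r ex P) (X : E) (W : VField E M) :
    pulledField p ex P X W 0 = W p := by
  unfold pulledField
  rw [zero_smul, h.P_zero, h.ex_zero, Ring.inverse_one, rep_apply (mem_extChartAt_source p)]
  exact coord_self (W p)

variable {X : E} {V : VField E M}

theorem tendsto_smul_zero (X : E) : Tendsto (fun t : ℝ => t • X) (𝓝 0) (𝓝 0) := by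
  have h : Continuous fun t : ℝ => t • X := by fun_prop
  simpa using h.tendsto 0

/-- The covariant derivative along a radial geodesic is the derivative of the components with
respect to a parallel frame. -/
theorem hasDerivAt_pulledField (h : IsNormalChart cov p r ex P)
    (hV : ∀ᶠ Z in 𝓝 (0 : E), rep p V (ex Z) = P Z X) (W : VField E M) :
    ∀ᶠ t in 𝓝 (0 : ℝ), HasDerivAt (pulledField p ex P X W)
      (pulledField p ex P X (nabla cov V W) t) t := by
  filter_upwards [h.eventually_smul_mem X, (tendsto_smul_zero X).eventually hV] with t ht hVt
  have hG := (contDiffOn_christoffel (p := p) cov).mono flatDomain_subset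
  have hm := h.mem _ ht
  have h1 : DifferentiableAt ℝ (rep p W) (ex (t • X)) :=
    ((contDiffOn_rep W).contDiffAt ((isOpen_extChartAt_target p).mem_nhds
      (flatDomain_subset hm))).differentiableAt (by simp)
  have h2 := h1.hasFDerivAt.comp_hasDerivAt t (h.hasDerivAt_ex ht)
  have h3 := (h.hasDerivAt_inverse_P isOpen_flatDomain hG ht).clm_apply h2
  refine h3.congr_deriv ?_
  rw [pulledField, rep_nabla cov hm, hVt, map_add, ContinuousLinearMap.comp_apply, add_comm]
  rfl

/-- The point with parameter `t` of the radial geodesic in the direction `X`. -/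
def radialPoint (p : M) (ex : E → E) (X : E) (t : ℝ) : M :=
  (extChartAt 𝓘(ℝ, E) p).symm (ex (t • X))

theorem eq_of_pulledField_eq (h : IsNormalChart cov p r ex P) {t : ℝ}
    (ht : t • X ∈ Metric.ball (0 : E) r) {W W' : VField E M}
    (hW : pulledField p ex P X W t = pulledField p ex P X W' t) :
    W (radialPoint p ex X t) = W' (radialPoint p ex X t) := by
  have h1 := congrArg (P (t • X)) hW
  unfold pulledField at h1
  rw [h.P_inverse_P ht, h.P_inverse_P ht] at h1
  exact coord_injective ((extChartAt 𝓘(ℝ, E) p).map_target (ex_mem_target h ht)) h1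

/-- Radially parallel fields have vanishing covariant derivatives along radial geodesics. -/
theorem nabla_eq_zero_of_parallel (h : IsNormalChart cov p r ex P)
    (hV : ∀ᶠ Z in 𝓝 (0 : E), rep p V (ex Z) = P Z X) {W : VField E M} {v : E}
    (hW : ∀ᶠ Z in 𝓝 (0 : E), rep p W (ex Z) = P Z v) :
    ∀ᶠ t in 𝓝 (0 : ℝ), nabla cov V W (radialPoint p ex X t) = 0 := by
  have h1 : ∀ᶠ t in 𝓝 (0 : ℝ), pulledField p ex P X W t = v := by
    filter_upwards [(tendsto_smul_zero X).eventually hW, h.eventually_smul_mem X] with t ht hb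
    rw [pulledField, ht, h.inverse_P_P hb]
  filter_upwards [h1.eventually_nhds, hasDerivAt_pulledField h hV W,
    h.eventually_smul_mem X] with t ht hd hb
  refine eq_of_pulledField_eq h hb (W' := 0) ?_
  have h2 : HasDerivAt (pulledField p ex P X W) 0 t :=
    (hasDerivAt_const t v).congr_of_eventuallyEq ht
  rw [hd.unique h2]
  refine ((congrArg _ ?_).trans (map_zero (Ring.inverse (P (t • X))))).symm
  exact map_zero (coord p ((extChartAt 𝓘(ℝ, E) p).symm (ex (t • X))))

/-- Evaluated on fields that are parallel along a radial geodesic, the covariant derivative of a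
tensor field is the covariant derivative of its value: the other terms of the product rule
vanish. -/
theorem covDeriv_radialPoint {n : ℕ} {S : TField E M n} (hS : IsTensorial S)
    {Y : Fin n → VField E M}
    (hY : ∀ i, ∀ᶠ t in 𝓝 (0 : ℝ), nabla cov V (Y i) (radialPoint p ex X t) = 0) :
    ∀ᶠ t in 𝓝 (0 : ℝ), covDeriv cov S (Fin.cons V Y) (radialPoint p ex X t) =
      nabla cov V (S Y) (radialPoint p ex X t) := by
  filter_upwards [eventually_all.2 hY] with t ht
  rw [covDeriv_apply]
  have h1 : (∑ i, S (Function.update Y i (nabla cov V (Y i)))) (radialPoint p ex X t) = 0 := by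
    rw [VField.sum_apply]
    refine Finset.sum_eq_zero fun i _ => hS.eq_zero (i := i) ?_
    rw [Function.update_self]
    exact ht i
  exact (congrArg (fun w => nabla cov V (S Y) (radialPoint p ex X t) - w) h1).trans (sub_zero _)

/-- The arguments `(V, …, V, Y₁, …, Yₙ)` of a `k`-fold iterated covariant derivative. -/
def consArgs {n : ℕ} (V : VField E M) (Y : Fin n → VField E M) : (k : ℕ) → Fin (n + k) → VField E M
  | 0 => Y
  | k + 1 => Fin.cons V (consArgs V Y k)

theorem consArgs_update {n : ℕ} (V W : VField E M) (i : Fin n) (k : ℕ) :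
    consArgs V (Function.update (fun _ => V) i W) k =
      Function.update (fun _ => V) (i.addNat k) W := by
  induction k with
  | zero => rfl
  | succ k ih =>
    have h : (fun _ : Fin (n + (k + 1)) => V) =
        (Fin.cons V fun _ : Fin (n + k) => V : Fin (n + k + 1) → VField E M) := by
      funext j
      refine Fin.cases ?_ (fun j => ?_) j <;> rfl
    rw [consArgs, ih, h]
    exact Fin.cons_update _ _ _ _

/-- The derivatives, along a radial geodesic, of a tensor field evaluated on parallel fields, are
its iterated covariant derivatives evaluated on the same fields. -/
theorem iteratedDeriv_pulledField (h : IsNormalChart cov p r ex P)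
    (hV : ∀ᶠ Z in 𝓝 (0 : E), rep p V (ex Z) = P Z X) {n : ℕ} {S : TField E M n}
    (hS : IsTensorial S) {Y : Fin n → VField E M}
    (hY : ∀ i, ∀ᶠ t in 𝓝 (0 : ℝ), nabla cov V (Y i) (radialPoint p ex X t) = 0) (k : ℕ) :
    iteratedDeriv k (pulledField p ex P X (S Y)) =ᶠ[𝓝 0]
      pulledField p ex P X (iterCovDeriv cov S k (consArgs V Y k)) := by
  have hY' : ∀ k i, ∀ᶠ t in 𝓝 (0 : ℝ),
      nabla cov V (consArgs V Y k i) (radialPoint p ex X t) = 0 := by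
    intro k
    induction k with
    | zero => exact hY
    | succ k ih => exact fun i => Fin.cases (nabla_eq_zero_of_parallel h hV hV) ih i
  induction k with
  | zero => rw [iteratedDeriv_zero]; rfl
  | succ k ih =>
    rw [iteratedDeriv_succ]
    filter_upwards [ih.eventually_nhds, hasDerivAt_pulledField h hV
      (iterCovDeriv cov S k (consArgs V Y k)),
      covDeriv_radialPoint (hS.iterCovDeriv cov k) (hY' k)] with t ht hd hc
    rw [Filter.EventuallyEq.deriv_eq ht, hd.deriv]
    exact congrArg (fun w => Ring.inverse (P (t • X)) (coord p (radialPoint p ex X t) w)) hc.symm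

theorem IsTensorial.congr {n : ℕ} {S : TField E M n} (hS : IsTensorial S)
    {Y Y' : Fin n → VField E M} {x : M} (h : ∀ i, Y i x = Y' i x) : S Y x = S Y' x := by
  have key : ∀ s : Finset (Fin n), S (s.piecewise Y Y') x = S Y' x := by
    intro s
    induction s using Finset.induction_on with
    | empty => rw [Finset.piecewise_empty]
    | insert i s hi ih =>
      rw [← ih, Finset.piecewise_insert, ← sub_eq_zero]
      have h1 := S.map_update_sub (s.piecewise Y Y') i (Y i) (Y' i)
      have h2 : Function.update (s.piecewise Y Y') i (Y' i) = s.piecewise Y Y' := by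
        rw [← Finset.piecewise_eq_of_notMem s Y Y' hi, Function.update_eq_self]
      rw [h2] at h1
      refine (congrArg (fun W : VField E M => W x) h1).symm.trans (hS.eq_zero (i := i) ?_)
      rw [Function.update_self]
      exact sub_eq_zero.2 (h i)
  rw [← key Finset.univ, Finset.piecewise_univ]

/-- The endomorphism `slotEnd` at a point may be computed with any vector fields that extend the
given tangent vectors. -/
theorem IsTensorial.slotEnd_apply {n : ℕ} {S : TField E M n} (hS : IsTensorial S) (i : Fin n)
    {W : VField E M} {X Y : TangentSpace 𝓘(ℝ, E) p} (hV : V p = X) (hW : W p = Y) :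
    slotEnd (S.evalAt p) i X Y = S (Function.update (fun _ => V) i W) p := by
  change S (fun j => extendVector p (Function.update (fun _ => X) i Y j)) p = _
  refine hS.congr fun j => ?_
  rw [extendVector_apply_self]
  by_cases hj : j = i
  · subst hj
    rw [Function.update_self, Function.update_self, hW]
  · rw [Function.update_of_ne hj, Function.update_of_ne hj, hV]

theorem iteratedDeriv_clm_apply {F F' : Type*} [NormedAddCommGroup F] [NormedSpace ℝ F]
    [NormedAddCommGroup F'] [NormedSpace ℝ F'] {L : ℝ → F →L[ℝ] F'} {t : ℝ}
    (hL : ContDiffAt ℝ ∞ L t) (k : ℕ) (v : F) :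
    iteratedDeriv k (fun s => L s v) t = iteratedDeriv k L t v := by
  rw [iteratedDeriv_eq_iteratedFDeriv, iteratedDeriv_eq_iteratedFDeriv]
  have h1 := (ContinuousLinearMap.apply ℝ F' v).iteratedFDeriv_comp_left (f := L) (x := t)
    (hL.of_le (by exact_mod_cast le_top)) (i := k) le_rfl
  exact DFunLike.congr_fun h1 _

theorem apply_eq_of_rep (h : IsNormalChart cov p r ex P) {v : E}
    (hV : ∀ᶠ Z in 𝓝 (0 : E), rep p V (ex Z) = P Z v) : V p = v := by
  have h1 := hV.self_of_nhds
  rw [h.ex_zero, h.P_zero, rep_apply (mem_extChartAt_source p)] at h1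
  exact (coord_self (V p)).symm.trans h1

/-- Let `S` be a tensor field, and `T` the operator that it gives along a radial geodesic,
transported back to the base point. The derivatives of `T` are given by the iterated covariant
derivatives of `S`, as one sees on parallel fields. The slot `i` of `S` becomes the slot
`i + k` of `∇ᵏS`, whose first `k` slots are the directions of differentiation. -/
theorem iteratedDeriv_eq_slotEnd (h : IsNormalChart cov p r ex P) {n : ℕ} {S : TField E M n}
    (hS : IsTensorial S) (i : Fin n) {T : ℝ → E →L[ℝ] E} (hT : ContDiffAt ℝ ∞ T 0)
    (hTS : ∀ (V W : VField E M) (Y : E), (∀ᶠ Z in 𝓝 (0 : E), rep p V (ex Z) = P Z X) →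
      (∀ᶠ Z in 𝓝 (0 : E), rep p W (ex Z) = P Z Y) →
      ∀ᶠ t in 𝓝 (0 : ℝ), T t Y = pulledField p ex P X (S (Function.update (fun _ => V) i W)) t)
    (k : ℕ) :
    iteratedDeriv k T 0 = slotEnd ((iterCovDeriv cov S k).evalAt p) (i.addNat k) X := by
  ext Y
  obtain ⟨V, hV⟩ := exists_radially_parallel h X
  obtain ⟨W, hW⟩ := exists_radially_parallel h Y
  have hY : ∀ j, ∀ᶠ t in 𝓝 (0 : ℝ),
      nabla cov V (Function.update (fun _ => V) i W j) (radialPoint p ex X t) = 0 := by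
    intro j
    by_cases hj : j = i
    · subst hj
      rw [Function.update_self]
      exact nabla_eq_zero_of_parallel h hV hW
    · rw [Function.update_of_ne hj]
      exact nabla_eq_zero_of_parallel h hV hV
  have h1 := (iteratedDeriv_pulledField h hV hS hY k).self_of_nhds
  have h2 : (fun t => T t Y) =ᶠ[𝓝 0] _ := hTS V W Y hV hW
  rw [← iteratedDeriv_clm_apply hT, h2.iteratedDeriv_eq, h1, pulledField_zero h, consArgs_update]
  exact ((hS.iterCovDeriv cov k).slotEnd_apply _ (apply_eq_of_rep h hV)
    (apply_eq_of_rep h hW)).symm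

theorem iteratedDeriv_pulledTorsionOp (h : IsNormalChart cov p r ex P) (X : E) (k : ℕ) :
    iteratedDeriv k (IsExpChart.pulledTorsionOp (christoffel cov p) ex P X) 0 =
      slotEnd ((iterCovDeriv cov (torsionTensor cov) k).evalAt p)
        ((1 : Fin 2).addNat k) X := by
  refine iteratedDeriv_eq_slotEnd h (isTensorial_torsionTensor cov) 1
    (h.contDiffAt_pulledTorsionOp isOpen_flatDomain
      ((contDiffOn_christoffel cov).mono flatDomain_subset) X) ?_ k
  intro V W Y hV hW
  filter_upwards [h.eventually_smul_mem X, (tendsto_smul_zero X).eventually hV,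
    (tendsto_smul_zero X).eventually hW] with t ht hVt hWt
  rw [pulledField, rep_torsionTensor cov (h.mem _ ht), Function.update_self,
    Function.update_of_ne (by decide), hVt, hWt]
  rfl

theorem iteratedDeriv_pulledCurvatureOp (h : IsNormalChart cov p r ex P) (X : E) (k : ℕ) :
    iteratedDeriv k (IsExpChart.pulledCurvatureOp (christoffel cov p) ex P X) 0 =
      slotEnd ((iterCovDeriv cov (curvatureTensor cov) k).evalAt p)
        ((1 : Fin 3).addNat k) X := by
  refine iteratedDeriv_eq_slotEnd h (isTensorial_curvatureTensor cov) 1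
    (h.contDiffAt_pulledCurvatureOp isOpen_flatDomain
      ((contDiffOn_christoffel cov).mono flatDomain_subset) X) ?_ k
  intro V W Y hV hW
  filter_upwards [h.eventually_smul_mem X, (tendsto_smul_zero X).eventually hV,
    (tendsto_smul_zero X).eventually hW] with t ht hVt hWt
  rw [pulledField, rep_curvatureTensor cov (h.mem _ ht), Function.update_self,
    Function.update_of_ne (by decide), Function.update_of_ne (by decide), hVt, hWt]
  rfl

end AffineManifold

/-! ### The power series equation -/

namespace FormalSeries

section Recursion

variable {V W : Type*} [AddCommGroup V] [Module ℝ V] [Ring W] [Algebra ℝ W]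

theorem coeff_mul (F G : FormalSeries V W) (k : ℕ) (X : V) :
    (F * G).coeff k X =
      ∑ ij ∈ Finset.HasAntidiagonal.antidiagonal k, F.coeff ij.1 X * G.coeff ij.2 X := rfl

theorem coeff_number_number_add (F : FormalSeries V W) (k : ℕ) (X : V) :
    (F.number + F).number.coeff k X = ((k : ℝ) * (k + 1)) • F.coeff k X := by
  change (k : ℝ) • ((k : ℝ) • F.coeff k X + F.coeff k X) = _
  rw [mul_smul, add_smul, one_smul]

theorem coeff_zero_apply (F : FormalSeries V W) (X : V) : F.coeff 0 X = F.coeff 0 0 := by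
  obtain ⟨m, hm⟩ := F.homogeneous 0
  rw [hm, hm]
  exact congrArg m (Subsingleton.elim _ _)

/-- The equation `N (N + 1) F = R F + N (T F)` determines `F` from its constant term when `R` and
`T` have no constant terms, as it then expresses `k (k + 1)` times the component of degree `k` by
the components of lower degree. -/
theorem eq_of_number_equation {R T F G : FormalSeries V W} (hR : ∀ X, R.coeff 0 X = 0)
    (hT : ∀ X, T.coeff 0 X = 0) (h0 : F.coeff 0 0 = G.coeff 0 0)
    (hF : (F.number + F).number = R * F + (T * F).number)
    (hG : (G.number + G).number = R * G + (T * G).number) : F = G := by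
  have hcoeff : ∀ k X, F.coeff k X = G.coeff k X := by
    intro k
    induction k using Nat.strong_induction_on with
    | _ k ih =>
      intro X
      rcases Nat.eq_zero_or_pos k with rfl | hk
      · rw [F.coeff_zero_apply, G.coeff_zero_apply, h0]
      have hsum : ∀ S : FormalSeries V W, (∀ X, S.coeff 0 X = 0) →
          (S * F).coeff k X = (S * G).coeff k X := by
        intro S hS
        rw [coeff_mul, coeff_mul]
        refine Finset.sum_congr rfl fun ij hij => ?_
        rcases Nat.eq_zero_or_pos ij.1 with h | h
        · simp only [h, hS, zero_mul]
        · rw [ih ij.2 (by rw [Finset.HasAntidiagonal.mem_antidiagonal] at hij; omega)]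
      have h1 := congrArg (fun H : FormalSeries V W => H.coeff k X) hF
      have h2 := congrArg (fun H : FormalSeries V W => H.coeff k X) hG
      simp only [coeff_number_number_add] at h1 h2
      have h3 : (R * F + (T * F).number).coeff k X = (R * G + (T * G).number).coeff k X := by
        change (R * F).coeff k X + (k : ℝ) • (T * F).coeff k X =
          (R * G).coeff k X + (k : ℝ) • (T * G).coeff k X
        rw [hsum R hR, hsum T hT]
      have hk0 : ((k : ℝ) * (k + 1)) ≠ 0 := by positivity
      exact smul_right_injective W hk0 (h1.trans (h3.trans h2.symm))
  ext k X
  exact hcoeff k X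

end Recursion

/-- The component of degree `k` of the Taylor series of `f` is given by the derivatives of `f` along
the lines through the origin. -/
theorem coeff_taylor_eq_iteratedDeriv {V W : Type*} [NormedAddCommGroup V] [NormedSpace ℝ V]
    [NormedAddCommGroup W] [NormedSpace ℝ W] {f : V → W} (hf : ContDiffAt ℝ ∞ f 0) (k : ℕ) (X : V) :
    (taylor f).coeff k X = (k ! : ℝ)⁻¹ • iteratedDeriv k (fun t : ℝ => f (t • X)) 0 := by
  change (k ! : ℝ)⁻¹ • iteratedFDeriv ℝ k f 0 (fun _ => X) = _
  congr 1
  obtain ⟨u, hu, hfu⟩ := (contDiffAt_infty.1 hf k).contDiffOn le_rfl (by simp)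
  obtain ⟨s, hsu, hs, h0s⟩ := mem_nhds_iff.1 hu
  let g : ℝ →L[ℝ] V := ContinuousLinearMap.toSpanSingleton ℝ X
  have hg : ∀ t, g t = t • X := fun t => rfl
  have hg0 : g 0 = 0 := by simp
  have hs' : IsOpen (g ⁻¹' s) := hs.preimage g.continuous
  have h0 : (0 : ℝ) ∈ g ⁻¹' s := by rw [Set.mem_preimage, hg0]; exact h0s
  have h1 := g.iteratedFDerivWithin_comp_right (hfu.mono hsu) hs.uniqueDiffOn
    hs'.uniqueDiffOn (x := 0) (by rw [hg0]; exact h0s) (i := k) le_rfl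
  rw [iteratedFDerivWithin_of_isOpen k hs' h0, hg0, iteratedFDerivWithin_of_isOpen k hs h0s] at h1
  have h2 : (fun t : ℝ => f (t • X)) = f ∘ g := by
    funext t
    exact congrArg f (hg t).symm
  rw [h2, iteratedDeriv_eq_iteratedFDeriv, h1]
  simp [g]

end FormalSeries

namespace AffineManifold

variable {E : Type*} [NormedAddCommGroup E] [NormedSpace ℝ E]
  {M : Type*} [TopologicalSpace M] [ChartedSpace E M] [IsManifold 𝓘(ℝ, E) ∞ M]
  {p : M} [FiniteDimensional ℝ E] [T2Space M]
variable {cov : Connection E M} [CovariantDerivative.ContMDiffCovariantDerivative cov ∞]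
variable {r : ℝ} {ex : E → E} {P : E → E →L[ℝ] E}

open ChartConnection

theorem contDiffAt_backwardTransport (h : IsNormalChart cov p r ex P) :
    ContDiffAt ℝ ∞ (E := E) (F := E →L[ℝ] E) (backwardTransport cov p) 0 :=
  (h.contDiffAt_backward (by simpa using h.pos)).congr_of_eventuallyEq
    (backwardTransport_eventuallyEq h)

theorem coeff_torsionSeries (h : IsNormalChart cov p r ex P) (k : ℕ) (X : E) :
    (torsionSeries cov p).coeff k X = PowerSeries.coeff k (PowerSeries.X *
      TaylorSeries.taylor (IsExpChart.pulledTorsionOp (christoffel cov p) ex P X)) := by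
  rcases k with _ | k
  · exact (PowerSeries.coeff_zero_X_mul _).symm
  · refine Eq.trans ?_ ((PowerSeries.coeff_succ_X_mul k _).trans
      ((TaylorSeries.coeff_taylor _ k).trans
        (congrArg _ (iteratedDeriv_pulledTorsionOp h X k)))).symm
    refine congrArg (fun i => (k ! : ℝ)⁻¹ •
        slotEnd ((iterCovDeriv cov (torsionTensor cov) k).evalAt p) i X) (Fin.ext ?_)
    exact Nat.add_comm k 1

theorem coeff_curvatureSeries (h : IsNormalChart cov p r ex P) (k : ℕ) (X : E) :
    (curvatureSeries cov p).coeff k X = PowerSeries.coeff k (PowerSeries.X ^ 2 *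
      TaylorSeries.taylor (IsExpChart.pulledCurvatureOp (christoffel cov p) ex P X)) := by
  have hsq (f : PowerSeries (E →L[ℝ] E)) :
      PowerSeries.X ^ 2 * f = PowerSeries.X * (PowerSeries.X * f) := by rw [pow_two, mul_assoc]
  refine Eq.trans ?_ (congrArg (PowerSeries.coeff k) (hsq _)).symm
  rcases k with _ | _ | k
  · exact (PowerSeries.coeff_zero_X_mul _).symm
  · exact ((PowerSeries.coeff_succ_X_mul 0 _).trans (PowerSeries.coeff_zero_X_mul _)).symm
  · refine Eq.trans ?_ ((PowerSeries.coeff_succ_X_mul (k + 1) _).trans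
      ((PowerSeries.coeff_succ_X_mul k _).trans ((TaylorSeries.coeff_taylor _ k).trans
        (congrArg _ (iteratedDeriv_pulledCurvatureOp h X k))))).symm
    refine congrArg (fun i => (k ! : ℝ)⁻¹ •
        slotEnd ((iterCovDeriv cov (curvatureTensor cov) k).evalAt p) i X) (Fin.ext ?_)
    exact Nat.add_comm k 1

theorem coeff_backwardTransportSeries (h : IsNormalChart cov p r ex P) (k : ℕ) (X : E) :
    (backwardTransportSeries cov p).coeff k X = PowerSeries.coeff k
      (TaylorSeries.taylor fun s : ℝ => IsExpChart.backward ex P (s • X)) := by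
  refine (FormalSeries.coeff_taylor_eq_iteratedDeriv (contDiffAt_backwardTransport h) k X).trans ?_
  rw [TaylorSeries.coeff_taylor]
  exact congrArg _ (Filter.EventuallyEq.iteratedDeriv_eq k
    ((tendsto_smul_zero X).eventually (backwardTransport_eventuallyEq h)))

theorem backwardTransportSeries_coeff_zero (h : IsNormalChart cov p r ex P) :
    (backwardTransportSeries cov p).coeff 0 0 =
      ContinuousLinearMap.id ℝ (TangentSpace 𝓘(ℝ, E) p) := by
  refine (coeff_backwardTransportSeries h 0 0).trans ?_
  rw [TaylorSeries.coeff_taylor, iteratedDeriv_zero]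
  simp only [Nat.factorial_zero, Nat.cast_one, inv_one, one_smul, smul_zero, IsExpChart.backward,
    h.P_zero, Ring.inverse_one, one_mul]
  exact h.fderiv_ex_zero

/-- At `X`, the component of degree `k` of the equation is the coefficient of `tᵏ` in `t` times the
Jacobi equation along the radial geodesic with initial velocity `X`. -/
theorem backwardTransportSeries_equation (h : IsNormalChart cov p r ex P) :
    ((backwardTransportSeries cov p).number + backwardTransportSeries cov p).number =
      curvatureSeries cov p * backwardTransportSeries cov p +
        (torsionSeries cov p * backwardTransportSeries cov p).number := by
  have h0 (X : E) : (0 : ℝ) • X ∈ Metric.ball (0 : E) r := by simpa using h.pos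
  have hG := (contDiffOn_christoffel (p := p) cov).mono flatDomain_subset
  have key (k : ℕ) (X : E) :
      ((backwardTransportSeries cov p).number + backwardTransportSeries cov p).number.coeff k X =
        (curvatureSeries cov p * backwardTransportSeries cov p +
          (torsionSeries cov p * backwardTransportSeries cov p).number).coeff k X := by
    refine (FormalSeries.coeff_number_number_add _ k X).trans ?_
    have h1 := TaylorSeries.coeff_taylor_of_jacobi
      (IsExpChart.contDiffAt_comp_smul (h.contDiffAt_backward (h0 X)))
      (h.contDiffAt_pulledCurvatureOp isOpen_flatDomain hG X)
      (h.contDiffAt_pulledTorsionOp isOpen_flatDomain hG X)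
      (h.deriv_backward isOpen_flatDomain hG X) k
    let b : ℕ → E →L[ℝ] E := fun j => (backwardTransportSeries cov p).coeff j X
    let ρ : ℕ → E →L[ℝ] E := fun j => (curvatureSeries cov p).coeff j X
    let τ : ℕ → E →L[ℝ] E := fun j => (torsionSeries cov p).coeff j X
    have hb : ∀ j, _ = b j := fun j => (coeff_backwardTransportSeries h j X).symm
    have hρ : ∀ j, PowerSeries.coeff j (PowerSeries.X ^ 2 *
        TaylorSeries.taylor (IsExpChart.pulledCurvatureOp (christoffel cov p) ex P X)) = ρ j :=
      fun j => (coeff_curvatureSeries h j X).symm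
    have hτ : ∀ j, PowerSeries.coeff j (PowerSeries.X *
        TaylorSeries.taylor (IsExpChart.pulledTorsionOp (christoffel cov p) ex P X)) = τ j :=
      fun j => (coeff_torsionSeries h j X).symm
    rw [PowerSeries.coeff_mul, PowerSeries.coeff_mul, hb] at h1
    simp only [hb, hρ, hτ] at h1
    exact h1
  exact FormalSeries.ext (funext fun k => funext fun X => key k X)

end AffineManifold

theorem mainTheorem4 {E : Type*} [NormedAddCommGroup E] [NormedSpace ℝ E] [FiniteDimensional ℝ E]
    {M : Type*} [TopologicalSpace M] [T2Space M] [ChartedSpace E M] [IsManifold 𝓘(ℝ, E) ∞ M]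
    (cov : AffineManifold.Connection E M) [CovariantDerivative.ContMDiffCovariantDerivative cov ∞]
    (p : M) :
    AffineManifold.expDomain cov p ∈ 𝓝 0 ∧
    ContDiffAt ℝ ∞ (E := E) (F := E →L[ℝ] E) (AffineManifold.backwardTransport cov p) 0 ∧
    ∀ F : FormalSeries (TangentSpace 𝓘(ℝ, E) p)
        (TangentSpace 𝓘(ℝ, E) p →L[ℝ] TangentSpace 𝓘(ℝ, E) p),
      F = AffineManifold.backwardTransportSeries cov p ↔
        F.coeff 0 0 = ContinuousLinearMap.id ℝ (TangentSpace 𝓘(ℝ, E) p) ∧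
        (F.number + F).number =
          AffineManifold.curvatureSeries cov p * F +
            (AffineManifold.torsionSeries cov p * F).number := by
  obtain ⟨r, ex, P, h⟩ := ChartConnection.exists_isExpChart AffineManifold.isOpen_flatDomain
    (AffineManifold.mem_flatDomain (p := p))
    ((AffineManifold.contDiffOn_christoffel (p := p) cov).mono AffineManifold.flatDomain_subset)
  have h : AffineManifold.IsNormalChart cov p r ex P := h
  refine ⟨AffineManifold.expDomain_mem_nhds h, AffineManifold.contDiffAt_backwardTransport h,
    fun F => ⟨?_, fun hF => ?_⟩⟩
  · rintro rfl
    exact ⟨AffineManifold.backwardTransportSeries_coeff_zero h,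
      AffineManifold.backwardTransportSeries_equation h⟩
  · exact FormalSeries.eq_of_number_equation (fun _ => rfl) (fun _ => rfl)
      (hF.1.trans (AffineManifold.backwardTransportSeries_coeff_zero h).symm) hF.2
      (AffineManifold.backwardTransportSeries_equation h)

end
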